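/- **Setting.** Let $\Lambda\in\mathbb R$, $\Omega_0(X)=1+\frac{\Lambda}{12}|X|^2$ for $X=(X^2,X^3)=(X,Y)\in\mathbb R^2$, and $P=\{X\in\mathbb R^2:\Omega_0(X)>0\}$ (so $P=\mathbb R^2$ for $\Lambda\ge 0$). For a real function $H$ on the plane, smooth on $P$, consider the nonexpanding impulsive wave metric in continuous form, in coordinates $(U,V,X,Y)$ with $U_+=\max(U,0)$, $$ds^2=\omega^{-2}\big[g_{ij}\,dX^i dX^j-2\,dU\,dV\big],\qquad g_{ij}=\delta_{ij}+2U_+H_{,ij}+U_+^2\,\delta^{kl}H_{,ik}H_{,jl},$$ $$\omega=1+\tfrac{\Lambda}{12}\big(\delta_{ij}X^iX^j-2UV-2U_+G\big),\qquad G=H-X^iH_{,i},$$ on the open set where $\Omega_0>0$, $\omega>0$ and $\det(g_{ij})\neq0$. *The complete background.* Let $M_\Lambda$ be the set of $(\tilde U,\tilde V,Z_2,Z_3,z)\in\mathbb R^5$ with $z^2+\frac{\Lambda}{3}(Z_2^2+Z_3^2-2\tilde U\tilde V)=1$, and $z=1$ if $\Lambda=0$. With the metric $dZ_2^2+dZ_3^2-2d\tilde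 Ud\tilde V+\frac3\Lambda dz^2$ (last term absent if $\Lambda=0$) it is de Sitter space, Minkowski space or the anti-de Sitter hyperboloid for $\Lambda>0$, $=0$, $<0$. Around each of the poles $z=\pm1$ (only $z=1$ if $\Lambda=0$) it has the conformally flat coordinates $(\mathcal U,\mathcal V,x,y)$ given by $\tilde U=\mathcal U/\Omega$, $\tilde V=\mathcal V/\Omega$, $Z_2=x/\Omega$, $Z_3=y/\Omega$, $z=\pm(2/\Omega-1)$, where $\Omega=1+\frac{\Lambda}{12}(x^2+y^2-2\,\mathcal U\mathcal V)>0$. *The impulsive wave spacetime.* It consists of the halves $\{\tilde U\le0\}$ and $\{\tilde U\ge0\}$ of $M_\Lambda$, joined along the wave surface $\{\tilde U=0\}$ by means of the continuous coordinates $(U,V,X,Y)$. These are related to the conformally flat coordinates centred at the same pole by the identity for $U\le0$ and by $$\mathcal U=U,\quad \mathcal V=V+H+\tfrac12U\big(H_{,X}^2+H_{,Y}^2\big),\quad x=X+UH_{,X},\quad y=Y+UH_{,Y}$$ for $U>0$ (at $U=0$ the limits from the two sides are identified). The profile in the coordinates centred at $z=1$ is $H$ and the profile in those centred at $z=-1$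 is $H_s$. Both are assumed smooth on $P$. For $\Lambda>0$ they represent one function on the spherical wave surface, i.e. $$H_s(X)=\tfrac{\Lambda}{12}|X|^2\,H\Big(\frac{12\,X}{\Lambda|X|^2}\Big)\qquad(X\neq0).$$ For $\Lambda=0$ there is no second pole and $H_s$ plays no role; for $\Lambda<0$ the functions $H$ and $H_s$ are the (independent) profiles on the two sheets $z\ge1$ and $z\le-1$ of the hyperboloidal wave surface. The charts are the continuous coordinates (with the metric above) and, on $\tilde U\neq0$, the conformally flat coordinates (with the background metric). *Filippov geodesics.* For $f:D\subseteq\mathbb R^d\to\mathbb R^d$ let $\mathcal F[f](x)=\bigcap_{\delta>0}\bigcap_{\mu(S)=0}\overline{\mathrm{co}}\,f(B_\delta(x)\setminus S)$, with $\mu$ the Lebesgue measure. A Filippov solution of $\dot W=f(W)$ on an interval is a curve that is absolutely continuous on compact subintervals with $\dot W\in\mathcal F[f](W)$ almost everywhere. A curve in the spacetime is a *geodesic in the sense of Filippov* if near every parameter value it is, in one of the charts, the position component of a Filippov solution of the geodesic equation $\ddot x^\mu=-\Gamma^\mu_{\nu\rho}\dot x^\nu\dot x^\rho$ of the metric of this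 chart, written as a first order system for $(x,\dot x)$. **Theorem.** Let $p$ be a point of the impulsive wave spacetime off the wave surface $\{\tilde U=0\}$ and $v$ a tangent vector at $p$. Then there is a geodesic $\gamma$ in the sense of Filippov with $\gamma(0)=p$, $\dot\gamma(0)=v$ that is defined for all values $\tau\in\mathbb R$ of its parameter (so it is complete) and is a $C^1$-curve. It is unique: every geodesic in the sense of Filippov on any interval $I\ni0$ with the same initial data coincides with $\gamma$ on $I$. -/

import Mathlib

open Set MeasureTheory
open scoped ContDiff

noncomputable section

/-! ### Filippov solutions of autonomous ordinary differential equations -/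

section Filippov

variable {E : Type*} [NormedAddCommGroup E] [NormedSpace ℝ E] [MeasureSpace E]

/-- The Filippov set-valued map of `f : D → E`: the intersection, over all `δ > 0` and all null
sets `S`, of the closed convex hulls of `f (B_δ(x) \ S)`. (Balls of equivalent norms are nested in
each other, so the choice of the norm on a finite-dimensional space is immaterial.) -/
def filippovMap (D : Set E) (f : E → E) (x : E) : Set E :=
  ⋂ (δ : ℝ) (_ : 0 < δ) (S : Set E) (_ : volume S = 0),
    closure (convexHull ℝ (f '' ((Metric.closedBall x δ ∩ D) \ S)))

/-- `W` is a Filippov solution of `W' = f(W)`, `f : D → E`, on the interval `J`: it is absolutely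
continuous on every compact subinterval and satisfies the differential inclusion
`W' ∈ F[f](W)` almost everywhere. -/
structure IsFilippovSolutionOn (D : Set E) (f : E → E) (J : Set ℝ) (W : ℝ → E) : Prop where
  mem : ∀ t ∈ J, W t ∈ D
  absCont : ∀ a ∈ J, ∀ b ∈ J, AbsolutelyContinuousOnInterval W a b
  inclusion : ∀ᵐ t : ℝ, t ∈ J → ∃ d ∈ filippovMap D f (W t), HasDerivAt W d t

end Filippov

namespace ImpulsiveWave

/-- Four coordinates `(U, V, X, Y)`, numbered `0, 1, 2, 3`. -/
abbrev Coord := Fin 4 → ℝ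

/-- The two spatial coordinates `(X, Y)`. -/
abbrev Plane := Fin 2 → ℝ

/-- Five coordinates `((Ũ, Ṽ, Z₂, Z₃), z)` of the flat space in which (anti-)de Sitter space is
embedded; the last one is normalised, `z = Z₄ / a` with `a = √(3 / |Λ|)`. -/
abbrev Ambient := Coord × ℝ

/-- The `i`-th partial derivative. -/
def pd {n : ℕ} (f : (Fin n → ℝ) → ℝ) (i : Fin n) (x : Fin n → ℝ) : ℝ :=
  fderiv ℝ f x (Pi.single i 1)

/-- The spatial part `(X, Y)` of a coordinate quadruple. -/
def planePart (x : Coord) : Plane := ![x 2, x 3]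

/-- The kink function `U₊`. -/
def kink (u : ℝ) : ℝ := max u 0

/-- `X² + Y²`. -/
def planeSq (X : Plane) : ℝ := X 0 ^ 2 + X 1 ^ 2

/-- The Minkowski inner product `X X' + Y Y' - U V' - V U'` in null coordinates. -/
def mink (x y : Coord) : ℝ := x 2 * y 2 + x 3 * y 3 - x 0 * y 1 - x 1 * y 0

/-! ### The continuous form of the metric -/

/-- The conformal factor `1 + (Λ/12)(X² + Y²)` on the surface `U = 0`. -/
def surfaceFactor (Λ : ℝ) (X : Plane) : ℝ := 1 + Λ / 12 * planeSq X

/-- `G = H - Xⁱ H,ᵢ`. -/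
def profileG (H : Plane → ℝ) (X : Plane) : ℝ := H X - ∑ i, X i * pd H i X

/-- `ω = 1 + (Λ/12)(X² + Y² - 2UV - 2 U₊ G)`. -/
def omega (Λ : ℝ) (H : Plane → ℝ) (x : Coord) : ℝ :=
  1 + Λ / 12 * (planeSq (planePart x) - 2 * x 0 * x 1
    - 2 * kink (x 0) * profileG H (planePart x))

/-- `g_ij = δ_ij + 2 U₊ H,ᵢⱼ + U₊² δᵏˡ H,ᵢₖ H,ⱼₗ`. -/
def spatialMetric (H : Plane → ℝ) (x : Coord) : Matrix (Fin 2) (Fin 2) ℝ := fun i j =>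
  let hess : Fin 2 → Fin 2 → ℝ := fun k l => pd (pd H k) l (planePart x)
  (if i = j then 1 else 0) + 2 * kink (x 0) * hess i j
    + kink (x 0) ^ 2 * ∑ k, hess i k * hess j k

/-- The line element `ds² = ω⁻² (g_ij dXⁱ dXʲ - 2 dU dV)`. -/
def metric (Λ : ℝ) (H : Plane → ℝ) (x : Coord) : Matrix (Fin 4) (Fin 4) ℝ :=
  let g := spatialMetric H x
  (omega Λ H x ^ 2)⁻¹ • !![0, -1, 0, 0;
                           -1, 0, 0, 0;
                           0, 0, g 0 0, g 0 1;
                           0, 0, g 1 0, g 1 1]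

/-- The Christoffel symbols `Γ^μ_{νρ}` of the metric. They are defined by the usual formula wherever
the metric is differentiable; the remaining points (`U = 0`) form a null set, on which the values
are irrelevant for Filippov's solution concept. -/
def christoffel (Λ : ℝ) (H : Plane → ℝ) (x : Coord) (μ ν ρ : Fin 4) : ℝ :=
  1 / 2 * ∑ l, (metric Λ H x)⁻¹ μ l *
    (pd (fun y => metric Λ H y l ρ) ν x + pd (fun y => metric Λ H y l ν) ρ x
      - pd (fun y => metric Λ H y ν ρ) l x)

/-- The geodesic equation as a first order system for position and velocity. -/
def geodesicField (Λ : ℝ) (H : Plane → ℝ) (W : Coord × Coord) : Coord × Coord :=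
  (W.2, fun μ => -∑ ν, ∑ ρ, christoffel Λ H W.1 μ ν ρ * W.2 ν * W.2 ρ)

/-! ### The complete impulsive wave spacetime -/

/-- The complete background of constant curvature, in the embedding
`Z₂² + Z₃² - 2ŨṼ + (3/Λ) z² = 3/Λ`, multiplied by `Λ/3`: for `Λ ≠ 0` this is (anti-)de Sitter
space, for `Λ = 0` it is Minkowski space.

The spacetime with the impulse is obtained from the halves `Ũ ≤ 0` and `Ũ ≥ 0` of the background by
identifying their boundaries with a warp. As a set it is therefore the disjoint union of
`{Ũ ≤ 0}` (the half in front of the wave, with the wave surface `{Ũ = 0}`, whose points are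
labelled by their coordinates in this half) and `{Ũ > 0}` (the open half behind the wave). How the
two pieces fit together along the wave surface, that is the manifold structure and the metric, is
given by the charts below and not by the subspace topology of the ambient space. -/
def Spacetime (Λ : ℝ) : Type :=
  {p : Ambient // p.2 ^ 2 + Λ / 3 * mink p.1 p.1 = 1 ∧ (Λ = 0 → p.2 = 1)}

/-- The global null coordinate `Ũ`; the wave surface is `{Ũ = 0}`. -/
def nullU {Λ : ℝ} (p : Spacetime Λ) : ℝ := p.1.1 0

/-- The vectors of the ambient space that are tangent to the background at `p`. -/
def IsTangent {Λ : ℝ} (p : Spacetime Λ) (v : Ambient) : Prop :=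
  p.1.2 * v.2 + Λ / 3 * mink p.1.1 v.1 = 0

/-- The two poles `z = 1` and `z = -1`, around which the conformally flat coordinates of the
background can be centred. -/
inductive Pole
  | north
  | south

/-- The value of `z` at the pole. -/
def Pole.sign : Pole → ℝ
  | .north => 1
  | .south => -1

/-- The conformally flat coordinates `(𝒰, 𝒱, x, y)` of the background, centred at a pole:
`Ũ = 𝒰/Ω`, `Ṽ = 𝒱/Ω`, `Z₂ = x/Ω`, `Z₃ = y/Ω`, `z = ±(2/Ω - 1)`. -/
def embed (Λ : ℝ) (s : Pole) (x : Coord) : Ambient :=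
  let Ω : ℝ := 1 + Λ / 12 * mink x x
  (Ω⁻¹ • x, s.sign * (2 / Ω - 1))

/-- The transformation from the continuous coordinates `(U, V, X, Y)` to the conformally flat
coordinates `(𝒰, 𝒱, x, y)` of the respective half of the background: the identity for `U ≤ 0`, and
`𝒰 = U`, `𝒱 = V + H + ½ U (H,X² + H,Y²)`, `x = X + U H,X`, `y = Y + U H,Y` for `U > 0`. -/
def toConformallyFlat (H : Plane → ℝ) (x : Coord) : Coord :=
  let X := planePart x
  if x 0 ≤ 0 then x
  else ![x 0,
         x 1 + H X + 1 / 2 * x 0 * (pd H 0 X ^ 2 + pd H 1 X ^ 2),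
         x 2 + x 0 * pd H 0 X,
         x 3 + x 0 * pd H 1 X]

/-- The charts of the spacetime.
* `wave s`: the continuous coordinates around the wave surface;
* `half s`: the conformally flat coordinates of the two open halves of the background. -/
inductive Chart
  | wave (s : Pole)
  | half (s : Pole)

/-- The pole at which a chart is centred. -/
def Chart.pole : Chart → Pole
  | .wave s => s
  | .half s => s

/-- The function `H` in the continuous metric of a chart, if `H` and `Hs` are the profiles in the
coordinates centred at the north and the south pole. In the two open halves the metric is the
background metric, i.e. the one with `H = 0`. -/
def Chart.profile (H Hs : Plane → ℝ) : Chart → Plane → ℝ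
  | .wave .north => H
  | .wave .south => Hs
  | .half _ => 0

/-- The coordinate domain of a chart. For the continuous coordinates: all points with positive
conformal factor at which the metric is nondegenerate. For the conformally flat coordinates: all
points off the wave surface with positive conformal factor. -/
def Chart.domain (Λ : ℝ) (H Hs : Plane → ℝ) : Chart → Set Coord
  | .wave s => {x | 0 < surfaceFactor Λ (planePart x) ∧
      0 < omega Λ (Chart.profile H Hs (.wave s)) x ∧
      (spatialMetric (Chart.profile H Hs (.wave s)) x).det ≠ 0}
  | .half _ => {x | x 0 ≠ 0 ∧ 0 < omega Λ 0 x}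

/-- The point of the spacetime with given coordinates. This map is a local parametrisation (off the
wave surface it is a local isometry onto the background); it need not be globally injective. -/
def Chart.toAmbient (Λ : ℝ) (H Hs : Plane → ℝ) (k : Chart) (x : Coord) : Ambient :=
  embed Λ k.pole (toConformallyFlat (k.profile H Hs) x)

/-! ### Geodesics of the spacetime -/

/-- `γ`, defined on the interval `I`, is a geodesic in the sense of Filippov: near every parameter
value it is, in some chart, the position component of a Filippov solution of the geodesic equation,
written as a first order system. -/
def IsFilippovGeodesicOn (Λ : ℝ) (H Hs : Plane → ℝ) (I : Set ℝ) (γ : ℝ → Spacetime Λ) : Prop :=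
  ∀ t₀ ∈ I, ∃ k : Chart, ∃ ε > 0, ∃ W : ℝ → Coord × Coord,
    IsFilippovSolutionOn {w | w.1 ∈ k.domain Λ H Hs} (geodesicField Λ (k.profile H Hs))
      (I ∩ Ioo (t₀ - ε) (t₀ + ε)) W ∧
    ∀ t ∈ I ∩ Ioo (t₀ - ε) (t₀ + ε), (γ t).1 = k.toAmbient Λ H Hs (W t).1

/-- `γ : ℝ → M` is a `C¹`-curve: near every parameter value it is `C¹` in some chart. -/
def IsC1Curve (Λ : ℝ) (H Hs : Plane → ℝ) (γ : ℝ → Spacetime Λ) : Prop :=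
  ∀ t₀ : ℝ, ∃ k : Chart, ∃ ε > 0, ∃ c : ℝ → Coord,
    ContDiffOn ℝ 1 c (Ioo (t₀ - ε) (t₀ + ε)) ∧
    ∀ t ∈ Ioo (t₀ - ε) (t₀ + ε),
      c t ∈ k.domain Λ H Hs ∧ (γ t).1 = k.toAmbient Λ H Hs (c t)

/-- The curve `γ` on `I` has position `p` and velocity `v` at parameter value `0` (`p` off the wave
surface, where the spacetime is an open part of the background). -/
def HasInitialData {Λ : ℝ} (I : Set ℝ) (γ : ℝ → Spacetime Λ) (p : Spacetime Λ) (v : Ambient) :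
    Prop :=
  γ 0 = p ∧ HasDerivWithinAt (fun t => (γ t).1) v I 0

end ImpulsiveWave

end

noncomputable section

open Filter Topology NNReal

/-! ### The Filippov map of a field at points of continuity, and its position component. -/

section FilippovBasics

variable {E : Type*} [NormedAddCommGroup E] [NormedSpace ℝ E] [MeasureSpace E]

/-! The background is a quadric in a flat ambient space, and a geodesic `c` on it solves the linear
equation `c'' = -k c` with the constant `k = curv c'`. Free motion is therefore the explicit
complete flow `flow k` on pairs of position and velocity (`embed_eq_flow`). Scaling the ambient form
by `Λ / 3` covers all signs of `Λ` at once.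

The continuous metric is the pullback of the background metric by the identity in front of the wave
and by the smooth map `waveMap` behind it. Hence on each side its geodesics are flow orbits seen
through the respective map (`geodesicField_eq_pullField`, `embed_comp_eq_flow`). On `U = 0` the two
maps and their differentials differ, in ambient terms, by one null rotation applied to position and
velocity alike (`embed_waveMap`, `dEmbed_waveMap`). Its parameter depends only on the point of the
wave surface, and not on the pole of the chart (`waveParam_south_eq`). Such a rotation preserves the
ambient form, hence `k`, and on the surface it changes neither `Ũ` nor its velocity.

So `Ũ` does not notice the wave: along the constructed orbit it is a solution of the scalar
oscillator equation. It is nonzero at the start, so all its zeros are simple and isolated. The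
crossing times are known in advance, and a global orbit arises by inserting a rotation at each of
them, possibly infinitely many (`exists_isBrokenOrbit`). Near every time it lifts to a Filippov
solution in a chart: at a crossing, two classical solutions with common initial data are glued along
`U = 0`, and the position stays `C¹` (`exists_isLocalGeodesic`).

For uniqueness, the position part of a Filippov solution is `C¹` even where the accelerations jump.
So near each time an arbitrary Filippov geodesic is either such a broken orbit or touches the wave
surface with vanishing `Ũ'` (`isBrokenOrbitNear_or_tangent`). The set where it agrees locally with
the constructed orbit is open and closed. Touching cannot occur at its boundary, because the scalar
oscillator has no double zero (`IsBrokenOrbit.eventually_eq_of_frequently`). Tangential motion thus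
never has to be analysed. -/

theorem filippovMap_subset_of_continuousAt (D : Set E) {f : E → E} {x : E}
    (hf : ContinuousAt f x) : filippovMap D f x ⊆ {f x} := by
  intro d hd
  have key : ∀ ε > 0, d ∈ Metric.closedBall (f x) ε := by
    intro ε hε
    obtain ⟨δ, hδ, h⟩ := Metric.nhds_basis_closedBall.mem_iff.1
      (hf (Metric.closedBall_mem_nhds (f x) hε))
    have := mem_iInter.1 (mem_iInter.1 (mem_iInter.1 (mem_iInter.1 hd δ) hδ) ∅) measure_empty
    refine closure_minimal (convexHull_min ?_ (convex_closedBall _ _)) Metric.isClosed_closedBall this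
    rintro _ ⟨y, hy, rfl⟩
    exact h hy.1.1
  have h0 : dist d (f x) ≤ 0 := le_of_forall_pos_le_add fun ε hε => by
    simpa using key ε hε
  exact dist_le_zero.1 h0

/-- A neighbourhood has positive measure, so no null set can remove all nearby points whose values
are close to `f x`. -/
theorem mem_filippovMap_of_continuousAt [(volume : Measure E).IsOpenPosMeasure] {D : Set E}
    {f : E → E} {x : E} (hf : ContinuousAt f x) (hD : D ∈ 𝓝 x) : f x ∈ filippovMap D f x := by
  refine mem_iInter₂.2 fun δ hδ => mem_iInter₂.2 fun S hS => ?_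
  refine closure_mono (subset_convexHull ℝ _) ?_
  refine mem_closure_iff_nhds.2 fun V hV => ?_
  have hN : f ⁻¹' V ∩ (Metric.closedBall x δ ∩ D) ∈ 𝓝 x :=
    inter_mem (hf hV) (inter_mem (Metric.closedBall_mem_nhds x hδ) hD)
  have : ¬ (f ⁻¹' V ∩ (Metric.closedBall x δ ∩ D)) ⊆ S := fun h =>
    (Measure.measure_pos_of_mem_nhds volume hN).ne' (measure_mono_null h hS)
  obtain ⟨y, hy, hyS⟩ := not_subset.1 this
  exact ⟨f y, hy.1, y, ⟨hy.2, hyS⟩, rfl⟩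

end FilippovBasics

/-- No continuity of `f` enters: the ball in the product confines the second component of the point,
hence the first component of `f`, to a closed ball, which is convex. -/
theorem filippovMap_fst_eq {E : Type*} [NormedAddCommGroup E] [NormedSpace ℝ E]
    [MeasureSpace (E × E)] {D : Set (E × E)} {f : E × E → E × E}
    (hf : ∀ w, (f w).1 = w.2) {w d : E × E} (hd : d ∈ filippovMap D f w) : d.1 = w.2 := by
  have key : ∀ ε > 0, dist d.1 w.2 ≤ ε := by
    intro ε hε
    have := mem_iInter.1 (mem_iInter.1 (mem_iInter.1 (mem_iInter.1 hd ε) hε) ∅) measure_empty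
    have h2 : d ∈ (Prod.fst : E × E → E) ⁻¹' Metric.closedBall w.2 ε := by
      refine closure_minimal (convexHull_min ?_ ?_) ?_ this
      · rintro _ ⟨y, hy, rfl⟩
        have : dist y w ≤ ε := hy.1.1
        simp only [mem_preimage, hf, Metric.mem_closedBall]
        exact (le_max_right _ _).trans this
      · exact (convex_closedBall w.2 ε).is_linear_preimage ⟨fun _ _ => rfl, fun _ _ => rfl⟩
      · exact Metric.isClosed_closedBall.preimage continuous_fst
    exact h2
  have h0 : dist d.1 w.2 ≤ 0 := le_of_forall_pos_le_add fun ε hε => by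
    simpa using key ε hε
  exact dist_le_zero.1 h0

/-! ### Absolutely continuous functions with continuous almost-everywhere derivative. -/

section FTC

variable {E : Type*} [NormedAddCommGroup E] [NormedSpace ℝ E] [CompleteSpace E]

/-- An absolutely continuous function whose derivative agrees almost everywhere with a continuous
function is continuously differentiable. -/
theorem hasDerivWithinAt_of_absolutelyContinuous {J : Set ℝ} (hJ : J.OrdConnected)
    {W g : ℝ → E} (hW : ∀ a ∈ J, ∀ b ∈ J, AbsolutelyContinuousOnInterval W a b)
    (hg : ContinuousOn g J) (h : ∀ᵐ t : ℝ, t ∈ J → HasDerivAt W (g t) t) :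
    ∀ t ∈ J, HasDerivWithinAt W (g t) J t := by
  have key : ∀ a ∈ J, ∀ b ∈ J, ∃ δ : ℝ → E, EqOn W δ (uIcc a b) ∧
      ∀ t ∈ uIcc a b, HasDerivWithinAt δ (g t) (uIcc a b) t := by
    intro a ha b hb
    have hab : uIcc a b ⊆ J := hJ.uIcc_subset ha hb
    -- Extending `g` by constants beyond the compact subinterval gives a continuous function on the
    -- line, whose primitive is `C¹` and so absolutely continuous. The difference to `W` has
    -- derivative zero almost everywhere.
    set G : ℝ → E := IccExtend (inf_le_sup : a ⊓ b ≤ a ⊔ b) ((uIcc a b).domRestrict g) with hG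
    have hGc : Continuous G :=
      (continuousOn_iff_continuous_domRestrict.1 (hg.mono hab)).Icc_extend'
    have hGg : ∀ t ∈ uIcc a b, G t = g t := fun t ht => IccExtend_of_mem _ _ ht
    set Φ : ℝ → E := fun t => ∫ s in a..t, G s with hΦ
    have hΦd : ∀ t, HasDerivAt Φ (G t) t := fun t =>
      intervalIntegral.integral_hasDerivAt_right (hGc.intervalIntegrable _ _)
        hGc.aestronglyMeasurable.stronglyMeasurableAtFilter hGc.continuousAt
    have hΦ1 : ContDiff ℝ 1 Φ := by
      refine contDiff_one_iff_deriv.2 ⟨fun t => (hΦd t).differentiableAt, ?_⟩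
      rw [show deriv Φ = G from funext fun t => (hΦd t).deriv]
      exact hGc
    obtain ⟨C, hC⟩ := ((hW a ha b hb).sub
      hΦ1.contDiffOn.absolutelyContinuousOnInterval).const_of_ae_hasDerivAt_zero (by
        filter_upwards [h] with t ht htab
        have := (ht (hab htab)).sub (hΦd t)
        rwa [hGg t htab, sub_self] at this)
    refine ⟨fun t => C + Φ t, fun t ht => ?_, fun t ht => ?_⟩
    · rw [← hC t ht]; simp
    · rw [← hGg t ht]
      exact ((hΦd t).const_add C).hasDerivWithinAt
  intro t ht
  -- `J` may contain its end points, so the two one-sided derivatives are found separately. A side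
  -- without further points of `J` reduces to a singleton.
  have right : HasDerivWithinAt W (g t) (J ∩ Ici t) t := by
    by_cases hb : ∃ b ∈ J, t < b
    · obtain ⟨b, hb, htb⟩ := hb
      obtain ⟨δ, h1, h2⟩ := key t ht b hb
      have h3 := (h2 t left_mem_uIcc).congr h1 (h1 left_mem_uIcc)
      refine h3.mono_of_mem_nhdsWithin ?_
      rw [uIcc_of_le htb.le]
      exact mem_of_superset (inter_mem_nhdsWithin _ (Iio_mem_nhds htb))
        fun s hs => ⟨hs.1.2, hs.2.le⟩
    · push Not at hb
      refine HasDerivWithinAt.mono (t := {t}) ?_ fun s hs => le_antisymm (hb s hs.1) hs.2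
      exact HasFDerivWithinAt.singleton
  have left : HasDerivWithinAt W (g t) (J ∩ Iic t) t := by
    by_cases hb : ∃ b ∈ J, b < t
    · obtain ⟨b, hb, htb⟩ := hb
      obtain ⟨δ, h1, h2⟩ := key t ht b hb
      have h3 := (h2 t left_mem_uIcc).congr h1 (h1 left_mem_uIcc)
      refine h3.mono_of_mem_nhdsWithin ?_
      rw [uIcc_of_ge htb.le]
      exact mem_of_superset (inter_mem_nhdsWithin _ (Ioi_mem_nhds htb))
        fun s hs => ⟨le_of_lt hs.2, hs.1.2⟩
    · push Not at hb
      refine HasDerivWithinAt.mono (t := {t}) ?_ fun s hs => le_antisymm hs.2 (hb s hs.1)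
      exact HasFDerivWithinAt.singleton
  refine (left.union right).mono fun s hs => ?_
  rcases le_total s t with h | h
  · exact Or.inl ⟨hs, h⟩
  · exact Or.inr ⟨hs, h⟩

end FTC

/-- A function with vanishing derivative on an interval is constant there. -/
theorem eq_of_hasDerivWithinAt_zero {E : Type*} [NormedAddCommGroup E] [NormedSpace ℝ E]
    {J : Set ℝ} (hJ : J.OrdConnected) {f : ℝ → E}
    (h : ∀ t ∈ J, HasDerivWithinAt f 0 J t) {s t : ℝ} (hs : s ∈ J) (ht : t ∈ J) : f s = f t := by
  have := hJ.convex.norm_image_sub_le_of_norm_hasDerivWithin_le (C := 0) h (by simp) ht hs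
  rw [zero_mul] at this
  exact sub_eq_zero.1 (norm_le_zero_iff.1 this)

/-! ### The harmonic oscillator equation -/

/-- The cosine of the oscillator equation with constant `k`: value one and slope zero at zero. -/
def gcos (k t : ℝ) : ℝ :=
  if 0 < k then Real.cos (√k * t) else if k = 0 then 1 else Real.cosh (√(-k) * t)

/-- The sine of the oscillator equation with constant `k`: value zero and slope one at zero. -/
def gsin (k t : ℝ) : ℝ :=
  if 0 < k then Real.sin (√k * t) / √k else if k = 0 then t else Real.sinh (√(-k) * t) / √(-k)

/-- Writing `k` as `r²`, `0` or `-r²` reduces each identity for `gcos` and `gsin` to a classical one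
for trigonometric, affine or hyperbolic functions. -/
theorem curvature_cases (k : ℝ) : (∃ r : ℝ, r ≠ 0 ∧ k = r ^ 2 ∧
      (∀ t, gcos k t = Real.cos (r * t)) ∧ ∀ t, gsin k t = Real.sin (r * t) / r) ∨
    (k = 0 ∧ (∀ t, gcos k t = 1) ∧ ∀ t, gsin k t = t) ∨
    (∃ r : ℝ, r ≠ 0 ∧ k = -r ^ 2 ∧
      (∀ t, gcos k t = Real.cosh (r * t)) ∧ ∀ t, gsin k t = Real.sinh (r * t) / r) := by
  rcases lt_trichotomy k 0 with hk | hk | hk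
  · refine Or.inr (Or.inr ⟨√(-k), ?_, ?_, fun t => ?_, fun t => ?_⟩)
    · exact (Real.sqrt_pos.2 (by linarith)).ne'
    · rw [Real.sq_sqrt (by linarith)]; ring
    · simp [gcos, hk.not_gt, hk.ne]
    · simp [gsin, hk.not_gt, hk.ne]
  · exact Or.inr (Or.inl ⟨hk, fun t => by simp [gcos, hk], fun t => by simp [gsin, hk]⟩)
  · refine Or.inl ⟨√k, (Real.sqrt_pos.2 hk).ne', (Real.sq_sqrt hk.le).symm, fun t => ?_,
      fun t => ?_⟩
    · simp [gcos, hk]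
    · simp [gsin, hk]

theorem gcos_zero (k : ℝ) : gcos k 0 = 1 := by
  rcases curvature_cases k with ⟨r, _, _, h, _⟩ | ⟨_, h, _⟩ | ⟨r, _, _, h, _⟩ <;> simp [h]

theorem gsin_zero (k : ℝ) : gsin k 0 = 0 := by
  rcases curvature_cases k with ⟨r, _, _, _, h⟩ | ⟨_, _, h⟩ | ⟨r, _, _, _, h⟩ <;> simp [h]

theorem hasDerivAt_gcos (k t : ℝ) : HasDerivAt (gcos k) (-k * gsin k t) t := by
  rcases curvature_cases k with ⟨r, hr, hk, h, h'⟩ | ⟨hk, h, h'⟩ | ⟨r, hr, hk, h, h'⟩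
  · rw [funext h, h']
    convert (((hasDerivAt_id' t).const_mul r)).cos using 1
    rw [hk]; field_simp
  · rw [funext h, hk]
    simpa using hasDerivAt_const t (1 : ℝ)
  · rw [funext h, h']
    convert (((hasDerivAt_id' t).const_mul r)).cosh using 1
    rw [hk]; field_simp

theorem hasDerivAt_gsin (k t : ℝ) : HasDerivAt (gsin k) (gcos k t) t := by
  rcases curvature_cases k with ⟨r, hr, hk, h, h'⟩ | ⟨hk, h, h'⟩ | ⟨r, hr, hk, h, h'⟩
  · rw [funext h', h]
    exact ((((hasDerivAt_id' t).const_mul r).sin).div_const r).congr_deriv (by field_simp)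
  · rw [funext h', h]
    exact hasDerivAt_id t
  · rw [funext h', h]
    exact ((((hasDerivAt_id' t).const_mul r).sinh).div_const r).congr_deriv (by field_simp)

theorem gcos_sq_add (k t : ℝ) : gcos k t ^ 2 + k * gsin k t ^ 2 = 1 := by
  rcases curvature_cases k with ⟨r, hr, hk, h, h'⟩ | ⟨hk, h, h'⟩ | ⟨r, hr, hk, h, h'⟩
  · rw [h, h', hk, ← Real.cos_sq_add_sin_sq (r * t)]; field_simp
  · rw [h, hk]; ring
  · rw [h, h', hk, ← Real.cosh_sq_sub_sinh_sq (r * t)]; field_simp; ring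

theorem gcos_add (k s t : ℝ) :
    gcos k (s + t) = gcos k s * gcos k t - k * (gsin k s * gsin k t) := by
  rcases curvature_cases k with ⟨r, hr, hk, h, h'⟩ | ⟨hk, h, h'⟩ | ⟨r, hr, hk, h, h'⟩
  · rw [h, h, h, h', h', mul_add, Real.cos_add, hk]; field_simp
  · rw [h, h, h, hk]; ring
  · rw [h, h, h, h', h', mul_add, Real.cosh_add, hk]; field_simp; ring

theorem gsin_add (k s t : ℝ) :
    gsin k (s + t) = gsin k s * gcos k t + gcos k s * gsin k t := by
  rcases curvature_cases k with ⟨r, hr, hk, h, h'⟩ | ⟨hk, h, h'⟩ | ⟨r, hr, hk, h, h'⟩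
  · simp only [h, h', mul_add, Real.sin_add]; field_simp
  · simp [h, h']
  · simp only [h, h', mul_add, Real.sinh_add]; field_simp

section Flow

variable {E : Type*} [NormedAddCommGroup E] [NormedSpace ℝ E]

/-- The flow of the oscillator equation with constant `k` on pairs of position and velocity. -/
def flow (k t : ℝ) (b : E × E) : E × E :=
  (gcos k t • b.1 + gsin k t • b.2, (-k * gsin k t) • b.1 + gcos k t • b.2)

theorem flow_zero (k : ℝ) (b : E × E) : flow k 0 b = b := by
  simp [flow, gcos_zero, gsin_zero]

theorem flow_add (k s t : ℝ) (b : E × E) : flow k (s + t) b = flow k s (flow k t b) := by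
  simp only [flow, gcos_add, gsin_add]
  ext1 <;> module

theorem flow_flow_neg (k t : ℝ) (b : E × E) : flow k t (flow k (-t) b) = b := by
  rw [← flow_add, add_neg_cancel, flow_zero]

theorem flow_neg_flow (k t : ℝ) (b : E × E) : flow k (-t) (flow k t b) = b := by
  rw [← flow_add, neg_add_cancel, flow_zero]

theorem hasDerivAt_flow_fst (k t : ℝ) (b : E × E) :
    HasDerivAt (fun t => (flow k t b).1) (flow k t b).2 t := by
  simp only [flow]
  exact ((hasDerivAt_gcos k t).smul_const b.1).add ((hasDerivAt_gsin k t).smul_const b.2)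

/-- Carrying `(c s, d s)` back to time zero by the inverse flow gives a curve with derivative zero.
This needs no Lipschitz theory and works with one-sided derivatives at the ends of `J`. -/
theorem eq_flow_of_hasDerivWithinAt {J : Set ℝ} (hJ : J.OrdConnected) {k : ℝ} {c d : ℝ → E}
    (hc : ∀ t ∈ J, HasDerivWithinAt c (d t) J t)
    (hd : ∀ t ∈ J, HasDerivWithinAt d (-k • c t) J t) {t₀ t : ℝ} (ht₀ : t₀ ∈ J) (ht : t ∈ J) :
    (c t, d t) = flow k (t - t₀) (c t₀, d t₀) := by
  have h : ∀ s ∈ J, HasDerivWithinAt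
      (fun s => (gcos k s • c s - gsin k s • d s, (k * gsin k s) • c s + gcos k s • d s)) 0 J s := by
    intro s hs
    have hC := (hasDerivAt_gcos k s).hasDerivWithinAt (s := J)
    have hS := (hasDerivAt_gsin k s).hasDerivWithinAt (s := J)
    refine (((hC.smul (hc s hs)).sub (hS.smul (hd s hs))).prodMk
      (((hS.const_mul k).smul (hc s hs)).add (hC.smul (hd s hs)))).congr_deriv ?_
    refine Prod.ext ?_ ?_ <;> simp only [Prod.fst_zero, Prod.snd_zero] <;> module
  have inv : ∀ s, (c s, d s) = flow k s
      (gcos k s • c s - gsin k s • d s, (k * gsin k s) • c s + gcos k s • d s) := by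
    intro s
    have := gcos_sq_add k s
    simp only [flow]
    ext1
    · have : (gcos k s ^ 2 + k * gsin k s ^ 2) • c s = c s := by rw [this, one_smul]
      simp only
      nth_rewrite 1 [← this]
      module
    · have : (gcos k s ^ 2 + k * gsin k s ^ 2) • d s = d s := by rw [this, one_smul]
      simp only
      nth_rewrite 1 [← this]
      module
  have e := eq_of_hasDerivWithinAt_zero hJ h ht ht₀
  conv_lhs => rw [inv t, e]
  conv_rhs => rw [inv t₀, ← flow_add, sub_add_cancel]

end Flow

/-! ### Locally prescribed piecewise constant functions on the line -/

section Continuation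

variable {α : Type*}

/-- Near `t₀`, the function `Q` is equal to `Q t₀` where `u ≤ 0` and to `B t₀ (Q t₀)` where
`0 < u`. -/
def IsBrokenAt (u : ℝ → ℝ) (B : ℝ → α ≃ α) (Q : ℝ → α) (t₀ : ℝ) : Prop :=
  ∀ᶠ t in 𝓝 t₀, Q t = if u t ≤ 0 then Q t₀ else B t₀ (Q t₀)

variable {u : ℝ → ℝ} {B : ℝ → α ≃ α} {Q Q' : ℝ → α}

theorem IsBrokenAt.congr {t₀ : ℝ} (h : IsBrokenAt u B Q t₀) (hQ : Q' =ᶠ[𝓝 t₀] Q) :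
    IsBrokenAt u B Q' t₀ := by
  unfold IsBrokenAt
  rw [hQ.eq_of_nhds]
  filter_upwards [h, hQ] with t h1 h2
  rw [h2, h1]

theorem isBrokenAt_iff_of_ne {t₀ : ℝ} (hB : B t₀ = Equiv.refl α) :
    IsBrokenAt u B Q t₀ ↔ ∀ᶠ t in 𝓝 t₀, Q t = Q t₀ := by
  simp [IsBrokenAt, hB]

/-- Local solvability with the value prescribed at any point close to `t₀`. -/
theorem exists_isBrokenAt_near
    (hu : Continuous u)
    (hiso : ∀ t, ∀ᶠ s in 𝓝[≠] t, u s ≠ 0)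
    (hB : ∀ t, u t ≠ 0 → B t = Equiv.refl α)
    (t₀ : ℝ) : ∃ ε > 0, ∀ t₁ ∈ Ioo (t₀ - ε) (t₀ + ε), t₁ ≠ t₀ → ∀ a : α,
    ∃ Q : ℝ → α, Q t₁ = a ∧ u t₁ ≠ 0 ∧ ∀ t ∈ Ioo (t₀ - ε) (t₀ + ε), IsBrokenAt u B Q t := by
  obtain ⟨ε, hε, h⟩ := Metric.eventually_nhds_iff.1 (eventually_nhdsWithin_iff.1 (hiso t₀))
  have hne : ∀ t ∈ Ioo (t₀ - ε) (t₀ + ε), t ≠ t₀ → u t ≠ 0 := fun t ht hne =>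
    h (by rw [Real.dist_eq, abs_lt]; constructor <;> linarith [ht.1, ht.2]) hne
  refine ⟨ε, hε, fun t₁ ht₁ hne₁ a => ?_⟩
  -- The value at `t₀` is the one valid where `u ≤ 0`. If `t₁` lies on the other side, it is
  -- recovered by undoing `B t₀`; this is where invertibility enters.
  set b : α := if u t₁ ≤ 0 then a else (B t₀).symm a with hb
  refine ⟨fun t => if t = t₀ then b else if u t ≤ 0 then b else B t₀ b, ?_, hne t₁ ht₁ hne₁,
    fun t ht => ?_⟩
  · by_cases h1 : u t₁ ≤ 0 <;> simp [hne₁, h1, hb]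
  · by_cases htt : t = t₀
    · subst htt
      refine Eventually.of_forall fun s => ?_
      by_cases hs : s = t
      · subst hs
        by_cases h1 : u s ≤ 0
        · simp [h1]
        · simp [h1, hB s (by linarith : 0 < u s).ne']
      · simp [hs]
    · rw [isBrokenAt_iff_of_ne (hB t (hne t ht htt))]
      have h1 : ∀ᶠ s in 𝓝 t, (u s ≤ 0 ↔ u t ≤ 0) := by
        rcases (hne t ht htt).lt_or_gt with h2 | h2
        · filter_upwards [hu.continuousAt.eventually_lt_const h2] with s hs
          simp [hs.le, h2.le]
        · filter_upwards [hu.continuousAt.eventually_const_lt h2] with s hs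
          simp [hs.not_ge, h2.not_ge]
      filter_upwards [h1, isOpen_ne.mem_nhds htt] with s hs hne₂
      simp only [hs, if_neg htt, if_neg (show s ≠ t₀ from hne₂)]

/-- Gluing at a point where `u ≠ 0`. -/
theorem IsBrokenAt.glue
    (hB : ∀ t, u t ≠ 0 → B t = Equiv.refl α)
    {a b c : ℝ} (hub : u b ≠ 0) (h : Q b = Q' b)
    (hQ : ∀ t ∈ Icc a b, IsBrokenAt u B Q t) (hQ' : ∀ t ∈ Ico b c, IsBrokenAt u B Q' t) :
    ∀ t ∈ Ico a c, IsBrokenAt u B (fun t => if t ≤ b then Q t else Q' t) t := by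
  intro t ht
  rcases lt_trichotomy t b with h1 | h1 | h1
  · exact (hQ t ⟨ht.1, h1.le⟩).congr (by
      filter_upwards [Iio_mem_nhds h1] with s hs
      rw [if_pos (le_of_lt hs)])
  · subst h1
    have e1 := (isBrokenAt_iff_of_ne (hB t hub)).1 (hQ t ⟨ht.1, le_rfl⟩)
    have e2 := (isBrokenAt_iff_of_ne (hB t hub)).1 (hQ' t ⟨le_rfl, ht.2⟩)
    rw [isBrokenAt_iff_of_ne (hB t hub)]
    filter_upwards [e1, e2] with s h1 h2
    rw [if_pos le_rfl]
    split_ifs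
    · exact h1
    · rw [h2, h]
  · exact (hQ' t ⟨h1.le, ht.2⟩).congr (by
      filter_upwards [Ioi_mem_nhds h1] with s hs
      rw [if_neg (not_le.2 hs)])

/-- A continuation argument: the infimum of the times that cannot be reached can itself be passed,
which is absurd. -/
theorem exists_isBrokenAt_right
    (hu : Continuous u)
    (hiso : ∀ t, ∀ᶠ s in 𝓝[≠] t, u s ≠ 0)
    (hB : ∀ t, u t ≠ 0 → B t = Equiv.refl α)
    {a b : ℝ} (hab : a ≤ b)
    (hQ : ∀ t ∈ Icc a b, IsBrokenAt u B Q t) (c : ℝ) (hbc : b ≤ c) :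
    ∃ Q' : ℝ → α, EqOn Q' Q (Icc a b) ∧ ∀ t ∈ Icc a c, IsBrokenAt u B Q' t := by
  set S : Set ℝ := {c | ∃ Q' : ℝ → α, EqOn Q' Q (Icc a b) ∧ ∀ t ∈ Icc a c, IsBrokenAt u B Q' t}
  suffices H : Icc b c ⊆ S from H ⟨hbc, le_rfl⟩
  -- A time approached from the left by reachable ones is passed by restarting at a reachable `t₁`
  -- close to it, with the value `P t₁`. The gluing point has `u t₁ ≠ 0`, so nothing but equality of
  -- values has to match there.
  have step : ∀ t₀, b ≤ t₀ → (∀ ε > 0, ∃ t₁ ∈ S, b ≤ t₁ ∧ t₁ < t₀ ∧ t₀ - ε < t₁) →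
      ∃ d > t₀, d ∈ S := by
    intro t₀ hb h
    obtain ⟨ε, hε, h1⟩ := exists_isBrokenAt_near hu hiso hB t₀
    obtain ⟨t₁, ⟨P, hP1, hP2⟩, hbt, htt, hεt⟩ := h ε hε
    obtain ⟨R, hR1, hR2, hR3⟩ := h1 t₁ ⟨hεt, by linarith⟩ htt.ne (P t₁)
    refine ⟨t₀ + ε / 2, by linarith, fun t => if t ≤ t₁ then P t else R t, fun t ht => ?_, ?_⟩
    · simp only [if_pos (ht.2.trans hbt)]
      exact hP1 ht
    · intro t ht
      exact IsBrokenAt.glue hB hR2 hR1.symm hP2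
        (c := t₀ + ε) (fun s hs => hR3 s ⟨by linarith [hs.1], hs.2⟩) t ⟨ht.1, by linarith [ht.2]⟩
  have mono : ∀ d ∈ S, ∀ d' ≤ d, d' ∈ S := fun d ⟨P, h1, h2⟩ d' hd =>
    ⟨P, h1, fun t ht => h2 t ⟨ht.1, ht.2.trans hd⟩⟩
  -- The condition at `d` already describes `P` on a full neighbourhood, so `P` itself serves a
  -- little beyond `d`; there `u` has no zero and local constancy suffices.
  have open_right : ∀ d, b ≤ d → d ∈ S → ∃ e > d, e ∈ S := by
    rintro d hbd ⟨P, hP1, hP2⟩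
    obtain ⟨ε, hε, h1⟩ := exists_isBrokenAt_near hu hiso hB d
    have h2 := hP2 d ⟨hab.trans hbd, le_rfl⟩
    obtain ⟨η, hη, h3⟩ := Metric.eventually_nhds_iff.1 h2
    set m := min ε η with hm
    have hm0 : 0 < m := lt_min hε hη
    obtain ⟨R, hR1, hR2, hR3⟩ := h1 (d + m / 2)
      ⟨by linarith, by linarith [min_le_left ε η]⟩ (by linarith) (P (d + m / 2))
    refine ⟨d + m / 4, by linarith, P, hP1, fun t ht => ?_⟩
    by_cases htd : t ≤ d
    · exact hP2 t ⟨ht.1, htd⟩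
    · push Not at htd
      have hut : u t ≠ 0 := by
        obtain ⟨_, _, h, _⟩ := h1 t ⟨by linarith, by linarith [min_le_left ε η, ht.2]⟩ htd.ne' (P t)
        exact h
      rw [isBrokenAt_iff_of_ne (hB t hut)]
      have e1 : ∀ᶠ s in 𝓝 t, (u s ≤ 0 ↔ u t ≤ 0) := by
        rcases hut.lt_or_gt with h2 | h2
        · filter_upwards [hu.continuousAt.eventually_lt_const h2] with s hs
          simp [hs.le, h2.le]
        · filter_upwards [hu.continuousAt.eventually_const_lt h2] with s hs
          simp [hs.not_ge, h2.not_ge]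
      have hdist : ∀ s, d < s → s < d + η → dist s d < η := fun s h1 h2 => by
        rw [Real.dist_eq, abs_lt]; constructor <;> linarith
      have htη : t < d + η := by linarith [min_le_right ε η, ht.2]
      filter_upwards [e1, Ioo_mem_nhds htd htη] with s hs hs'
      rw [h3 (hdist s hs'.1 hs'.2), h3 (hdist t htd htη)]
      simp only [hs]
  intro d hd
  by_contra hdS
  set T : Set ℝ := {d | b ≤ d ∧ d ∉ S}
  have hT : T.Nonempty := ⟨d, hd.1, hdS⟩
  have hTb : BddBelow T := ⟨b, fun x hx => hx.1⟩
  set m := sInf T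
  have hbS : b ∈ S := ⟨Q, fun _ _ => rfl, hQ⟩
  have hbm : b ≤ m := le_csInf hT fun x hx => hx.1
  have hlt : ∀ x, b ≤ x → x < m → x ∈ S := fun x hx hxm => by
    by_contra h
    exact absurd (csInf_le hTb ⟨hx, h⟩) (not_le.2 hxm)
  have hmS : ∃ e > m, e ∈ S := by
    rcases hbm.eq_or_lt with h | h
    · rw [← h]; exact open_right b le_rfl hbS
    · refine step m hbm fun ε hε => ?_
      refine ⟨max b (m - ε / 2), hlt _ (le_max_left _ _) (max_lt h (by linarith)), le_max_left _ _,
        max_lt h (by linarith), lt_of_lt_of_le (by linarith) (le_max_right _ _)⟩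
  obtain ⟨e, he, heS⟩ := hmS
  obtain ⟨x, hx, hxe⟩ := exists_lt_of_csInf_lt hT he
  exact hx.2 (mono e heS x hxe.le)

/-- The condition refers to the sign of `u` and not to the direction of time, so extension to the
left follows from extension to the right. -/
theorem isBrokenAt_neg {t : ℝ} :
    IsBrokenAt (fun t => u (-t)) (fun t => B (-t)) (fun t => Q (-t)) t ↔ IsBrokenAt u B Q (-t) := by
  unfold IsBrokenAt
  constructor
  · intro h
    have := (continuous_neg.tendsto (-t)).eventually (by rwa [neg_neg])
    simpa using this
  · intro h
    exact (continuous_neg.tendsto t).eventually h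

theorem exists_isBrokenAt_both
    (hu : Continuous u)
    (hiso : ∀ t, ∀ᶠ s in 𝓝[≠] t, u s ≠ 0)
    (hB : ∀ t, u t ≠ 0 → B t = Equiv.refl α)
    {a b : ℝ} (hab : a ≤ b)
    (hQ : ∀ t ∈ Icc a b, IsBrokenAt u B Q t) :
    ∃ Q' : ℝ → α, EqOn Q' Q (Icc a b) ∧ ∀ t ∈ Icc (a - 1) (b + 1), IsBrokenAt u B Q' t := by
  obtain ⟨P, hP1, hP2⟩ := exists_isBrokenAt_right hu hiso hB hab hQ (b + 1) (by linarith)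
  have hiso' : ∀ t, ∀ᶠ s in 𝓝[≠] t, u (-s) ≠ 0 := by
    intro t
    have h : Tendsto (fun s : ℝ => -s) (𝓝[≠] t) (𝓝[≠] (-t)) :=
      tendsto_nhdsWithin_of_tendsto_nhds_of_eventually_within _
        ((continuous_neg.tendsto t).mono_left nhdsWithin_le_nhds)
        (eventually_mem_nhdsWithin.mono fun s hs => by simpa using hs)
    exact h.eventually (hiso (-t))
  obtain ⟨R, hR1, hR2⟩ := exists_isBrokenAt_right (u := fun t => u (-t)) (B := fun t => B (-t))
    (Q := fun t => P (-t)) (hu.comp continuous_neg) hiso' (fun t ht => hB _ ht)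
    (a := -(b + 1)) (b := -a) (by linarith)
    (fun t ht => isBrokenAt_neg.2 (hP2 _ ⟨by linarith [ht.2], by linarith [ht.1]⟩))
    (-(a - 1)) (by linarith)
  refine ⟨fun t => R (-t), fun t ht => ?_, fun t ht => ?_⟩
  · have := hR1 (x := -t) ⟨by linarith [ht.2], by linarith [ht.1]⟩
    simp only [neg_neg] at this
    exact this.trans (hP1 ht)
  · have := hR2 (-t) ⟨by linarith [ht.2], by linarith [ht.1]⟩
    have h2 := isBrokenAt_neg (u := u) (B := B) (Q := fun t => R (-t)) (t := -t)
    simp only [neg_neg] at h2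
    exact h2.1 this

/-- The line is exhausted by the intervals `[-n, n]`, each solution extending the previous one. The
zeros of `u` need not be enumerated. -/
theorem exists_isBrokenAt
    (hu : Continuous u)
    (hiso : ∀ t, ∀ᶠ s in 𝓝[≠] t, u s ≠ 0)
    (hB : ∀ t, u t ≠ 0 → B t = Equiv.refl α)
    (hu0 : u 0 ≠ 0) (a : α) :
    ∃ Q : ℝ → α, Q 0 = a ∧ ∀ t, IsBrokenAt u B Q t := by
  let X : ℕ → Type _ := fun n => {Q : ℝ → α // ∀ t ∈ Icc (-(n : ℝ)) n, IsBrokenAt u B Q t}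
  have base : ∀ t ∈ Icc (-((0 : ℕ) : ℝ)) ((0 : ℕ) : ℝ), IsBrokenAt u B (fun _ => a) t := by
    intro t ht
    have : t = 0 := by simpa using ht
    subst this
    rw [isBrokenAt_iff_of_ne (hB 0 hu0)]
    exact Eventually.of_forall fun _ => rfl
  have next : ∀ n (Q : X n), ∃ Q' : X (n + 1), EqOn Q'.1 Q.1 (Icc (-(n : ℝ)) n) := by
    intro n Q
    obtain ⟨Q', h1, h2⟩ := exists_isBrokenAt_both hu hiso hB
      (by linarith [(Nat.cast_nonneg n : (0 : ℝ) ≤ n)]) Q.2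
    exact ⟨⟨Q', fun t ht => h2 t (by push_cast at ht; exact ⟨by linarith [ht.1], ht.2⟩)⟩, h1⟩
  choose F hF using next
  let S : ∀ n, X n := fun n => Nat.rec ⟨fun _ => a, base⟩ F n
  have hS : ∀ m n, n ≤ m → EqOn (S m).1 (S n).1 (Icc (-(n : ℝ)) n) := by
    intro m n hnm
    induction m, hnm using Nat.le_induction with
    | base => exact fun _ _ => rfl
    | succ m hnm ih =>
      intro t ht
      have hc : (n : ℝ) ≤ m := by exact_mod_cast hnm
      rw [← ih ht]
      exact hF m (S m) ⟨by linarith [ht.1], by linarith [ht.2]⟩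
  have hceil : ∀ t : ℝ, t ∈ Icc (-(⌈|t|⌉₊ : ℝ)) ⌈|t|⌉₊ := fun t => abs_le.1 (Nat.le_ceil _)
  refine ⟨fun t => (S ⌈|t|⌉₊).1 t, ?_, fun t => ?_⟩
  · exact hS _ 0 (Nat.zero_le _) (by simp)
  -- One more than the ceiling makes `t` an interior point of `[-N, N]`, so a single solution covers
  -- a neighbourhood of `t`.
  set N := ⌈|t|⌉₊ + 1 with hN
  have htN : |t| < N := by
    rw [hN]; push_cast; linarith [Nat.le_ceil |t|]
  refine ((S N).2 t (abs_le.1 htN.le)).congr ?_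
  filter_upwards [continuous_abs.continuousAt.eventually_lt_const htN] with s hs
  exact (hS N _ (Nat.ceil_le.2 hs.le) (hceil s)).symm

end Continuation

namespace ImpulsiveWave

/-! ### The conformally flat background -/

theorem mink_comm (x y : Coord) : mink x y = mink y x := by
  simp only [mink]; ring

theorem mink_sub_right (x y z : Coord) : mink x (y - z) = mink x y - mink x z := by
  simp only [mink, Pi.sub_apply]; ring

theorem mink_smul_right (c : ℝ) (x y : Coord) : mink x (c • y) = c * mink x y := by
  simp only [mink, Pi.smul_apply, smul_eq_mul]; ring

theorem mink_smul_left (c : ℝ) (x y : Coord) : mink (c • x) y = c * mink x y := by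
  simp only [mink, Pi.smul_apply, smul_eq_mul]; ring

theorem eq_zero_of_mink_eq_zero {y : Coord} (h : ∀ x, mink x y = 0) : y = 0 := by
  have h0 := h (Pi.single 1 1)
  have h1 := h (Pi.single 0 1)
  have h2 := h (Pi.single 2 1)
  have h3 := h (Pi.single 3 1)
  simp [mink] at h0 h1 h2 h3
  ext i
  fin_cases i <;> simp [h0, h1, h2, h3]

theorem hasDerivWithinAt_mink {f g : ℝ → Coord} {f' g' : Coord} {J : Set ℝ} {t : ℝ}
    (hf : HasDerivWithinAt f f' J t) (hg : HasDerivWithinAt g g' J t) :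
    HasDerivWithinAt (fun t => mink (f t) (g t)) (mink f' (g t) + mink (f t) g') J t := by
  have hf := hasDerivWithinAt_pi.1 hf
  have hg := hasDerivWithinAt_pi.1 hg
  simp only [mink]
  exact (((((hf 2).mul (hg 2)).add ((hf 3).mul (hg 3))).sub ((hf 0).mul (hg 1))).sub
    ((hf 1).mul (hg 0))).congr_deriv (by ring)

/-- The conformal factor of the background in conformally flat coordinates. -/
def conformal (Λ : ℝ) (y : Coord) : ℝ := 1 + Λ / 12 * mink y y

/-- The right-hand side of the geodesic equation in conformally flat coordinates. -/
def flatAccel (Λ : ℝ) (y w : Coord) : Coord :=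
  (Λ / (6 * conformal Λ y)) • ((2 * mink y w) • w - mink w w • y)

/-- The differential of `embed`. -/
def dEmbed (Λ : ℝ) (s : Pole) (y w : Coord) : Ambient :=
  ((conformal Λ y)⁻¹ • w - (Λ / 6 * mink y w / conformal Λ y ^ 2) • y,
    s.sign * (-2 * (Λ / 6 * mink y w) / conformal Λ y ^ 2))

/-- `Λ / 3` times the squared length of an ambient vector, in a form which makes sense for all
`Λ`. -/
def curv (Λ : ℝ) (v : Ambient) : ℝ := v.2 ^ 2 + Λ / 3 * mink v.1 v.1

theorem Pole.sign_sq (s : Pole) : s.sign ^ 2 = 1 := by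
  cases s <;> simp [Pole.sign]

theorem embed_eq (Λ : ℝ) (s : Pole) (y : Coord) :
    embed Λ s y = ((conformal Λ y)⁻¹ • y, s.sign * (2 / conformal Λ y - 1)) := rfl

theorem hasDerivWithinAt_conformal (Λ : ℝ) {y : ℝ → Coord} {w : Coord} {J : Set ℝ} {t : ℝ}
    (hy : HasDerivWithinAt y w J t) :
    HasDerivWithinAt (fun t => conformal Λ (y t)) (Λ / 6 * mink (y t) w) J t := by
  simp only [conformal]
  exact (((hasDerivWithinAt_mink hy hy).const_mul (Λ / 12)).const_add 1).congr_deriv (by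
    rw [mink_comm w]; ring)

theorem hasDerivWithinAt_embed {Λ : ℝ} (s : Pole) {y : ℝ → Coord} {w : Coord} {J : Set ℝ} {t : ℝ}
    (hy : HasDerivWithinAt y w J t) (hΩ : conformal Λ (y t) ≠ 0) :
    HasDerivWithinAt (fun t => embed Λ s (y t)) (dEmbed Λ s (y t) w) J t := by
  simp only [embed_eq]
  have h := (hasDerivWithinAt_conformal Λ hy).inv hΩ
  refine HasDerivWithinAt.prodMk ?_ ?_
  · refine (h.smul hy).congr_deriv ?_
    simp only [Pi.inv_apply]
    module
  · simp only [div_eq_mul_inv (2 : ℝ)]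
    exact (((h.const_mul 2).sub_const 1).const_mul s.sign).congr_deriv (by ring)

/-- `embed` is isometric from the conformally flat metric to the ambient form; the `z` component
supplies the missing part of the square. -/
theorem curv_dEmbed {Λ : ℝ} (s : Pole) {y w : Coord} (hΩ : conformal Λ y ≠ 0) :
    curv Λ (dEmbed Λ s y w) = Λ / 3 * mink w w / conformal Λ y ^ 2 := by
  have e : Λ * mink y y = 12 * (conformal Λ y - 1) := by simp only [conformal]; ring
  have e1 : mink ((conformal Λ y)⁻¹ • w - (Λ / 6 * mink y w / conformal Λ y ^ 2) • y)
      ((conformal Λ y)⁻¹ • w - (Λ / 6 * mink y w / conformal Λ y ^ 2) • y) =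
      mink w w / conformal Λ y ^ 2 - 2 * (Λ / 6 * mink y w ^ 2 / conformal Λ y ^ 3)
        + (Λ / 6 * mink y w / conformal Λ y ^ 2) ^ 2 * mink y y := by
    rw [mink_sub_right, mink_comm _ (_ • w), mink_comm _ (_ • y)]
    simp only [mink_smul_left, mink_sub_right, mink_smul_right, mink_comm w y]
    field_simp
    ring
  simp only [curv, dEmbed, mul_pow, s.sign_sq]
  rw [e1]
  generalize mink w w = a at *
  generalize mink y w = b at *
  generalize mink y y = c at *
  generalize conformal Λ y = Ω at *
  field_simp
  linear_combination (b ^ 2 * Λ ^ 2) * e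

/-- On a quadric the acceleration of a geodesic is normal, that is, a multiple of the position
vector. In coordinates this follows from `Λ ⟨y, y⟩ = 12 (Ω - 1)`. -/
theorem hasDerivWithinAt_dEmbed {Λ : ℝ} (s : Pole) {y w : ℝ → Coord} {J : Set ℝ} {t : ℝ}
    (hy : HasDerivWithinAt y (w t) J t) (hw : HasDerivWithinAt w (flatAccel Λ (y t) (w t)) J t)
    (hΩ : conformal Λ (y t) ≠ 0) :
    HasDerivWithinAt (fun t => dEmbed Λ s (y t) (w t))
      (-(Λ / 3 * mink (w t) (w t) / conformal Λ (y t) ^ 2) • embed Λ s (y t)) J t := by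
  have e : Λ * mink (y t) (y t) = 12 * (conformal Λ (y t) - 1) := by simp only [conformal]; ring
  have h := hasDerivWithinAt_conformal Λ hy
  have hm := (hasDerivWithinAt_mink hy hw).const_mul (Λ / 6)
  have hq := hm.div (h.pow 2) (pow_ne_zero 2 hΩ)
  have ew : mink (y t) (flatAccel Λ (y t) (w t)) = Λ / (6 * conformal Λ (y t)) *
      (2 * mink (y t) (w t) ^ 2 - mink (w t) (w t) * mink (y t) (y t)) := by
    simp only [flatAccel, mink_smul_right, mink_sub_right]; ring
  simp only [dEmbed, embed_eq]
  refine HasDerivWithinAt.prodMk ?_ ?_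
  · refine (((h.inv hΩ).smul hw).sub (hq.smul hy)).congr_deriv ?_
    rw [ew]
    simp only [Pi.inv_apply, Pi.div_apply, Pi.pow_apply, flatAccel]
    generalize mink (w t) (w t) = a at *
    generalize mink (y t) (w t) = b at *
    generalize mink (y t) (y t) = c at *
    generalize conformal Λ (y t) = Ω at *
    ext i
    simp only [Pi.add_apply, Pi.sub_apply, Pi.smul_apply, smul_eq_mul]
    field_simp
    linear_combination (3 * Ω * a * y t i * Λ) * e
  · simp only [mul_div_assoc (-2 : ℝ)]
    refine ((hq.const_mul (-2)).const_mul s.sign).congr_deriv ?_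
    rw [ew]
    simp only [Pi.pow_apply]
    generalize mink (w t) (w t) = a at *
    generalize mink (y t) (w t) = b at *
    generalize mink (y t) (y t) = c at *
    generalize conformal Λ (y t) = Ω at *
    simp only [smul_eq_mul]
    field_simp
    linear_combination (6 * s.sign * Λ * Ω * a) * e

/-- The factor in front of the position is `Λ / 3` times the squared speed, a conserved quantity.
The embedded curve thus solves a linear equation with constant coefficient. -/
theorem embed_eq_flow {Λ : ℝ} (s : Pole) {y w : ℝ → Coord} {J : Set ℝ} (hJ : J.OrdConnected)
    (hy : ∀ t ∈ J, HasDerivWithinAt y (w t) J t)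
    (hw : ∀ t ∈ J, HasDerivWithinAt w (flatAccel Λ (y t) (w t)) J t)
    (hΩ : ∀ t ∈ J, conformal Λ (y t) ≠ 0) {t₀ t : ℝ} (ht₀ : t₀ ∈ J) (ht : t ∈ J) :
    (embed Λ s (y t), dEmbed Λ s (y t) (w t)) =
      flow (curv Λ (dEmbed Λ s (y t₀) (w t₀))) (t - t₀)
        (embed Λ s (y t₀), dEmbed Λ s (y t₀) (w t₀)) := by
  have hk : ∀ r ∈ J, Λ / 3 * mink (w r) (w r) / conformal Λ (y r) ^ 2 =
      curv Λ (dEmbed Λ s (y t₀) (w t₀)) := by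
    intro r hr
    rw [curv_dEmbed s (hΩ t₀ ht₀)]
    refine eq_of_hasDerivWithinAt_zero (f := fun r => Λ / 3 * mink (w r) (w r) /
      conformal Λ (y r) ^ 2) hJ (fun r hr => ?_) hr ht₀
    have h1 := hasDerivWithinAt_conformal Λ (hy r hr)
    have h2 := (hasDerivWithinAt_mink (hw r hr) (hw r hr)).const_mul (Λ / 3)
    refine (h2.div (h1.pow 2) (pow_ne_zero 2 (hΩ r hr))).congr_deriv ?_
    have hΩ := hΩ r hr
    rw [mink_comm (flatAccel _ _ _)]
    simp only [flatAccel, mink_smul_right, mink_sub_right, Pi.pow_apply, mink_comm (w r) (y r)]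
    field_simp
    ring
  refine eq_flow_of_hasDerivWithinAt hJ (fun r hr => hasDerivWithinAt_embed s (hy r hr) (hΩ r hr))
    (fun r hr => ?_) ht₀ ht
  rw [← hk r hr]
  exact hasDerivWithinAt_dEmbed s (hy r hr) (hw r hr) (hΩ r hr)

/-! ### Geodesics in coordinates related to the conformally flat ones -/

/-- The first order system of the geodesic equation of the pullback of the background metric by the
coordinate transformation `T`. -/
def pullField (Λ : ℝ) (T : Coord → Coord) (W : Coord × Coord) : Coord × Coord :=
  (W.2, (fderiv ℝ T W.1).inverse
    (flatAccel Λ (T W.1) (fderiv ℝ T W.1 W.2) - fderiv ℝ (fderiv ℝ T) W.1 W.2 W.2))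

/-- The second derivative of `T ∘ x` is `D²T(x', x') + DT x''`, and `pullField` is defined so that
this equals `flatAccel`. -/
theorem embed_comp_eq_flow {Λ : ℝ} (s : Pole) {T : Coord → Coord} {W : ℝ → Coord × Coord}
    {J : Set ℝ} (hJ : J.OrdConnected)
    (hW : ∀ t ∈ J, HasDerivWithinAt W (pullField Λ T (W t)) J t)
    (hT : ∀ t ∈ J, ContDiffAt ℝ 2 T (W t).1)
    (hinv : ∀ t ∈ J, (fderiv ℝ T (W t).1).IsInvertible)
    (hΩ : ∀ t ∈ J, conformal Λ (T (W t).1) ≠ 0) {t₀ t : ℝ} (ht₀ : t₀ ∈ J) (ht : t ∈ J) :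
    (embed Λ s (T (W t).1), dEmbed Λ s (T (W t).1) (fderiv ℝ T (W t).1 (W t).2)) =
      flow (curv Λ (dEmbed Λ s (T (W t₀).1) (fderiv ℝ T (W t₀).1 (W t₀).2))) (t - t₀)
        (embed Λ s (T (W t₀).1), dEmbed Λ s (T (W t₀).1) (fderiv ℝ T (W t₀).1 (W t₀).2)) := by
  have h1 : ∀ t ∈ J, HasDerivWithinAt (fun t => (W t).1) (W t).2 J t := fun t ht =>
    (hasFDerivAt_fst (𝕜 := ℝ) (p := W t)).comp_hasDerivWithinAt t (hW t ht)
  have h2 : ∀ t ∈ J, HasDerivWithinAt (fun t => (W t).2) (pullField Λ T (W t)).2 J t :=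
    fun t ht => (hasFDerivAt_snd (𝕜 := ℝ) (p := W t)).comp_hasDerivWithinAt t (hW t ht)
  refine embed_eq_flow s (y := fun t => T (W t).1) (w := fun t => fderiv ℝ T (W t).1 (W t).2) hJ
    (fun t ht => ?_) (fun t ht => ?_) hΩ ht₀ ht
  · exact ((hT t ht).differentiableAt (by norm_num)).hasFDerivAt.comp_hasDerivWithinAt t (h1 t ht)
  · have hT' : DifferentiableAt ℝ (fderiv ℝ T) (W t).1 :=
      ((hT t ht).fderiv_right (m := 1) (by norm_num)).differentiableAt (by norm_num)
    have h3 : HasDerivWithinAt (fun t => fderiv ℝ T (W t).1)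
      (fderiv ℝ (fderiv ℝ T) (W t).1 (W t).2) J t :=
      hT'.hasFDerivAt.comp_hasDerivWithinAt t (h1 t ht)
    refine (h3.clm_apply (h2 t ht)).congr_deriv ?_
    simp only [pullField]
    rw [(hinv t ht).self_apply_inverse]
    abel

theorem fderiv_apply_eq_sum_pd {n : ℕ} (f : (Fin n → ℝ) → ℝ) (x w : Fin n → ℝ) :
    fderiv ℝ f x w = ∑ i, pd f i x * w i := by
  conv_lhs => rw [pi_eq_sum_univ' w, map_sum]
  refine Finset.sum_congr rfl fun i _ => ?_
  rw [map_smul, smul_eq_mul, mul_comm]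
  rfl

end ImpulsiveWave

/-! ### The Christoffel symbols of a pulled-back background metric. -/

namespace ImpulsiveWave

/-- The pullback of the background metric by `T`, as a bilinear form. -/
def pullForm (Λ : ℝ) (T : Coord → Coord) (y e f : Coord) : ℝ :=
  (conformal Λ (T y) ^ 2)⁻¹ * mink (fderiv ℝ T y e) (fderiv ℝ T y f)

/-- The derivative of `pullForm Λ T · e f` in the direction `h`. -/
def pullFormDeriv (Λ : ℝ) (T : Coord → Coord) (y h e f : Coord) : ℝ :=
  -(2 * (Λ / 6 * mink (T y) (fderiv ℝ T y h)) / conformal Λ (T y) ^ 3) *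
      mink (fderiv ℝ T y e) (fderiv ℝ T y f) +
    (conformal Λ (T y) ^ 2)⁻¹ * (mink (fderiv ℝ (fderiv ℝ T) y h e) (fderiv ℝ T y f) +
      mink (fderiv ℝ T y e) (fderiv ℝ (fderiv ℝ T) y h f))

section

variable {Λ : ℝ} {T : Coord → Coord} {x : Coord}

theorem differentiableAt_mink {E : Type*} [NormedAddCommGroup E] [NormedSpace ℝ E]
    {f g : E → Coord} {x : E} (hf : DifferentiableAt ℝ f x)
    (hg : DifferentiableAt ℝ g x) : DifferentiableAt ℝ (fun y => mink (f y) (g y)) x := by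
  have hf := differentiableAt_pi.1 hf
  have hg := differentiableAt_pi.1 hg
  simp only [mink]
  exact ((((hf 2).mul (hg 2)).add ((hf 3).mul (hg 3))).sub ((hf 0).mul (hg 1))).sub
    ((hf 1).mul (hg 0))

theorem differentiableAt_pullForm (hT : ContDiffAt ℝ 2 T x) (hΩ : conformal Λ (T x) ≠ 0)
    (e f : Coord) : DifferentiableAt ℝ (fun y => pullForm Λ T y e f) x := by
  have hT' : DifferentiableAt ℝ (fderiv ℝ T) x :=
    (hT.fderiv_right (m := 1) (by norm_num)).differentiableAt (by norm_num)
  have hT0 : DifferentiableAt ℝ T x := hT.differentiableAt (by norm_num)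
  have hc : DifferentiableAt ℝ (fun y => conformal Λ (T y)) x := by
    simp only [conformal]
    exact ((differentiableAt_mink hT0 hT0).const_mul _).const_add _
  simp only [pullForm]
  exact ((hc.pow 2).inv (pow_ne_zero 2 hΩ)).mul
    (differentiableAt_mink (hT'.clm_apply (differentiableAt_const e))
      (hT'.clm_apply (differentiableAt_const f)))

/-- Restricting to the line `x + t h` turns the claim into product and chain rules in one variable.
-/
theorem fderiv_pullForm (hT : ContDiffAt ℝ 2 T x) (hΩ : conformal Λ (T x) ≠ 0)
    (h e f : Coord) : fderiv ℝ (fun y => pullForm Λ T y e f) x h = pullFormDeriv Λ T x h e f := by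
  have hT' : DifferentiableAt ℝ (fderiv ℝ T) x :=
    (hT.fderiv_right (m := 1) (by norm_num)).differentiableAt (by norm_num)
  have hT0 : DifferentiableAt ℝ T x := hT.differentiableAt (by norm_num)
  refine ((differentiableAt_pullForm hT hΩ e f).hasFDerivAt.hasLineDerivAt h).unique ?_
  have hl : HasDerivWithinAt (fun t : ℝ => x + t • h) h univ 0 := by
    exact ((((hasDerivAt_id (0 : ℝ)).smul_const h).const_add x).congr_deriv
      (one_smul ℝ h)).hasDerivWithinAt
  have l0 : x + (0 : ℝ) • h = x := by simp
  have h1 : HasDerivWithinAt (fun t : ℝ => T (x + t • h)) (fderiv ℝ T x h) univ 0 := by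
    refine HasFDerivAt.comp_hasDerivWithinAt (𝕜 := ℝ) 0 ?_ hl
    rw [l0]; exact hT0.hasFDerivAt
  have h2 : HasDerivWithinAt (fun t : ℝ => fderiv ℝ T (x + t • h)) (fderiv ℝ (fderiv ℝ T) x h)
      univ 0 := by
    refine HasFDerivAt.comp_hasDerivWithinAt (𝕜 := ℝ) 0 ?_ hl
    rw [l0]; exact hT'.hasFDerivAt
  have h3 : ∀ e, HasDerivWithinAt (fun t : ℝ => fderiv ℝ T (x + t • h) e)
      (fderiv ℝ (fderiv ℝ T) x h e) univ 0 := fun e =>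
    (h2.clm_apply (hasDerivWithinAt_const _ _ e)).congr_deriv (by simp)
  have h4 := (((hasDerivWithinAt_conformal Λ h1).pow 2).inv
    (by simp only [Pi.pow_apply, l0]; exact pow_ne_zero 2 hΩ)).mul
    (hasDerivWithinAt_mink (h3 e) (h3 f))
  rw [HasLineDerivAt, ← hasDerivWithinAt_univ]
  refine h4.congr_deriv ?_
  simp only [Pi.inv_apply, Pi.pow_apply, l0, pullFormDeriv]
  generalize conformal Λ (T x) = Ω at *
  field_simp
  norm_num
  ring

end

/-- The geodesic equation of a metric that is locally the pullback of the background metric. -/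
theorem geodesicField_eq_pullField {Λ : ℝ} {H : Plane → ℝ} {T : Coord → Coord} {x : Coord}
    (hT : ContDiffAt ℝ 2 T x) (hinv : (fderiv ℝ T x).IsInvertible) (hΩ : conformal Λ (T x) ≠ 0)
    (hg : ∀ᶠ y in 𝓝 x, ∀ i j, metric Λ H y i j =
      pullForm Λ T y (Pi.single i 1) (Pi.single j 1)) (w : Coord) :
    geodesicField Λ H (x, w) = pullField Λ T (x, w) := by
  have hcomb : ∀ᶠ y in 𝓝 x, ∀ i (f : Coord), ∑ j, metric Λ H y i j * f j =
      pullForm Λ T y (Pi.single i 1) f := by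
    filter_upwards [hg] with y hy i f
    simp only [hy, pullForm]
    conv_rhs => rw [pi_eq_sum_univ' f, map_sum]
    simp only [map_smul, mul_assoc, ← Finset.mul_sum]
    congr 1
    simp only [mink, Finset.sum_apply, Pi.smul_apply, smul_eq_mul, Finset.mul_sum,
      ← Finset.sum_add_distrib, ← Finset.sum_sub_distrib]
    refine Finset.sum_congr rfl fun j _ => ?_
    ring
  have hcomb2 : ∀ᶠ y in 𝓝 x, ∀ e f : Coord, ∑ i, e i * ∑ j, metric Λ H y i j * f j =
      pullForm Λ T y e f := by
    filter_upwards [hcomb] with y hy e f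
    simp only [hy, pullForm]
    conv_rhs => rw [pi_eq_sum_univ' e, map_sum]
    simp only [map_smul, mul_left_comm _ (conformal Λ (T y) ^ 2)⁻¹, ← Finset.mul_sum]
    congr 1
    simp only [mink, Finset.sum_apply, Pi.smul_apply, smul_eq_mul, Finset.sum_mul,
      ← Finset.sum_add_distrib, ← Finset.sum_sub_distrib]
    refine Finset.sum_congr rfl fun j _ => ?_
    ring
  have hdiff : ∀ i j, DifferentiableAt ℝ (fun y => metric Λ H y i j) x := fun i j =>
    (differentiableAt_pullForm hT hΩ (Pi.single i 1) (Pi.single j 1)).congr_of_eventuallyEq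
      (hg.mono fun y hy => hy i j)
  -- first derivatives of the metric, contracted with `w`
  have hD1 : ∀ l (h : Coord), ∑ ν, ∑ ρ, pd (fun y => metric Λ H y l ρ) ν x * h ν * w ρ =
      pullFormDeriv Λ T x h (Pi.single l 1) w := by
    intro l h
    rw [← fderiv_pullForm hT hΩ, ← Filter.EventuallyEq.fderiv_eq (hcomb.mono fun y hy => hy l w :
        (fun y => ∑ j, metric Λ H y l j * w j) =ᶠ[𝓝 x]
          fun y => pullForm Λ T y (Pi.single l 1) w),
      fderiv_fun_sum fun j _ => (hdiff l j).mul_const _, Finset.sum_comm,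
      sum_apply]
    refine Finset.sum_congr rfl fun ρ _ => ?_
    rw [fderiv_mul_const (hdiff l ρ), smul_apply, fderiv_apply_eq_sum_pd,
      Finset.smul_sum]
    refine Finset.sum_congr rfl fun ν _ => ?_
    rw [smul_eq_mul]; ring
  have hD2 : ∀ l, ∑ ν, ∑ ρ, pd (fun y => metric Λ H y ν ρ) l x * w ν * w ρ =
      pullFormDeriv Λ T x (Pi.single l 1) w w := by
    intro l
    rw [← fderiv_pullForm hT hΩ, ← Filter.EventuallyEq.fderiv_eq (hcomb2.mono fun y hy => hy w w :
        (fun y => ∑ i, w i * ∑ j, metric Λ H y i j * w j) =ᶠ[𝓝 x]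
          fun y => pullForm Λ T y w w),
      fderiv_fun_sum fun i _ => (DifferentiableAt.fun_sum fun j _ =>
        (hdiff i j).mul_const _).const_mul _, sum_apply]
    refine Finset.sum_congr rfl fun i _ => ?_
    rw [fderiv_const_mul (DifferentiableAt.fun_sum fun j _ => (hdiff i j).mul_const _),
      fderiv_fun_sum fun j _ => (hdiff i j).mul_const _, smul_apply,
      sum_apply, Finset.smul_sum]
    refine Finset.sum_congr rfl fun j _ => ?_
    rw [fderiv_mul_const (hdiff i j), smul_apply]
    simp only [smul_eq_mul, pd]; ring
  -- The acceleration `a` is shown to satisfy the geodesic equation with lowered index (`hkey`);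
  -- nondegeneracy of the metric then raises the index.
  set a : Coord := (pullField Λ T (x, w)).2 with ha
  have hTa : fderiv ℝ T x a = flatAccel Λ (T x) (fderiv ℝ T x w) -
      fderiv ℝ (fderiv ℝ T) x w w := hinv.self_apply_inverse _
  have hsymm : IsSymmSndFDerivAt ℝ T x := hT.isSymmSndFDerivAt (by simp)
  have hkey : ∀ l, ∑ m, metric Λ H x l m * a m = -(1 / 2 * ∑ ν, ∑ ρ,
      (pd (fun y => metric Λ H y l ρ) ν x + pd (fun y => metric Λ H y l ν) ρ x
      - pd (fun y => metric Λ H y ν ρ) l x) * w ν * w ρ) := by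
    intro l
    have e1 : ∑ ν, ∑ ρ, (pd (fun y => metric Λ H y l ρ) ν x + pd (fun y => metric Λ H y l ν) ρ x
        - pd (fun y => metric Λ H y ν ρ) l x) * w ν * w ρ =
        2 * pullFormDeriv Λ T x w (Pi.single l 1) w
          - pullFormDeriv Λ T x (Pi.single l 1) w w := by
      have e2 : ∑ ν, ∑ ρ, pd (fun y => metric Λ H y l ν) ρ x * w ν * w ρ =
          pullFormDeriv Λ T x w (Pi.single l 1) w := by
        rw [← hD1 l w, Finset.sum_comm]
        refine Finset.sum_congr rfl fun i _ => Finset.sum_congr rfl fun j _ => ?_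
        ring
      rw [two_mul, ← hD2 l]
      nth_rewrite 1 [← hD1 l w]
      rw [← e2]
      simp only [← Finset.sum_add_distrib, ← Finset.sum_sub_distrib]
      refine Finset.sum_congr rfl fun i _ => Finset.sum_congr rfl fun j _ => ?_
      ring
    rw [e1, hcomb.self_of_nhds l a, pullForm, hTa]
    -- By symmetry of `D²T` the terms containing `D²T(w, e_l)` cancel in the Christoffel
    -- combination. What remains is `⟨DT e_l, D²T(w, w)⟩` and the derivatives of the conformal
    -- factor.
    have hs : fderiv ℝ (fderiv ℝ T) x w (Pi.single l 1) =
      fderiv ℝ (fderiv ℝ T) x (Pi.single l 1) w := hsymm _ _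
    simp only [pullFormDeriv, hs, flatAccel, mink_sub_right, mink_smul_right]
    rw [mink_comm (fderiv ℝ T x w) (fderiv ℝ (fderiv ℝ T) x (Pi.single l 1) w),
      mink_comm (T x) (fderiv ℝ T x (Pi.single l 1))]
    generalize conformal Λ (T x) = Ω at *
    field_simp
    ring
  -- The pulled-back form is nondegenerate since `mink` is and `DT` is bijective.
  have hM : IsUnit (metric Λ H x) := by
    rw [← Matrix.mulVec_injective_iff_isUnit]
    intro b c hbc
    refine sub_eq_zero.1 (hinv.injective (a₁ := b - c) (a₂ := 0) ?_)
    rw [map_zero]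
    refine eq_zero_of_mink_eq_zero fun z => ?_
    obtain ⟨e, rfl⟩ := hinv.surjective z
    have h0 : pullForm Λ T x e (b - c) = 0 := by
      rw [← hcomb2.self_of_nhds]
      have : ∀ i, ∑ j, metric Λ H x i j * (b - c) j = 0 := fun i => by
        have := congrFun hbc i
        simp only [Matrix.mulVec, dotProduct] at this
        simp [mul_sub, this]
      exact Finset.sum_eq_zero fun i _ => by rw [this i, mul_zero]
    exact (mul_eq_zero.1 h0).resolve_left (inv_ne_zero (pow_ne_zero 2 hΩ))
  refine Prod.ext rfl ?_
  rw [← ha]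
  have hinvM : (metric Λ H x)⁻¹ * metric Λ H x = 1 :=
    Matrix.nonsing_inv_mul _ ((Matrix.isUnit_iff_isUnit_det _).1 hM)
  have ha' : a = (metric Λ H x)⁻¹.mulVec ((metric Λ H x).mulVec a) := by
    rw [Matrix.mulVec_mulVec, hinvM, Matrix.one_mulVec]
  rw [ha']
  ext μ
  simp only [geodesicField, christoffel, Matrix.mulVec, dotProduct]
  simp only [hkey, mul_neg, Finset.sum_neg_distrib, neg_inj, Finset.mul_sum, Finset.sum_mul]
  rw [Finset.sum_congr rfl fun ν _ => Finset.sum_comm, Finset.sum_comm]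
  refine Finset.sum_congr rfl fun i _ => Finset.sum_congr rfl fun j _ =>
    Finset.sum_congr rfl fun k _ => ?_
  ring

end ImpulsiveWave

namespace ImpulsiveWave

/-! ### The flat coordinates -/

theorem pullForm_id (Λ : ℝ) (y e f : Coord) :
    pullForm Λ id y e f = (conformal Λ y ^ 2)⁻¹ * mink e f := by
  simp [pullForm]

theorem omega_eq_conformal {Λ : ℝ} {H : Plane → ℝ} {y : Coord} (h : y 0 ≤ 0 ∨ H = 0) :
    omega Λ H y = conformal Λ y := by
  rcases h with h | h
  · simp only [omega, conformal, kink, max_eq_right h, mink, planeSq, planePart]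
    simp [-mul_eq_mul_left_iff]; ring
  · simp only [omega, conformal, h, profileG, pd, mink, planeSq, planePart]
    simp [-mul_eq_mul_left_iff]; ring

theorem metric_eq_flat {Λ : ℝ} {H : Plane → ℝ} {y : Coord} (h : y 0 ≤ 0 ∨ H = 0) (i j : Fin 4) :
    metric Λ H y i j = pullForm Λ id y (Pi.single i 1) (Pi.single j 1) := by
  have hs : ∀ a b, spatialMetric H y a b = if a = b then 1 else 0 := by
    intro a b
    rcases h with h | h
    · simp [spatialMetric, kink, max_eq_right h]
    · have : ∀ i, pd (0 : Plane → ℝ) i = 0 := fun i => by ext; simp [pd]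
      simp [spatialMetric, h, this]
  rw [pullForm_id, metric, omega_eq_conformal h]
  simp only [hs]
  fin_cases i <;> fin_cases j <;> simp [mink]

/-! ### The continuous coordinates behind the wave -/

/-- The transformation from the continuous to the conformally flat coordinates behind the wave, as
a smooth map on both sides of the wave surface. -/
def waveMap (H : Plane → ℝ) (x : Coord) : Coord :=
  ![x 0,
    x 1 + H (planePart x) + 1 / 2 * x 0 * (pd H 0 (planePart x) ^ 2 + pd H 1 (planePart x) ^ 2),
    x 2 + x 0 * pd H 0 (planePart x),
    x 3 + x 0 * pd H 1 (planePart x)]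

theorem toConformallyFlat_of_nonpos {H : Plane → ℝ} {x : Coord} (h : x 0 ≤ 0) :
    toConformallyFlat H x = x := by
  simp [toConformallyFlat, h]

theorem toConformallyFlat_of_pos {H : Plane → ℝ} {x : Coord} (h : 0 < x 0) :
    toConformallyFlat H x = waveMap H x := by
  simp [toConformallyFlat, h.not_ge, waveMap]

theorem toConformallyFlat_zero (x : Coord) : toConformallyFlat 0 x = x := by
  have : ∀ i X, pd (0 : Plane → ℝ) i X = 0 := fun i => by simp [pd]
  rcases le_or_gt (x 0) 0 with h | h
  · exact toConformallyFlat_of_nonpos h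
  · rw [toConformallyFlat_of_pos h]
    ext i
    fin_cases i <;> simp [waveMap, this]

/-- The differential of `waveMap`. -/
def waveDeriv (H : Plane → ℝ) (x e : Coord) : Coord :=
  let p : Fin 2 → ℝ := fun i => pd H i (planePart x)
  let q : Fin 2 → ℝ := fun i => pd (pd H i) 0 (planePart x) * e 2 + pd (pd H i) 1 (planePart x) * e 3
  ![e 0,
    e 1 + (p 0 * e 2 + p 1 * e 3) + 1 / 2 * e 0 * (p 0 ^ 2 + p 1 ^ 2)
      + x 0 * (p 0 * q 0 + p 1 * q 1),
    e 2 + e 0 * p 0 + x 0 * q 0,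
    e 3 + e 0 * p 1 + x 0 * q 1]

theorem contDiff_planePart {n : WithTop ℕ∞} : ContDiff ℝ n planePart := by
  refine contDiff_pi.2 fun i => ?_
  fin_cases i
  · exact contDiff_apply ℝ ℝ 2
  · exact contDiff_apply ℝ ℝ 3

section

variable {H : Plane → ℝ}

theorem contDiffAt_pd {X : Plane} (hH : ContDiffAt ℝ ∞ H X) (i : Fin 2) :
    ContDiffAt ℝ ∞ (pd H i) X :=
  (hH.fderiv_right (m := ∞) (by simp)).clm_apply contDiffAt_const

variable {x : Coord}

theorem contDiffAt_waveMap (hH : ContDiffAt ℝ ∞ H (planePart x)) :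
    ContDiffAt ℝ ∞ (waveMap H) x := by
  have h0 : ContDiffAt ℝ ∞ (fun x => H (planePart x)) x := hH.comp x contDiff_planePart.contDiffAt
  have h1 : ∀ i, ContDiffAt ℝ ∞ (fun x => pd H i (planePart x)) x := fun i =>
    (contDiffAt_pd hH i).comp x contDiff_planePart.contDiffAt
  have hx : ∀ i : Fin 4, ContDiffAt ℝ ∞ (fun x : Coord => x i) x := fun i =>
    (contDiff_apply ℝ ℝ i).contDiffAt
  refine contDiffAt_pi.2 fun i => ?_
  fin_cases i
  · exact hx 0
  · exact ((hx 1).add h0).add ((contDiffAt_const.mul (hx 0)).mul (((h1 0).pow 2).add ((h1 1).pow 2)))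
  · exact (hx 2).add ((hx 0).mul (h1 0))
  · exact (hx 3).add ((hx 0).mul (h1 1))

theorem fderiv_waveMap (hH : ContDiffAt ℝ ∞ H (planePart x)) (e : Coord) :
    fderiv ℝ (waveMap H) x e = waveDeriv H x e := by
  refine (((contDiffAt_waveMap hH).differentiableAt
    (by simp)).hasFDerivAt.hasLineDerivAt e).unique ?_
  have hl : HasDerivAt (fun t : ℝ => x + t • e) e 0 :=
    (((hasDerivAt_id (0 : ℝ)).smul_const e).const_add x).congr_deriv (one_smul ℝ e)
  have l0 : x + (0 : ℝ) • e = x := by simp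
  have hx : ∀ i : Fin 4, HasDerivAt (fun t : ℝ => (x + t • e) i) (e i) 0 := hasDerivAt_pi.1 hl
  have hP : HasDerivAt (fun t : ℝ => planePart (x + t • e)) (planePart e) 0 := by
    refine hasDerivAt_pi.2 fun i => ?_
    fin_cases i
    · exact hx 2
    · exact hx 3
  have hF : ∀ F : Plane → ℝ, ContDiffAt ℝ ∞ F (planePart x) →
      HasDerivAt (fun t : ℝ => F (planePart (x + t • e)))
        (pd F 0 (planePart x) * e 2 + pd F 1 (planePart x) * e 3) 0 := by
    intro F hF
    have h1 : HasFDerivAt F (fderiv ℝ F (planePart x)) (planePart (x + (0 : ℝ) • e)) := by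
      rw [l0]; exact (hF.differentiableAt (by simp)).hasFDerivAt
    refine (h1.comp_hasDerivAt 0 hP).congr_deriv ?_
    rw [fderiv_apply_eq_sum_pd, Fin.sum_univ_two]
    simp [planePart]
  have h0 := hF H hH
  have h1 := fun i => hF (pd H i) (contDiffAt_pd hH i)
  rw [HasLineDerivAt]
  refine hasDerivAt_pi.2 fun i => ?_
  fin_cases i
  · exact hx 0
  · refine (((hx 1).add h0).add (((hx 0).const_mul (1 / 2)).mul
      (((h1 0).pow 2).add ((h1 1).pow 2)))).congr_deriv ?_
    simp [waveDeriv]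
    ring
  · refine ((hx 2).add ((hx 0).mul (h1 0))).congr_deriv ?_
    simp [waveDeriv]
    ring
  · refine ((hx 3).add ((hx 0).mul (h1 1))).congr_deriv ?_
    simp [waveDeriv]
    ring

theorem pd_pd_comm {X : Plane} (hH : ContDiffAt ℝ ∞ H X) (i j : Fin 2) :
    pd (pd H i) j X = pd (pd H j) i X := by
  have hd : DifferentiableAt ℝ (fderiv ℝ H) X :=
    (hH.fderiv_right (m := ∞) (by simp)).differentiableAt (by simp)
  have key : ∀ i j, pd (pd H i) j X = fderiv ℝ (fderiv ℝ H) X (Pi.single j 1) (Pi.single i 1) := by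
    intro i j
    change fderiv ℝ (fun y => fderiv ℝ H y (Pi.single i 1)) X (Pi.single j 1) = _
    rw [fderiv_clm_apply hd (differentiableAt_const _)]
    simp
  rw [key, key]
  exact (by exact_mod_cast contDiffAt_infty.1 hH 2 : ContDiffAt ℝ 2 H X).isSymmSndFDerivAt (by simp) _ _

/-- The terms quadratic in the gradient of `H` cancel in `x² + y² - 2𝒰𝒱`, and the linear ones
combine with `H` to `-2UG`. -/
theorem conformal_waveMap (Λ : ℝ) (hx : 0 ≤ x 0) :
    conformal Λ (waveMap H x) = omega Λ H x := by
  simp only [omega, conformal, kink, max_eq_left hx, mink, planeSq, waveMap, profileG,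
    Fin.sum_univ_two, Matrix.cons_val]
  simp only [planePart, Matrix.cons_val]
  ring

/-- The shift of `𝒱` is chosen so that all mixed terms `dU dX` and the `dU²` term cancel. The
spatial part is the square of `1 + U Hess H`, by symmetry of the Hessian. -/
theorem metric_eq_wave {Λ : ℝ} (hH : ContDiffAt ℝ ∞ H (planePart x)) (hx : 0 ≤ x 0)
    (i j : Fin 4) :
    metric Λ H x i j = pullForm Λ (waveMap H) x (Pi.single i 1) (Pi.single j 1) := by
  simp only [pullForm, conformal_waveMap Λ hx, fderiv_waveMap hH, metric]
  have hs := pd_pd_comm hH 1 0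
  fin_cases i <;> fin_cases j <;>
    simp [mink, waveDeriv, spatialMetric, kink, max_eq_left hx, hs, -mul_eq_mul_left_iff,
      -mul_eq_mul_right_iff, -mul_eq_zero, -zero_eq_mul] <;> ring

/-- The determinant of the spatial part of the differential of `waveMap`. -/
def hessDet (H : Plane → ℝ) (x : Coord) : ℝ :=
  (1 + x 0 * pd (pd H 0) 0 (planePart x)) * (1 + x 0 * pd (pd H 1) 1 (planePart x))
    - x 0 * pd (pd H 0) 1 (planePart x) * (x 0 * pd (pd H 1) 0 (planePart x))

/-- Since the spatial metric is the square of `1 + U Hess H`, its nondegeneracy is exactly local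
invertibility of `waveMap`. -/
theorem det_spatialMetric (hH : ContDiffAt ℝ ∞ H (planePart x)) (hx : 0 ≤ x 0) :
    (spatialMetric H x).det = hessDet H x ^ 2 := by
  have hs := pd_pd_comm hH 1 0
  simp [Matrix.det_fin_two, spatialMetric, hessDet, kink, max_eq_left hx, hs]
  ring

theorem isInvertible_of_injective {f : Coord →L[ℝ] Coord} (hf : ∀ e, f e = 0 → e = 0) :
    f.IsInvertible := by
  have hinj : Function.Injective (f : Coord →ₗ[ℝ] Coord) :=
    (injective_iff_map_eq_zero _).2 hf
  exact ⟨(LinearEquiv.ofInjectiveEndo _ hinj).toContinuousLinearEquiv, by ext; simp⟩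

theorem isInvertible_fderiv_waveMap (hH : ContDiffAt ℝ ∞ H (planePart x)) (hd : hessDet H x ≠ 0) :
    (fderiv ℝ (waveMap H) x).IsInvertible := by
  refine isInvertible_of_injective fun e he => ?_
  rw [fderiv_waveMap hH] at he
  have h0 := congrFun he 0
  have h1 := congrFun he 1
  have h2 := congrFun he 2
  have h3 := congrFun he 3
  simp only [waveDeriv, Pi.zero_apply, Matrix.cons_val] at h0 h1 h2 h3
  simp only [hessDet] at hd
  generalize pd (pd H 0) 0 (planePart x) = a at *
  generalize pd (pd H 0) 1 (planePart x) = b at *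
  generalize pd (pd H 1) 0 (planePart x) = c at *
  generalize pd (pd H 1) 1 (planePart x) = d at *
  generalize pd H 0 (planePart x) = p at *
  generalize pd H 1 (planePart x) = q at *
  rw [h0] at h1 h2 h3
  have e2 : e 2 = 0 := by
    refine (mul_eq_zero.1 ?_).resolve_left hd
    linear_combination (1 + x 0 * d) * h2 - x 0 * b * h3
  have e3 : e 3 = 0 := by
    refine (mul_eq_zero.1 ?_).resolve_left hd
    linear_combination (1 + x 0 * a) * h3 - x 0 * c * h2
  rw [e2, e3] at h1
  have e1 : e 1 = 0 := by linear_combination h1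
  ext i
  fin_cases i <;> simp [h0, e1, e2, e3]

end

/-- This is the regularity needed for local solvability and for continuity of the right-hand side;
operator inversion is smooth at invertible maps. -/
theorem contDiffAt_pullField {Λ : ℝ} {T : Coord → Coord} {W : Coord × Coord}
    (hT : ContDiffAt ℝ ∞ T W.1) (hinv : (fderiv ℝ T W.1).IsInvertible)
    (hΩ : conformal Λ (T W.1) ≠ 0) : ContDiffAt ℝ 1 (pullField Λ T) W := by
  have h1 : ContDiffAt ℝ ∞ (fderiv ℝ T) W.1 := hT.fderiv_right (m := ∞) (by simp)
  have h2 : ContDiffAt ℝ ∞ (fderiv ℝ (fderiv ℝ T)) W.1 := h1.fderiv_right (m := ∞) (by simp)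
  have g0 : ContDiffAt ℝ ∞ (fun W : Coord × Coord => T W.1) W := hT.comp W contDiffAt_fst
  have g1 : ContDiffAt ℝ ∞ (fun W : Coord × Coord => fderiv ℝ T W.1) W := h1.comp W contDiffAt_fst
  have g2 : ContDiffAt ℝ ∞ (fun W : Coord × Coord => fderiv ℝ (fderiv ℝ T) W.1) W :=
    h2.comp W contDiffAt_fst
  have gw : ContDiffAt ℝ ∞ (fun W : Coord × Coord => fderiv ℝ T W.1 W.2) W :=
    g1.clm_apply contDiffAt_snd
  have hm : ∀ {f g : Coord × Coord → Coord}, ContDiffAt ℝ ∞ f W → ContDiffAt ℝ ∞ g W →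
      ContDiffAt ℝ ∞ (fun W => mink (f W) (g W)) W := by
    intro f g hf hg
    have hf := contDiffAt_pi.1 hf
    have hg := contDiffAt_pi.1 hg
    simp only [mink]
    exact ((((hf 2).mul (hg 2)).add ((hf 3).mul (hg 3))).sub ((hf 0).mul (hg 1))).sub
      ((hf 1).mul (hg 0))
  have hc : ContDiffAt ℝ ∞ (fun W : Coord × Coord => conformal Λ (T W.1)) W :=
    contDiffAt_const.add (contDiffAt_const.mul (hm g0 g0))
  have hF : ContDiffAt ℝ ∞ (fun W : Coord × Coord => flatAccel Λ (T W.1) (fderiv ℝ T W.1 W.2)) W :=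
    (contDiffAt_const.div (contDiffAt_const.mul hc)
      (mul_ne_zero (by norm_num) hΩ)).smul
      (((contDiffAt_const.mul (hm g0 gw)).smul gw).sub ((hm gw gw).smul g0))
  have hi : ContDiffAt ℝ ∞ (fun W : Coord × Coord => (fderiv ℝ T W.1).inverse) W :=
    ContDiffAt.comp (g := ContinuousLinearMap.inverse) W hinv.contDiffAt_map_inverse g1
  exact (contDiffAt_snd.prodMk (hi.clm_apply (hF.sub
    ((g2.clm_apply contDiffAt_snd).clm_apply contDiffAt_snd)))).of_le (by simp)

end ImpulsiveWave

namespace ImpulsiveWave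

/-! ### Inverting the conformally flat coordinates -/

/-- `Λ / 3` times the inner product of the ambient space, in a form which makes sense for all
`Λ`. -/
def ambientForm (Λ : ℝ) (p q : Ambient) : ℝ := p.2 * q.2 + Λ / 3 * mink p.1 q.1

theorem curv_eq (Λ : ℝ) (v : Ambient) : curv Λ v = ambientForm Λ v v := by
  simp only [curv, ambientForm]; ring

/-- The conformally flat coordinates of a point of the background. -/
def chartPos (s : Pole) (p : Ambient) : Coord := (2 / (1 + s.sign * p.2)) • p.1

/-- The components of a tangent vector in conformally flat coordinates. -/
def chartVel (s : Pole) (p v : Ambient) : Coord :=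
  (2 / (1 + s.sign * p.2)) • v.1 - (2 * s.sign * v.2 / (1 + s.sign * p.2) ^ 2) • p.1

theorem Pole.sign_mul_self (s : Pole) : s.sign * s.sign = 1 := by
  rw [← sq, s.sign_sq]

section

variable {Λ : ℝ} {s : Pole} {p v : Ambient}

/-- On the quadric `(Λ/3)⟨p, p⟩ = 1 - z²`, and `1 - z²` factors as `(1 - sz)(1 + sz)`. So the chart
of pole `s` reaches every point with `sz > -1`. -/
theorem conformal_chartPos (hp : ambientForm Λ p p = 1) (hs : -1 < s.sign * p.2) :
    conformal Λ (chartPos s p) = 2 / (1 + s.sign * p.2) := by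
  have h : 1 + s.sign * p.2 ≠ 0 := by linarith
  have h2 : (s.sign * p.2) ^ 2 = p.2 * p.2 := by rw [mul_pow, s.sign_sq]; ring
  simp only [ambientForm] at hp
  simp only [conformal, chartPos, mink_smul_left, mink_smul_right]
  generalize s.sign * p.2 = m at *
  field_simp
  linear_combination 12 * hp + 12 * h2

theorem conformal_chartPos_pos (hp : ambientForm Λ p p = 1) (hs : -1 < s.sign * p.2) :
    0 < conformal Λ (chartPos s p) := by
  rw [conformal_chartPos hp hs]
  exact div_pos two_pos (by linarith)

theorem embed_chartPos (hp : ambientForm Λ p p = 1) (hs : -1 < s.sign * p.2) :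
    embed Λ s (chartPos s p) = p := by
  have h : 1 + s.sign * p.2 ≠ 0 := by linarith
  rw [embed_eq, conformal_chartPos hp hs, chartPos]
  refine Prod.ext ?_ ?_
  · rw [smul_smul, inv_mul_cancel₀ (div_ne_zero two_ne_zero h), one_smul]
  · simp only
    have := s.sign_mul_self
    field_simp
    linear_combination p.2 * this

theorem dEmbed_chartVel (hp : ambientForm Λ p p = 1) (hs : -1 < s.sign * p.2)
    (hv : ambientForm Λ p v = 0) :
    dEmbed Λ s (chartPos s p) (chartVel s p v) = v := by
  have h : 1 + s.sign * p.2 ≠ 0 := by linarith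
  have hss := s.sign_mul_self
  have hm : Λ / 6 * mink (chartPos s p) (chartVel s p v) / conformal Λ (chartPos s p) ^ 2 =
      -(s.sign * v.2 / 2) := by
    rw [conformal_chartPos hp hs]
    simp only [chartPos, chartVel, mink_smul_left, mink_sub_right, mink_smul_right]
    simp only [ambientForm] at hp hv
    generalize mink p.1 v.1 = a at *
    generalize mink p.1 p.1 = b at *
    field_simp
    linear_combination 6 * (1 + s.sign * p.2) * hv - 6 * s.sign * v.2 * hp
      + 6 * p.2 * v.2 * hss
  simp only [dEmbed]
  rw [mul_div_assoc (-2 : ℝ), hm]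
  refine Prod.ext ?_ ?_
  · rw [conformal_chartPos hp hs]
    simp only [chartPos, chartVel]
    ext i
    simp only [Pi.sub_apply, Pi.smul_apply, smul_eq_mul]
    field_simp
    ring
  · simp only
    linear_combination v.2 * hss

theorem ambientForm_embed {y : Coord} (hΩ : conformal Λ y ≠ 0) :
    ambientForm Λ (embed Λ s y) (embed Λ s y) = 1 := by
  have e : Λ * mink y y = 12 * (conformal Λ y - 1) := by simp only [conformal]; ring
  have hss := s.sign_mul_self
  simp only [ambientForm, embed_eq, mink_smul_left, mink_smul_right]
  generalize conformal Λ y = Ω at *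
  generalize mink y y = a at *
  field_simp
  linear_combination e + (3 * (2 - Ω) ^ 2) * hss

theorem ambientForm_embed_dEmbed {y w : Coord} (hΩ : conformal Λ y ≠ 0) :
    ambientForm Λ (embed Λ s y) (dEmbed Λ s y w) = 0 := by
  have e : Λ * mink y y = 12 * (conformal Λ y - 1) := by simp only [conformal]; ring
  have hss := s.sign_mul_self
  simp only [ambientForm, embed_eq, dEmbed, mink_smul_left, mink_smul_right, mink_sub_right]
  generalize conformal Λ y = Ω at *
  generalize mink y y = a at *
  generalize mink y w = b at *
  field_simp
  linear_combination (-Λ * b) * e + (-6 * (2 - Ω) * Λ * b) * hss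

theorem one_add_sign_mul_embed {y : Coord} :
    1 + s.sign * (embed Λ s y).2 = 2 / conformal Λ y := by
  have hss := s.sign_mul_self
  simp only [embed_eq]
  linear_combination (2 / conformal Λ y - 1) * hss

theorem neg_one_lt_sign_mul_embed {y : Coord} (hΩ : 0 < conformal Λ y) :
    -1 < s.sign * (embed Λ s y).2 := by
  have h := one_add_sign_mul_embed (Λ := Λ) (s := s) (y := y)
  have : 0 < 2 / conformal Λ y := by positivity
  linarith

theorem chartPos_embed {y : Coord} (hΩ : conformal Λ y ≠ 0) :
    chartPos s (embed Λ s y) = y := by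
  simp only [chartPos]
  rw [one_add_sign_mul_embed, embed_eq, smul_smul]
  field_simp
  simp

end

/-! ### The jump across the wave surface -/

/-- The null rotation of the ambient space with parameter `a`. It preserves `ambientForm`. -/
def nullRotation (Λ : ℝ) (a : Plane × ℝ) (v : Ambient) : Ambient :=
  (![v.1 0,
     v.1 1 + (a.1 0 * v.1 2 + a.1 1 * v.1 3 + a.2 * v.2)
       + 1 / 2 * (a.1 0 ^ 2 + a.1 1 ^ 2 + Λ / 3 * a.2 ^ 2) * v.1 0,
     v.1 2 + a.1 0 * v.1 0,
     v.1 3 + a.1 1 * v.1 0],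
   v.2 + Λ / 3 * a.2 * v.1 0)

theorem ambientForm_nullRotation (Λ : ℝ) (a : Plane × ℝ) (v w : Ambient) :
    ambientForm Λ (nullRotation Λ a v) (nullRotation Λ a w) = ambientForm Λ v w := by
  simp only [ambientForm, nullRotation, mink, Matrix.cons_val]
  ring

theorem nullRotation_neg (Λ : ℝ) (a : Plane × ℝ) (v : Ambient) :
    nullRotation Λ (-a) (nullRotation Λ a v) = v := by
  refine Prod.ext ?_ ?_
  · ext i
    fin_cases i <;> (simp [nullRotation]; try ring)
  · simp [nullRotation]

/-- The parameter of the null rotation that a wave with profile `H` causes at the point of the wave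
surface with spatial coordinates `X`. -/
def waveParam (Λ : ℝ) (s : Pole) (H : Plane → ℝ) (X : Plane) : Plane × ℝ :=
  (fun i => pd H i X + Λ / 6 * (X i / surfaceFactor Λ X) * profileG H X,
    s.sign * profileG H X / surfaceFactor Λ X)

theorem surfaceFactor_eq_conformal {Λ : ℝ} {y : Coord} (hy : y 0 = 0) :
    surfaceFactor Λ (planePart y) = conformal Λ y := by
  simp [surfaceFactor, conformal, planeSq, planePart, mink, hy]
  ring_nf
  simp

theorem conformal_waveMap_of_zero {Λ : ℝ} {H : Plane → ℝ} {y : Coord} (hy : y 0 = 0) :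
    conformal Λ (waveMap H y) = conformal Λ y := by
  simp [conformal, waveMap, mink, hy]

/-- At `Ũ = 0` both sides change only `Ṽ`. The gradient part of the parameter contributes `X·∇H /
Ω`; the terms with `G` contribute `G / Ω` because `Ω = 1 + (Λ/12)|X|²`. The sum is `H / Ω`. -/
theorem embed_waveMap {Λ : ℝ} {s : Pole} {H : Plane → ℝ} {y : Coord} (hy : y 0 = 0)
    (hΩ : conformal Λ y ≠ 0) :
    embed Λ s (waveMap H y) =
      nullRotation Λ (waveParam Λ s H (planePart y)) (embed Λ s y) := by
  have e : conformal Λ y = 1 + Λ / 12 * (y 2 ^ 2 + y 3 ^ 2) := by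
    simp only [conformal, mink, hy]; ring
  have hss := s.sign_mul_self
  rw [embed_eq, embed_eq, conformal_waveMap_of_zero hy]
  simp only [waveParam, surfaceFactor_eq_conformal hy, profileG, Fin.sum_univ_two]
  simp only [nullRotation, waveMap, Pi.smul_apply, smul_eq_mul, hy]
  have p2 : planePart y 0 = y 2 := rfl
  have p3 : planePart y 1 = y 3 := rfl
  rw [p2, p3]
  generalize H (planePart y) = h at *
  generalize pd H 0 (planePart y) = p at *
  generalize pd H 1 (planePart y) = q at *
  generalize conformal Λ y = Ω at *
  refine Prod.ext ?_ ?_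
  · ext i
    fin_cases i
    · simp
    · simp
      field_simp
      linear_combination (12 * (h - p * y 2 - q * y 3)) * e
        - (6 * (h - p * y 2 - q * y 3) * (2 - Ω)) * hss
    · simp
    · simp
  · simp

/-- Directions transversal to the surface are included. Thus the full initial data of a geodesic are
transformed by the same linear isometry that moves its position, and the flow can simply be
restarted. -/
theorem dEmbed_waveMap {Λ : ℝ} {s : Pole} {H : Plane → ℝ} {y w : Coord} (hy : y 0 = 0)
    (hΩ : conformal Λ y ≠ 0) :
    dEmbed Λ s (waveMap H y) (waveDeriv H y w) =
      nullRotation Λ (waveParam Λ s H (planePart y)) (dEmbed Λ s y w) := by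
  have e : conformal Λ y = 1 + Λ / 12 * (y 2 ^ 2 + y 3 ^ 2) := by
    simp only [conformal, mink, hy]; ring
  have hss := s.sign_mul_self
  simp only [dEmbed, conformal_waveMap_of_zero hy]
  simp only [waveParam, surfaceFactor_eq_conformal hy, profileG, Fin.sum_univ_two]
  simp only [nullRotation, waveMap, waveDeriv, mink, Pi.sub_apply, Pi.smul_apply, smul_eq_mul, hy,
    Matrix.cons_val]
  have p2 : planePart y 0 = y 2 := rfl
  have p3 : planePart y 1 = y 3 := rfl
  rw [p2, p3]
  generalize H (planePart y) = h at *
  generalize pd H 0 (planePart y) = p at *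
  generalize pd H 1 (planePart y) = q at *
  generalize conformal Λ y = Ω at *
  refine Prod.ext ?_ ?_
  · ext i
    fin_cases i
    · simp
    · simp
      field_simp
      linear_combination (72 * Λ * (w 2 * y 2 + w 3 * y 3 - w 0 * y 1) * (h - (p * y 2 + q * y 3))
        - 36 * Λ * w 0 * (h - (p * y 2 + q * y 3)) ^ 2) * (hss - e)
    · simp
      field_simp
      ring
    · simp
      field_simp
      ring
  · simp
    field_simp
    ring

/-! ### Independence of the pole -/

theorem hasDerivAt_line (X e : Plane) (i : Fin 2) :
    HasDerivAt (fun t : ℝ => (X + t • e) i) (e i) 0 :=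
  hasDerivAt_pi.1 ((((hasDerivAt_id (0 : ℝ)).smul_const e).const_add X).congr_deriv
    (one_smul ℝ e)) i

/-- With `r = (Λ/12)|X|²` the gluing relation reads `Hs = r H(X / r)`; it is differentiated along
the line `X + t e`. -/
theorem pd_profile_south {Λ : ℝ} {H Hs : Plane → ℝ} (hΛ : 0 < Λ) (hH : ContDiff ℝ ∞ H)
    (hHs : ContDiff ℝ ∞ Hs)
    (hglue : ∀ X : Plane, X ≠ 0 →
      Hs X = Λ / 12 * planeSq X * H ((12 / (Λ * planeSq X)) • X))
    {X Y : Plane} {r : ℝ} (hr : r = Λ / 12 * planeSq X) (hr0 : 0 < r) (hY : ∀ i, Y i = X i / r)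
    (i : Fin 2) :
    pd Hs i X = Λ / 6 * X i * (H Y - (Y 0 * pd H 0 Y + Y 1 * pd H 1 Y)) + pd H i Y := by
  set e : Plane := Pi.single i 1 with he
  have hX0 : X ≠ 0 := by
    rintro rfl
    simp [planeSq] at hr
    linarith
  have hq0 : planeSq X ≠ 0 := by
    intro h
    rw [h] at hr
    linarith
  have hYX : (12 / (Λ * planeSq X)) • X = Y := by
    ext j
    rw [hY j, hr, Pi.smul_apply, smul_eq_mul]
    field_simp
  have l0 : X + (0 : ℝ) • e = X := by simp
  have hne : ∀ᶠ t : ℝ in 𝓝 0, X + t • e ≠ 0 := by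
    have hc : ContinuousAt (fun t : ℝ => X + t • e) 0 := by fun_prop
    exact hc.eventually_ne (by rwa [l0])
  have hl := hasDerivAt_line X e
  have h1 : HasDerivAt (fun t : ℝ => Λ / 12 * planeSq (X + t • e))
      (Λ / 6 * (X 0 * e 0 + X 1 * e 1)) 0 := by
    simp only [planeSq]
    refine ((((hl 0).pow 2).add ((hl 1).pow 2)).const_mul (Λ / 12)).congr_deriv ?_
    simp only [l0]
    push_cast
    ring
  have hr1 : Λ / 12 * planeSq (X + (0 : ℝ) • e) ≠ 0 := by rw [l0, ← hr]; exact hr0.ne'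
  have h2 : HasDerivAt (fun t : ℝ => (Λ / 12 * planeSq (X + t • e))⁻¹ • (X + t • e))
      ((1 / r) • e - (Λ / 6 * (X 0 * e 0 + X 1 * e 1) / r ^ 2) • X) 0 := by
    refine ((h1.inv hr1).smul (hasDerivAt_pi.2 hl)).congr_deriv ?_
    simp only [Pi.inv_apply, l0, ← hr]
    rw [one_div]
    module
  have hYX' : (Λ / 12 * planeSq (X + (0 : ℝ) • e))⁻¹ • (X + (0 : ℝ) • e) = Y := by
    ext j
    rw [l0, ← hr, hY j, Pi.smul_apply, smul_eq_mul]
    field_simp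
  have h3 : HasDerivAt (fun t : ℝ => H ((Λ / 12 * planeSq (X + t • e))⁻¹ • (X + t • e)))
      (fderiv ℝ H Y ((1 / r) • e - (Λ / 6 * (X 0 * e 0 + X 1 * e 1) / r ^ 2) • X)) 0 := by
    refine HasFDerivAt.comp_hasDerivAt (𝕜 := ℝ) 0 ?_ h2
    rw [hYX']
    exact (hH.differentiable (by simp)).differentiableAt.hasFDerivAt
  have h4 : HasDerivAt (fun t : ℝ => Hs (X + t • e))
      (Λ / 6 * (X 0 * e 0 + X 1 * e 1) * H Y + r *
        fderiv ℝ H Y ((1 / r) • e - (Λ / 6 * (X 0 * e 0 + X 1 * e 1) / r ^ 2) • X)) 0 := by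
    refine ((h1.mul h3).congr_deriv ?_).congr_of_eventuallyEq ?_
    · simp only [hYX']
      rw [l0, ← hr]
    · filter_upwards [hne] with t ht
      rw [hglue _ ht]
      simp only [Pi.mul_apply]
      congr 3
      rw [← inv_div, div_mul_eq_mul_div]
  have h5 : pd Hs i X = _ :=
    ((hHs.differentiable (by simp)).differentiableAt.hasFDerivAt.hasLineDerivAt e).unique h4
  rw [h5, map_sub, map_smul, map_smul, fderiv_apply_eq_sum_pd H Y X, Fin.sum_univ_two]
  have h6 : fderiv ℝ H Y e = pd H i Y := rfl
  have h7 : X 0 * e 0 + X 1 * e 1 = X i := by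
    fin_cases i <;> simp [he]
  rw [h6, h7, hY 0, hY 1]
  simp only [smul_eq_mul]
  field_simp
  ring

/-- `X` and `Y` are the coordinates of one point of the spherical wave surface from the two poles.
Under the exchange `G` becomes `-r G` and the surface factors differ by `r`; the sign of the pole
absorbs the minus. -/
theorem waveParam_south_eq {Λ : ℝ} {H Hs : Plane → ℝ} (hΛ : 0 < Λ) (hH : ContDiff ℝ ∞ H)
    (hHs : ContDiff ℝ ∞ Hs)
    (hglue : ∀ X : Plane, X ≠ 0 →
      Hs X = Λ / 12 * planeSq X * H ((12 / (Λ * planeSq X)) • X))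
    {X Y : Plane} {r : ℝ} (hr : r = Λ / 12 * planeSq X) (hr0 : 0 < r) (hY : ∀ i, Y i = X i / r) :
    waveParam Λ .south Hs X = waveParam Λ .north H Y := by
  have hpd := pd_profile_south hΛ hH hHs hglue hr hr0 hY
  have hX0 : X ≠ 0 := by
    rintro rfl
    simp [planeSq] at hr
    linarith
  have hq0 : planeSq X ≠ 0 := by
    intro h
    rw [h] at hr
    linarith
  have hYX : (12 / (Λ * planeSq X)) • X = Y := by
    ext j
    rw [hY j, hr, Pi.smul_apply, smul_eq_mul]
    field_simp
  have hsX : surfaceFactor Λ X = 1 + r := by rw [surfaceFactor, hr]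
  have hsY : surfaceFactor Λ Y = (1 + r) / r := by
    have : planeSq Y = planeSq X / r ^ 2 := by
      simp only [planeSq, hY]; ring
    rw [surfaceFactor, this]
    field_simp
    linear_combination -12 * hr
  have hHsX : Hs X = r * H Y := by rw [hglue X hX0, hYX, ← hr]
  have hr2 : Λ * (X 0 ^ 2 + X 1 ^ 2) = 12 * r := by rw [hr, planeSq]; ring
  have hG : profileG Hs X = -r * profileG H Y := by
    simp only [profileG, Fin.sum_univ_two, hpd, hHsX]
    have h0 : X 0 = r * Y 0 := by rw [hY 0]; field_simp
    have h1 : X 1 = r * Y 1 := by rw [hY 1]; field_simp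
    rw [h0, h1] at hr2 ⊢
    linear_combination (-(1 / 6) * (H Y - (Y 0 * pd H 0 Y + Y 1 * pd H 1 Y))) * hr2
  have h1r : (1 + r) ≠ 0 := by positivity
  refine Prod.ext ?_ ?_
  · ext i
    simp only [waveParam, hG, hsX, hsY]
    rw [hpd i]
    have : profileG H Y = H Y - (Y 0 * pd H 0 Y + Y 1 * pd H 1 Y) := by
      simp only [profileG, Fin.sum_univ_two]
    rw [← this, hY i]
    field_simp
    ring
  · simp only [waveParam, hG, hsX, hsY, Pole.sign]
    field_simp

end ImpulsiveWave

namespace ImpulsiveWave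

/-! ### States and the broken flow -/

/-- The parameter of the null rotation at a point of the wave surface. -/
def jumpParam (Λ : ℝ) (H Hs : Plane → ℝ) (p : Ambient) : Plane × ℝ :=
  if -1 < p.2 then waveParam Λ .north H (planePart (chartPos .north p))
  else waveParam Λ .south Hs (planePart (chartPos .south p))

/-- Any pole whose chart contains the point may be used. Both do only for `-1 < z < 1`, which on the
wave surface forces `Λ > 0`, where the two profiles are related. -/
theorem jumpParam_eq {Λ : ℝ} {H Hs : Plane → ℝ}
    (hH : ContDiffOn ℝ ∞ H {X | 0 < surfaceFactor Λ X})
    (hHs : ContDiffOn ℝ ∞ Hs {X | 0 < surfaceFactor Λ X})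
    (hglue : 0 < Λ → ∀ X : Plane, X ≠ 0 →
      Hs X = Λ / 12 * planeSq X * H ((12 / (Λ * planeSq X)) • X))
    {s : Pole} {p : Ambient} (hp : ambientForm Λ p p = 1) (hp0 : p.1 0 = 0)
    (hs : -1 < s.sign * p.2) :
    jumpParam Λ H Hs p =
      waveParam Λ s (Chart.profile H Hs (.wave s)) (planePart (chartPos s p)) := by
  cases s with
  | north =>
    have : -1 < p.2 := by simpa [Pole.sign] using hs
    simp only [jumpParam, if_pos this, Chart.profile]
  | south =>
    have h1 : p.2 < 1 := by simp only [Pole.sign] at hs; linarith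
    by_cases h2 : -1 < p.2
    · simp only [jumpParam, if_pos h2, Chart.profile]
      simp only [ambientForm, mink, hp0] at hp
      have hΛ : 0 < Λ := by
        by_contra h
        push Not at h
        nlinarith [sq_nonneg (p.1 2), sq_nonneg (p.1 3)]
      have huniv : {X | 0 < surfaceFactor Λ X} = univ := by
        refine eq_univ_of_forall fun X => ?_
        simp only [mem_ofPred_eq, surfaceFactor, planeSq]
        positivity
      rw [huniv, contDiffOn_univ] at hH hHs
      have h3 : 0 < 1 + p.2 := by linarith
      have h4 : 0 < 1 - p.2 := by linarith
      -- On the wave surface `(Λ/3)|Z|² = 1 - z²`, so `(Λ/12)|X|²` in the southern chart is `(1 -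
      -- z²)/(1 - z)² = (1 + z)/(1 - z)`.
      refine (waveParam_south_eq hΛ hH hHs (hglue hΛ) (r := (1 + p.2) / (1 - p.2)) ?_
        (by positivity) ?_).symm
      · simp [planeSq, planePart, chartPos, Pole.sign, ← sub_eq_add_neg]
        field_simp
        linear_combination -12 * hp
      · intro i
        fin_cases i <;>
        · simp [planePart, chartPos, Pole.sign, ← sub_eq_add_neg]
          field_simp
    · simp only [jumpParam, if_neg h2, Chart.profile]

/-- At `Ũ = 0` a null rotation alters only `Ṽ`, which the parameter does not see. Hence the jump can
be undone by the opposite rotation evaluated at the image point. -/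
theorem jumpParam_nullRotation {Λ : ℝ} {H Hs : Plane → ℝ} {p : Ambient} (hp0 : p.1 0 = 0)
    (a : Plane × ℝ) : jumpParam Λ H Hs (nullRotation Λ a p) = jumpParam Λ H Hs p := by
  have h2 : (nullRotation Λ a p).2 = p.2 := by simp [nullRotation, hp0]
  have hP : ∀ s, planePart (chartPos s (nullRotation Λ a p)) = planePart (chartPos s p) := by
    intro s
    ext i
    fin_cases i
    · simp only [planePart, chartPos, h2]; simp [nullRotation, hp0]
    · simp only [planePart, chartPos, h2]; simp [nullRotation, hp0]
  simp only [jumpParam, h2, hP]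

/-- Passing from the half in front of the wave to the half behind it; the identity off the wave
surface. -/
def jump (Λ : ℝ) (H Hs : Plane → ℝ) (b : Ambient × Ambient) : Ambient × Ambient :=
  if b.1.1 0 = 0 then
    (nullRotation Λ (jumpParam Λ H Hs b.1) b.1, nullRotation Λ (jumpParam Λ H Hs b.1) b.2)
  else b

/-- The inverse of `jump`. -/
def jumpInv (Λ : ℝ) (H Hs : Plane → ℝ) (b : Ambient × Ambient) : Ambient × Ambient :=
  if b.1.1 0 = 0 then
    (nullRotation Λ (-jumpParam Λ H Hs b.1) b.1, nullRotation Λ (-jumpParam Λ H Hs b.1) b.2)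
  else b

/-- `b` consists of a point of the background and a tangent vector there, with `curv` equal
to `k`. -/
structure IsState (Λ k : ℝ) (b : Ambient × Ambient) : Prop where
  pos : ambientForm Λ b.1 b.1 = 1
  tangent : ambientForm Λ b.1 b.2 = 0
  speed : ambientForm Λ b.2 b.2 = k
  flat : Λ = 0 → b.1.2 = 1

section

variable {Λ k : ℝ} {H Hs : Plane → ℝ} {b : Ambient × Ambient}

theorem jump_of_ne (h : b.1.1 0 ≠ 0) : jump Λ H Hs b = b := if_neg h

theorem jump_fst_zero : (jump Λ H Hs b).1.1 0 = b.1.1 0 := by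
  unfold jump; split_ifs <;> rfl

theorem jump_snd_zero : (jump Λ H Hs b).2.1 0 = b.2.1 0 := by
  unfold jump; split_ifs <;> rfl

theorem jumpInv_fst_zero : (jumpInv Λ H Hs b).1.1 0 = b.1.1 0 := by
  unfold jumpInv; split_ifs <;> rfl

theorem jumpInv_snd_zero : (jumpInv Λ H Hs b).2.1 0 = b.2.1 0 := by
  unfold jumpInv; split_ifs <;> rfl

theorem jumpInv_jump : jumpInv Λ H Hs (jump Λ H Hs b) = b := by
  by_cases h : b.1.1 0 = 0
  · have h' : (jump Λ H Hs b).1.1 0 = 0 := by rw [jump_fst_zero, h]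
    rw [jumpInv, if_pos h', jump, if_pos h]
    simp only [jumpParam_nullRotation h, nullRotation_neg]
  · rw [jump_of_ne h, jumpInv, if_neg h]

theorem jump_jumpInv : jump Λ H Hs (jumpInv Λ H Hs b) = b := by
  by_cases h : b.1.1 0 = 0
  · have h' : (jumpInv Λ H Hs b).1.1 0 = 0 := by rw [jumpInv_fst_zero, h]
    rw [jump, if_pos h', jumpInv, if_pos h]
    have e : ∀ v, nullRotation Λ (jumpParam Λ H Hs b.1) (nullRotation Λ (-jumpParam Λ H Hs b.1) v)
        = v := fun v => by
      have := nullRotation_neg Λ (-jumpParam Λ H Hs b.1) v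
      rwa [neg_neg] at this
    simp only [jumpParam_nullRotation h, e]
  · rw [jumpInv, if_neg h, jump_of_ne h]

theorem jump_injective : Function.Injective (jump Λ H Hs) :=
  Function.LeftInverse.injective fun _ => jumpInv_jump

theorem IsState.nullRotation (hb : IsState Λ k b) (a : Plane × ℝ) :
    IsState Λ k (nullRotation Λ a b.1, nullRotation Λ a b.2) where
  pos := by rw [ambientForm_nullRotation, hb.pos]
  tangent := by rw [ambientForm_nullRotation, hb.tangent]
  speed := by rw [ambientForm_nullRotation, hb.speed]
  flat := fun h => by
    have := hb.flat h
    simp [ImpulsiveWave.nullRotation, h, this]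

theorem IsState.jump (hb : IsState Λ k b) : IsState Λ k (jump Λ H Hs b) := by
  unfold ImpulsiveWave.jump
  split_ifs
  · exact hb.nullRotation _
  · exact hb

theorem IsState.jumpInv (hb : IsState Λ k b) : IsState Λ k (jumpInv Λ H Hs b) := by
  unfold ImpulsiveWave.jumpInv
  split_ifs
  · exact hb.nullRotation _
  · exact hb

theorem ambientForm_combination (Λ a b c d : ℝ) (p v : Ambient) :
    ambientForm Λ (a • p + b • v) (c • p + d • v) =
      a * c * ambientForm Λ p p + (a * d + b * c) * ambientForm Λ p v + b * d * ambientForm Λ v v := by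
  simp only [ambientForm, mink, Prod.fst_add, Prod.snd_add, Prod.smul_fst, Prod.smul_snd,
    Pi.add_apply, Pi.smul_apply, smul_eq_mul]
  ring

/-- Position and velocity have Gram matrix `diag(1, k)`, which the flow preserves because `gcos² + k
gsin² = 1`. -/
theorem IsState.flow (hb : IsState Λ k b) (t : ℝ) : IsState Λ k (flow k t b) := by
  have h := gcos_sq_add k t
  refine ⟨?_, ?_, ?_, fun h0 => ?_⟩
  · simp only [_root_.flow, ambientForm_combination, hb.pos, hb.tangent, hb.speed]
    linear_combination h
  · simp only [_root_.flow, ambientForm_combination, hb.pos, hb.tangent, hb.speed]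
    ring
  · simp only [_root_.flow, ambientForm_combination, hb.pos, hb.tangent, hb.speed]
    linear_combination k * h
  -- For `Λ = 0` tangency removes the `z` component of the velocity, so `k = 0` and `z` stays `1`.
  · have h1 := hb.flat h0
    have h2 : b.2.2 = 0 := by
      have := hb.tangent
      simpa [ambientForm, h0, h1] using this
    have h3 : k = 0 := by rw [← hb.speed]; simp [ambientForm, h0, h2]
    simp [_root_.flow, h1, h2, h3, gcos]

/-- The motion near a point of the spacetime: the half in front of the wave is reached by the flow
of the state `b`, the half behind it by the flow of `jump b`. -/
def brokenFlow (Λ : ℝ) (H Hs : Plane → ℝ) (k t : ℝ) (b : Ambient × Ambient) : Ambient × Ambient :=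
  if (flow k t b).1.1 0 ≤ 0 then flow k t b else flow k t (jump Λ H Hs b)

theorem brokenFlow_of_ne (h : b.1.1 0 ≠ 0) (t : ℝ) :
    brokenFlow Λ H Hs k t b = flow k t b := by
  simp [brokenFlow, jump_of_ne h]

theorem flow_apply_zero (k t : ℝ) (b : Ambient × Ambient) :
    (flow k t b).1.1 0 = gcos k t * b.1.1 0 + gsin k t * b.2.1 0 := rfl

theorem flow_snd_apply_zero (k t : ℝ) (b : Ambient × Ambient) :
    (flow k t b).2.1 0 = -k * gsin k t * b.1.1 0 + gcos k t * b.2.1 0 := rfl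

theorem hasDerivAt_flow_apply_zero (k t : ℝ) (b : Ambient × Ambient) :
    HasDerivAt (fun t => (flow k t b).1.1 0) ((flow k t b).2.1 0) t :=
  ((hasDerivAt_gcos k t).mul_const _).add ((hasDerivAt_gsin k t).mul_const _)

/-- `Ũ` and its velocity evolve by an invertible linear system of their own. Every zero of `Ũ` is
therefore simple, which makes crossings transversal. -/
theorem flow_ne_zero {t : ℝ} (h : b.1.1 0 ≠ 0 ∨ b.2.1 0 ≠ 0) :
    (flow k t b).1.1 0 ≠ 0 ∨ (flow k t b).2.1 0 ≠ 0 := by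
  by_contra hcon
  push Not at hcon
  have h1 := flow_neg_flow k t b
  have h2 : b.1.1 0 = 0 := by
    rw [← h1, flow_apply_zero, hcon.1, hcon.2]; ring
  have h3 : b.2.1 0 = 0 := by
    rw [← h1, flow_snd_apply_zero, hcon.1, hcon.2]; ring
  exact h.elim (fun h => h h2) fun h => h h3

end

/-- A function with nonzero derivative at a zero changes its sign there. -/
theorem eventually_pos_mul_of_hasDerivWithinAt {f : ℝ → ℝ} {α t₀ : ℝ} {J : Set ℝ}
    (hf : HasDerivWithinAt f α J t₀) (h0 : f t₀ = 0) (hα : α ≠ 0) :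
    ∀ᶠ t in 𝓝[J] t₀, t ≠ t₀ → 0 < f t * ((t - t₀) * α) := by
  have h1 := hasDerivWithinAt_iff_tendsto_slope.1 hf
  have h2 : ∀ᶠ t in 𝓝[J \ {t₀}] t₀, 0 < slope f t₀ t * α :=
    (h1.mul_const α).eventually_const_lt (mul_self_pos.2 hα)
  rw [eventually_nhdsWithin_iff] at h2 ⊢
  filter_upwards [h2] with t ht htJ hne
  have h3 := ht ⟨htJ, hne⟩
  have h4 : t - t₀ ≠ 0 := sub_ne_zero.2 hne
  rw [slope_def_field, h0, sub_zero] at h3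
  have : f t * ((t - t₀) * α) = f t / (t - t₀) * α * (t - t₀) ^ 2 := by field_simp
  rw [this]
  positivity

end ImpulsiveWave

/-! ### Glued solutions -/

section Glue

variable {E : Type*} [NormedAddCommGroup E] [NormedSpace ℝ E]

/-- Picard–Lindelöf on an interval where the speed stays below `‖F w₀‖ + 1`; the Lipschitz bound
will supply absolute continuity after gluing. -/
theorem exists_solution_lipschitz [CompleteSpace E] {F : E → E} {w₀ : E}
    (hF : ContDiffAt ℝ 1 F w₀) (t₀ : ℝ) :
    ∃ W : ℝ → E, W t₀ = w₀ ∧ ∃ K : ℝ≥0, ∃ ε > 0, LipschitzOnWith K W (Ioo (t₀ - ε) (t₀ + ε)) ∧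
      ∀ t ∈ Ioo (t₀ - ε) (t₀ + ε), HasDerivAt W (F (W t)) t := by
  obtain ⟨W, hW0, ε, hε, hW⟩ :=
    hF.exists_forall_mem_closedBall_exists_eq_forall_mem_Ioo_hasDerivAt₀ t₀
  have hWc : ContinuousAt W t₀ := (hW t₀ ⟨by linarith, by linarith⟩).continuousAt
  have hc : ContinuousAt (fun t => F (W t)) t₀ :=
    ContinuousAt.comp (g := F) (by rw [hW0]; exact hF.continuousAt) hWc
  have hb : ∀ᶠ t in 𝓝 t₀, ‖F (W t)‖₊ < ‖F w₀‖₊ + 1 := by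
    refine hc.nnnorm.eventually_lt_const ?_
    simp only [hW0]
    exact lt_add_one _
  obtain ⟨δ, hδ, h⟩ := Metric.eventually_nhds_iff.1 hb
  have hd : ∀ t ∈ Ioo (t₀ - min ε δ) (t₀ + min ε δ), dist t t₀ < δ := fun t ht => by
    rw [Real.dist_eq, abs_lt]
    constructor <;> linarith [ht.1, ht.2, min_le_right ε δ]
  have hsub : ∀ t ∈ Ioo (t₀ - min ε δ) (t₀ + min ε δ), t ∈ Ioo (t₀ - ε) (t₀ + ε) := fun t ht =>
    ⟨by linarith [ht.1, min_le_left ε δ], by linarith [ht.2, min_le_left ε δ]⟩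
  refine ⟨W, hW0, ‖F w₀‖₊ + 1, min ε δ, lt_min hε hδ, ?_, fun t ht => hW t (hsub t ht)⟩
  exact (convex_Ioo _ _).lipschitzOnWith_of_nnnorm_hasDerivWithin_le
    (fun t ht => (hW t (hsub t ht)).hasDerivWithinAt) fun t ht => (h (hd t ht)).le

/-- For times on different sides of `t₀` the distances to `t₀` add up, so the triangle inequality
through `t₀` does not worsen the constant. -/
theorem LipschitzOnWith.glue {E : Type*} [PseudoMetricSpace E] {W₁ W₂ : ℝ → E} {K : ℝ≥0}
    {J : Set ℝ} {t₀ α : ℝ} (ht₀ : t₀ ∈ J)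
    (h₁ : LipschitzOnWith K W₁ J) (h₂ : LipschitzOnWith K W₂ J) (h₀ : W₁ t₀ = W₂ t₀) :
    LipschitzOnWith K (fun t => if (t - t₀) * α ≤ 0 then W₁ t else W₂ t) J := by
  have key : ∀ s ∈ J, ∀ t ∈ J, (s - t₀) * α ≤ 0 → ¬ (t - t₀) * α ≤ 0 →
      dist (W₁ s) (W₂ t) ≤ K * dist s t := by
    intro s hs t ht h1 h2
    push Not at h2
    have h3 := h₁.dist_le_mul s hs t₀ ht₀
    have h4 := h₂.dist_le_mul t₀ ht₀ t ht
    have h5 : dist s t = dist s t₀ + dist t₀ t := by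
      simp only [Real.dist_eq]
      rcases lt_trichotomy α 0 with hα | hα | hα
      · have a1 : t < t₀ := by nlinarith
        have a2 : t₀ ≤ s := by nlinarith
        rw [abs_of_nonneg (by linarith), abs_of_nonneg (by linarith), abs_of_nonneg (by linarith)]
        ring
      · rw [hα, mul_zero] at h2; exact absurd h2 (lt_irrefl _)
      · have a1 : t₀ < t := by nlinarith
        have a2 : s ≤ t₀ := by nlinarith
        rw [abs_of_nonpos (by linarith), abs_of_nonpos (by linarith), abs_of_nonpos (by linarith)]
        ring
    calc dist (W₁ s) (W₂ t) ≤ dist (W₁ s) (W₁ t₀) + dist (W₂ t₀) (W₂ t) := by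
          rw [← h₀]; exact dist_triangle _ _ _ |>.trans (by rw [h₀])
      _ ≤ K * dist s t := by rw [h5, mul_add]; exact add_le_add h3 h4
  refine LipschitzOnWith.of_dist_le_mul fun s hs t ht => ?_
  by_cases h1 : (s - t₀) * α ≤ 0 <;> by_cases h2 : (t - t₀) * α ≤ 0 <;> simp only [h1, h2, if_true,
    if_false]
  · exact h₁.dist_le_mul s hs t ht
  · exact key s hs t ht h1 h2
  · rw [dist_comm, dist_comm s]
    exact key t ht s hs h2 h1
  · exact h₂.dist_le_mul s hs t ht

/-- One parameter value is a null set, so the field on the wave surface itself never matters for a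
curve that is there only at `t₀`. -/
theorem isFilippovSolutionOn_of_hasDerivAt [MeasureSpace E]
    [(volume : Measure E).IsOpenPosMeasure]
    {D : Set E} {f : E → E} {W : ℝ → E} {K : ℝ≥0} {t₀ ε : ℝ}
    (hK : LipschitzOnWith K W (Ioo (t₀ - ε) (t₀ + ε)))
    (hD : ∀ t ∈ Ioo (t₀ - ε) (t₀ + ε), D ∈ 𝓝 (W t))
    (h : ∀ t ∈ Ioo (t₀ - ε) (t₀ + ε), t ≠ t₀ → HasDerivAt W (f (W t)) t ∧ ContinuousAt f (W t)) :
    IsFilippovSolutionOn D f (Ioo (t₀ - ε) (t₀ + ε)) W where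
  mem t ht := mem_of_mem_nhds (hD t ht)
  absCont a ha b hb :=
    (hK.mono (ordConnected_Ioo.uIcc_subset ha hb)).absolutelyContinuousOnInterval
  inclusion := by
    have : ∀ᵐ t : ℝ, t ≠ t₀ := by simp [ae_iff]
    filter_upwards [this] with t ht htJ
    obtain ⟨h1, h2⟩ := h t htJ ht
    exact ⟨f (W t), mem_filippovMap_of_continuousAt h2 (hD t htJ), h1⟩

end Glue

namespace ImpulsiveWave

/-! ### Geodesics through a given state -/

theorem exists_sign_mul {z : ℝ} : ∃ s : Pole, -1 < s.sign * z := by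
  by_cases h : -1 < z
  · exact ⟨.north, by simpa [Pole.sign] using h⟩
  · exact ⟨.south, by simp only [Pole.sign]; linarith⟩

theorem continuous_conformal (Λ : ℝ) : Continuous (conformal Λ) := by
  unfold conformal mink
  fun_prop

theorem continuous_surfaceFactor (Λ : ℝ) : Continuous (surfaceFactor Λ) := by
  unfold surfaceFactor planeSq
  fun_prop

theorem _root_.ContDiffOn.contDiffAt_profile {Λ : ℝ} {H : Plane → ℝ}
    (hH : ContDiffOn ℝ ∞ H {X | 0 < surfaceFactor Λ X}) {X : Plane} (hX : 0 < surfaceFactor Λ X) :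
    ContDiffAt ℝ ∞ H X :=
  hH.contDiffAt ((isOpen_lt continuous_const (continuous_surfaceFactor Λ)).mem_nhds hX)

theorem continuousAt_omega {Λ : ℝ} {F : Plane → ℝ} {x : Coord}
    (hF : ContDiffAt ℝ ∞ F (planePart x)) : ContinuousAt (omega Λ F) x := by
  have hP : ContinuousAt planePart x := (contDiff_planePart (n := 0)).continuous.continuousAt
  have c0 : ContinuousAt (fun x => F (planePart x)) x := hF.continuousAt.comp hP
  have c1 : ∀ i, ContinuousAt (fun x => pd F i (planePart x)) x := fun i =>
    ContinuousAt.comp (g := pd F i) (contDiffAt_pd hF i).continuousAt hP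
  have cx : ∀ i : Fin 4, ContinuousAt (fun x : Coord => x i) x := fun i =>
    (continuous_apply i).continuousAt
  have ck : ContinuousAt (fun x : Coord => kink (x 0)) x := (cx 0).max continuousAt_const
  have cp : ∀ i, ContinuousAt (fun x => planePart x i) x := fun i =>
    (continuous_apply i).continuousAt.comp hP
  unfold omega
  simp only [profileG, planeSq]
  fun_prop

/-- The defining inequalities involve `U₊` only through continuous functions, so the kink does not
spoil openness. -/
theorem domain_wave_mem_nhds {Λ : ℝ} {H Hs : Plane → ℝ} {s : Pole} {x : Coord}
    (hH : ContDiffAt ℝ ∞ (Chart.profile H Hs (.wave s)) (planePart x))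
    (hx : x ∈ Chart.domain Λ H Hs (.wave s)) : Chart.domain Λ H Hs (.wave s) ∈ 𝓝 x := by
  set F := Chart.profile H Hs (.wave s)
  have hP : ContinuousAt planePart x := (contDiff_planePart (n := 0)).continuous.continuousAt
  have c2 : ∀ i j, ContinuousAt (fun x => pd (pd F i) j (planePart x)) x := fun i j =>
    ContinuousAt.comp (g := pd (pd F i) j) (contDiffAt_pd (contDiffAt_pd hH i) j).continuousAt hP
  have cx : ∀ i : Fin 4, ContinuousAt (fun x : Coord => x i) x := fun i =>
    (continuous_apply i).continuousAt
  have ck : ContinuousAt (fun x : Coord => kink (x 0)) x := (cx 0).max continuousAt_const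
  have e1 : ContinuousAt (fun x => surfaceFactor Λ (planePart x)) x :=
    (continuous_surfaceFactor Λ).continuousAt.comp hP
  have e2 : ContinuousAt (fun x => omega Λ F x) x := continuousAt_omega hH
  have e3 : ContinuousAt (fun x => (spatialMetric F x).det) x := by
    simp only [Matrix.det_fin_two, spatialMetric, Fin.sum_univ_two]
    fun_prop
  filter_upwards [e1.eventually_const_lt hx.1, e2.eventually_const_lt hx.2.1,
    e3.eventually_ne hx.2.2] with y h1 h2 h3
  exact ⟨h1, h2, h3⟩

theorem domain_half_mem_nhds {Λ : ℝ} {H Hs : Plane → ℝ} {s : Pole} {x : Coord}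
    (hx : x ∈ Chart.domain Λ H Hs (.half s)) : Chart.domain Λ H Hs (.half s) ∈ 𝓝 x := by
  have e1 : ContinuousAt (fun x : Coord => x 0) x := (continuous_apply 0).continuousAt
  have h2 : 0 < conformal Λ x := by
    rw [← omega_eq_conformal (Or.inr rfl)]; exact hx.2
  filter_upwards [e1.eventually_ne hx.1,
    (continuous_conformal Λ).continuousAt.eventually_const_lt h2] with y h1 h2
  exact ⟨h1, by rwa [omega_eq_conformal (Or.inr rfl)]⟩

/-- In front of the wave and in the conformally flat charts. -/
theorem geodesicField_eventuallyEq_flat {Λ : ℝ} {H : Plane → ℝ} {W : Coord × Coord}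
    (h : W.1 0 < 0 ∨ H = 0) (hΩ : conformal Λ W.1 ≠ 0) :
    geodesicField Λ H =ᶠ[𝓝 W] pullField Λ id := by
  have hn : ∀ᶠ y in 𝓝 W.1, y 0 ≤ 0 ∨ H = 0 := by
    rcases h with h | h
    · filter_upwards [(continuous_apply 0).continuousAt.eventually_lt_const h] with y hy
      exact Or.inl hy.le
    · exact Eventually.of_forall fun _ => Or.inr h
  have hn2 : ∀ᶠ y in 𝓝 W.1, (∀ᶠ z in 𝓝 y, z 0 ≤ 0 ∨ H = 0) ∧ conformal Λ y ≠ 0 :=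
    hn.eventually_nhds.and ((continuous_conformal Λ).continuousAt.eventually_ne hΩ)
  filter_upwards [continuousAt_fst.eventually hn2] with V hV
  refine geodesicField_eq_pullField contDiffAt_id ?_ hV.2
    (hV.1.mono fun z hz i j => metric_eq_flat hz i j) V.2
  rw [fderiv_id]
  exact ⟨.refl ℝ Coord, rfl⟩

/-- Behind the wave. -/
theorem geodesicField_eventuallyEq_wave {Λ : ℝ} {H : Plane → ℝ} {W : Coord × Coord}
    (h : 0 < W.1 0) (hHP : ContDiffOn ℝ ∞ H {X | 0 < surfaceFactor Λ X})
    (hX : 0 < surfaceFactor Λ (planePart W.1)) (hω : omega Λ H W.1 ≠ 0)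
    (hdet : hessDet H W.1 ≠ 0) :
    geodesicField Λ H =ᶠ[𝓝 W] pullField Λ (waveMap H) := by
  have hP : ContinuousAt planePart W.1 := (contDiff_planePart (n := 0)).continuous.continuousAt
  have hHe : ∀ᶠ y in 𝓝 W.1, ContDiffAt ℝ ∞ H (planePart y) := by
    filter_upwards [hP.eventually ((continuous_surfaceFactor Λ).continuousAt.eventually_const_lt hX)]
      with y hy
    exact hHP.contDiffAt_profile hy
  have hH := hHe.self_of_nhds
  have hpos : ∀ᶠ y in 𝓝 W.1, 0 < y 0 := (continuous_apply 0).continuousAt.eventually_const_lt h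
  have hn : ∀ᶠ y in 𝓝 W.1, ∀ i j, metric Λ H y i j =
      pullForm Λ (waveMap H) y (Pi.single i 1) (Pi.single j 1) := by
    filter_upwards [hHe, hpos] with y h1 h2 i j
    exact metric_eq_wave h1 h2.le i j
  have c2 : ∀ i j, ContinuousAt (fun x => pd (pd H i) j (planePart x)) W.1 := fun i j =>
    ContinuousAt.comp (g := pd (pd H i) j) (contDiffAt_pd (contDiffAt_pd hH i) j).continuousAt hP
  have hd : ContinuousAt (fun x => hessDet H x) W.1 := by
    have c0 : ContinuousAt (fun x : Coord => x 0) W.1 := (continuous_apply 0).continuousAt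
    exact ((continuousAt_const.add (c0.mul (c2 0 0))).mul
      (continuousAt_const.add (c0.mul (c2 1 1)))).sub ((c0.mul (c2 0 1)).mul (c0.mul (c2 1 0)))
  have hc : ContinuousAt (fun x => conformal Λ (waveMap H x)) W.1 :=
    (continuous_conformal Λ).continuousAt.comp (contDiffAt_waveMap hH).continuousAt
  have hc0 : conformal Λ (waveMap H W.1) ≠ 0 := by rwa [conformal_waveMap Λ h.le]
  filter_upwards [continuousAt_fst.eventually hn.eventually_nhds,
    continuousAt_fst.eventually (hd.eventually_ne hdet),
    continuousAt_fst.eventually (hc.eventually_ne hc0),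
    continuousAt_fst.eventually hHe] with V h1 h2 h3 h4
  exact geodesicField_eq_pullField (by exact_mod_cast contDiffAt_infty.1 (contDiffAt_waveMap h4) 2)
    (isInvertible_fderiv_waveMap h4 h2) h3 h1 V.2

end ImpulsiveWave

/-! ### Local existence through a state transversal to the wave surface. -/

namespace ImpulsiveWave

theorem exists_Ioo_of_eventually {P : ℝ → Prop} {t₀ : ℝ} (h : ∀ᶠ t in 𝓝 t₀, P t) :
    ∃ δ > 0, ∀ t ∈ Ioo (t₀ - δ) (t₀ + δ), P t := by
  obtain ⟨δ, hδ, h⟩ := Metric.eventually_nhds_iff.1 h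
  exact ⟨δ, hδ, fun t ht => h (by rw [Real.dist_eq, abs_lt]; constructor <;> linarith [ht.1, ht.2])⟩

theorem isInvertible_fderiv_id (x : Coord) : (fderiv ℝ (id : Coord → Coord) x).IsInvertible := by
  rw [fderiv_id]
  exact ⟨.refl ℝ Coord, rfl⟩

/-- Near the parameter value `t₀` the curve `W` is a Filippov solution of the geodesic equation in
the chart `κ`, it is continuously differentiable, and its positions are the points `c t`. -/
structure IsLocalGeodesic (Λ : ℝ) (H Hs : Plane → ℝ) (κ : Chart) (t₀ ε : ℝ)
    (W : ℝ → Coord × Coord) (c : ℝ → Ambient) : Prop where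
  solution : IsFilippovSolutionOn {w | w.1 ∈ κ.domain Λ H Hs}
    (geodesicField Λ (κ.profile H Hs)) (Ioo (t₀ - ε) (t₀ + ε)) W
  continuousOn : ContinuousOn W (Ioo (t₀ - ε) (t₀ + ε))
  hasDerivAt : ∀ t ∈ Ioo (t₀ - ε) (t₀ + ε), HasDerivAt (fun t => (W t).1) (W t).2 t
  eq : ∀ t ∈ Ioo (t₀ - ε) (t₀ + ε), c t = κ.toAmbient Λ H Hs (W t).1

theorem toAmbient_half (Λ : ℝ) (H Hs : Plane → ℝ) (s : Pole) (x : Coord) :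
    (Chart.half s).toAmbient Λ H Hs x = embed Λ s x := by
  simp [Chart.toAmbient, Chart.profile, Chart.pole, toConformallyFlat_zero]

section

variable {Λ k : ℝ} {H Hs : Plane → ℝ} {b : Ambient × Ambient}

theorem exists_isLocalGeodesic_of_ne (hb : IsState Λ k b) (h0 : b.1.1 0 ≠ 0) (t₀ : ℝ) :
    ∃ κ : Chart, ∃ ε > 0, ∃ W : ℝ → Coord × Coord, IsLocalGeodesic Λ H Hs κ t₀ ε W
      fun t => (brokenFlow Λ H Hs k (t - t₀) b).1 := by
  obtain ⟨s, hs⟩ := exists_sign_mul (z := b.1.2)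
  set x₀ := chartPos s b.1 with hx₀
  set w₀ := chartVel s b.1 b.2 with hw₀
  have hΩ : 0 < conformal Λ x₀ := conformal_chartPos_pos hb.pos hs
  have hx00 : x₀ 0 ≠ 0 := by
    simp only [hx₀, chartPos, Pi.smul_apply, smul_eq_mul]
    exact mul_ne_zero (div_ne_zero two_ne_zero (by linarith)) h0
  have hdom : x₀ ∈ Chart.domain Λ H Hs (.half s) :=
    ⟨hx00, by rwa [omega_eq_conformal (Or.inr rfl)]⟩
  obtain ⟨W, hW0, K, ε, hε, hK, hW⟩ := exists_solution_lipschitz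
    (contDiffAt_pullField (Λ := Λ) (T := id) (W := (x₀, w₀)) contDiffAt_id
      (isInvertible_fderiv_id _) hΩ.ne') t₀
  have hc : ContinuousAt (fun t => (W t).1) t₀ :=
    continuousAt_fst.comp (hW t₀ ⟨by linarith, by linarith⟩).continuousAt
  have hev : ∀ᶠ t in 𝓝 t₀, (W t).1 ∈ Chart.domain Λ H Hs (.half s) := by
    refine hc.eventually_mem ?_
    simp only [hW0]
    exact domain_half_mem_nhds hdom
  obtain ⟨δ, hδ, hd⟩ := exists_Ioo_of_eventually (hev.and
    (Ioo_mem_nhds (by linarith : t₀ - ε < t₀) (by linarith : t₀ < t₀ + ε)))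
  have hΩt : ∀ t ∈ Ioo (t₀ - δ) (t₀ + δ), 0 < conformal Λ (W t).1 := fun t ht => by
    rw [← omega_eq_conformal (Or.inr rfl)]; exact (hd t ht).1.2
  have hf : ∀ t ∈ Ioo (t₀ - δ) (t₀ + δ), geodesicField Λ (Chart.profile H Hs (.half s)) =ᶠ[𝓝 (W t)]
      pullField Λ id := fun t ht => geodesicField_eventuallyEq_flat (Or.inr rfl) (hΩt t ht).ne'
  have hW' : ∀ t ∈ Ioo (t₀ - δ) (t₀ + δ), HasDerivAt W (pullField Λ id (W t)) t :=
    fun t ht => hW t (hd t ht).2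
  refine ⟨.half s, δ, hδ, W, ?_, ?_, ?_, ?_⟩
  · refine isFilippovSolutionOn_of_hasDerivAt (hK.mono fun t ht => (hd t ht).2)
      (fun t ht => continuousAt_fst.preimage_mem_nhds (domain_half_mem_nhds (hd t ht).1))
      fun t ht _ => ⟨?_, ?_⟩
    · rw [(hf t ht).eq_of_nhds]
      exact hW' t ht
    · exact (contDiffAt_pullField contDiffAt_id (isInvertible_fderiv_id _)
        (hΩt t ht).ne').continuousAt.congr (hf t ht).symm
  · exact fun t ht => (hW' t ht).continuousAt.continuousWithinAt
  · exact fun t ht => (hasFDerivAt_fst (𝕜 := ℝ) (p := W t)).comp_hasDerivAt t (hW' t ht)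
  · intro t ht
    simp only [brokenFlow_of_ne h0, toAmbient_half]
    have := embed_comp_eq_flow s (T := id) ordConnected_Ioo
      (fun t ht => (hW' t ht).hasDerivWithinAt) (fun t _ => contDiffAt_id)
      (fun t _ => isInvertible_fderiv_id _) (fun t ht => (hΩt t ht).ne')
      (t₀ := t₀) ⟨by linarith, by linarith⟩ ht
    simp only [hW0, fderiv_id, ContinuousLinearMap.id_apply, id_eq] at this
    rw [embed_chartPos hb.pos hs, dEmbed_chartVel hb.pos hs hb.tangent, curv_eq, hb.speed] at this
    exact (congrArg Prod.fst this).symm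

theorem contDiffOn_profile
    (hH : ContDiffOn ℝ ∞ H {X | 0 < surfaceFactor Λ X})
    (hHs : ContDiffOn ℝ ∞ Hs {X | 0 < surfaceFactor Λ X})
    (s : Pole) :
    ContDiffOn ℝ ∞ (Chart.profile H Hs (.wave s)) {X | 0 < surfaceFactor Λ X} := by
  cases s
  · exact hH
  · exact hHs

/-- Two smooth systems, one for each side, are solved across the surface from the same data, and at
each time the solution belonging to the current side is kept. -/
theorem exists_isLocalGeodesic_of_eq
    (hH : ContDiffOn ℝ ∞ H {X | 0 < surfaceFactor Λ X})
    (hHs : ContDiffOn ℝ ∞ Hs {X | 0 < surfaceFactor Λ X})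
    (hglue : 0 < Λ → ∀ X : Plane, X ≠ 0 →
      Hs X = Λ / 12 * planeSq X * H ((12 / (Λ * planeSq X)) • X))
    (hb : IsState Λ k b) (h0 : b.1.1 0 = 0) (h1 : b.2.1 0 ≠ 0)
    (t₀ : ℝ) :
    ∃ κ : Chart, ∃ ε > 0, ∃ W : ℝ → Coord × Coord, IsLocalGeodesic Λ H Hs κ t₀ ε W
      fun t => (brokenFlow Λ H Hs k (t - t₀) b).1 := by
  obtain ⟨s, hs⟩ := exists_sign_mul (z := b.1.2)
  set F := Chart.profile H Hs (.wave s) with hF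
  have hFP := contDiffOn_profile hH hHs s
  set x₀ := chartPos s b.1 with hx₀
  set w₀ := chartVel s b.1 b.2 with hw₀
  have hΩ : 0 < conformal Λ x₀ := conformal_chartPos_pos hb.pos hs
  have hx00 : x₀ 0 = 0 := by simp [hx₀, chartPos, h0]
  set α := w₀ 0 with hα
  have hm : 0 < 2 / (1 + s.sign * b.1.2) := div_pos two_pos (by linarith)
  have hαb : α = 2 / (1 + s.sign * b.1.2) * b.2.1 0 := by simp [hα, hw₀, chartVel, h0]
  have hα0 : α ≠ 0 := by rw [hαb]; exact mul_ne_zero hm.ne' h1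
  have hX₀ : 0 < surfaceFactor Λ (planePart x₀) := by rwa [surfaceFactor_eq_conformal hx00]
  have hFs : ContDiffAt ℝ ∞ F (planePart x₀) := hFP.contDiffAt_profile hX₀
  have hhess : hessDet F x₀ ≠ 0 := by simp [hessDet, hx00]
  have hdom : x₀ ∈ Chart.domain Λ H Hs (.wave s) := by
    refine ⟨hX₀, ?_, ?_⟩
    · rwa [omega_eq_conformal (Or.inl hx00.le)]
    · rw [← hF, det_spatialMetric hFs hx00.ge]
      exact pow_ne_zero 2 hhess
  have hΩ₂ : conformal Λ (waveMap F x₀) ≠ 0 := by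
    rw [conformal_waveMap_of_zero hx00]; exact hΩ.ne'
  obtain ⟨W₁, hW₁0, K₁, ε₁, hε₁, hK₁, hW₁⟩ := exists_solution_lipschitz
    (contDiffAt_pullField (Λ := Λ) (T := id) (W := (x₀, w₀)) contDiffAt_id
      (isInvertible_fderiv_id _) hΩ.ne') t₀
  obtain ⟨W₂, hW₂0, K₂, ε₂, hε₂, hK₂, hW₂⟩ := exists_solution_lipschitz
    (contDiffAt_pullField (Λ := Λ) (T := waveMap F) (W := (x₀, w₀)) (contDiffAt_waveMap hFs)
      (isInvertible_fderiv_waveMap hFs hhess) hΩ₂) t₀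
  have ht₁ : t₀ ∈ Ioo (t₀ - ε₁) (t₀ + ε₁) := ⟨by linarith, by linarith⟩
  have ht₂ : t₀ ∈ Ioo (t₀ - ε₂) (t₀ + ε₂) := ⟨by linarith, by linarith⟩
  -- Both solutions cross `U = 0` with the same slope `α ≠ 0`, so on both `U` has the sign of `(t -
  -- t₀) α`.
  have branch : ∀ W : ℝ → Coord × Coord, W t₀ = (x₀, w₀) → ∀ V, HasDerivAt W (w₀, V) t₀ →
      ∀ᶠ t in 𝓝 t₀, (W t).1 ∈ Chart.domain Λ H Hs (.wave s) ∧
        (t ≠ t₀ → 0 < (W t).1 0 * ((t - t₀) * α)) := by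
    intro W hW0 V hW
    refine Filter.Eventually.and ?_ ?_
    · refine (continuousAt_fst.comp hW.continuousAt : ContinuousAt (fun t => (W t).1)
        t₀).eventually_mem ?_
      simp only [Function.comp_apply, hW0]
      exact domain_wave_mem_nhds hFs hdom
    · have hd : HasDerivAt (fun t => (W t).1) w₀ t₀ :=
        (hasFDerivAt_fst (𝕜 := ℝ) (p := W t₀)).comp_hasDerivAt t₀ hW
      have hd0 : HasDerivAt (fun t => (W t).1 0) α t₀ := hasDerivAt_pi.1 hd 0
      have := eventually_pos_mul_of_hasDerivWithinAt (J := univ) hd0.hasDerivWithinAt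
        (by rw [hW0]; exact hx00) hα0
      rwa [nhdsWithin_univ] at this
  -- `α` is a positive multiple of the ambient slope, so `brokenFlow` changes branch on the same
  -- side as the glued solution.
  have hflow : ∀ᶠ t in 𝓝 t₀, t ≠ t₀ → 0 < (flow k (t - t₀) b).1.1 0 * ((t - t₀) * α) := by
    have hd : HasDerivAt (fun t => (flow k (t - t₀) b).1.1 0) (b.2.1 0) t₀ := by
      have := hasDerivAt_flow_apply_zero k (t₀ - t₀) b
      have h2 := this.comp_sub_const t₀ t₀
      rw [sub_self, flow_zero] at h2
      exact h2
    have := eventually_pos_mul_of_hasDerivWithinAt (J := univ) hd.hasDerivWithinAt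
      (by rw [sub_self, flow_zero]; exact h0) h1
    rw [nhdsWithin_univ] at this
    filter_upwards [this] with t ht hne
    have := ht hne
    rw [hαb]
    have e : (flow k (t - t₀) b).1.1 0 * ((t - t₀) * (2 / (1 + s.sign * b.1.2) * b.2.1 0)) =
      (2 / (1 + s.sign * b.1.2)) * ((flow k (t - t₀) b).1.1 0 * ((t - t₀) * b.2.1 0)) := by ring
    rw [e]
    positivity
  have hb₁ := branch W₁ hW₁0 _ ((hW₁ t₀ ht₁).congr_deriv (by rw [hW₁0]; rfl))
  have hb₂ := branch W₂ hW₂0 _ ((hW₂ t₀ ht₂).congr_deriv (by rw [hW₂0]; rfl))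
  have hhess₂ : ∀ᶠ t in 𝓝 t₀, hessDet F (W₂ t).1 ≠ 0 := by
    have hP : ContinuousAt planePart x₀ := (contDiff_planePart (n := 0)).continuous.continuousAt
    have c2 : ∀ i j, ContinuousAt (fun x => pd (pd F i) j (planePart x)) x₀ := fun i j =>
      ContinuousAt.comp (g := pd (pd F i) j) (contDiffAt_pd (contDiffAt_pd hFs i) j).continuousAt hP
    have c0 : ContinuousAt (fun x : Coord => x 0) x₀ := (continuous_apply 0).continuousAt
    have hd : ContinuousAt (hessDet F) x₀ :=
      ((continuousAt_const.add (c0.mul (c2 0 0))).mul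
      (continuousAt_const.add (c0.mul (c2 1 1)))).sub ((c0.mul (c2 0 1)).mul (c0.mul (c2 1 0)))
    have hc : Tendsto (fun t => (W₂ t).1) (𝓝 t₀) (𝓝 x₀) := by
      have : ContinuousAt (fun t => (W₂ t).1) t₀ :=
        continuousAt_fst.comp (hW₂ t₀ ht₂).continuousAt
      simpa only [ContinuousAt, hW₂0] using this
    exact hc.eventually (hd.eventually_ne hhess)
  have hconf₂ : ∀ᶠ t in 𝓝 t₀, conformal Λ (waveMap F (W₂ t).1) ≠ 0 := by
    have hd : ContinuousAt (fun x => conformal Λ (waveMap F x)) x₀ :=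
      (continuous_conformal Λ).continuousAt.comp (contDiffAt_waveMap hFs).continuousAt
    have hc : Tendsto (fun t => (W₂ t).1) (𝓝 t₀) (𝓝 x₀) := by
      have : ContinuousAt (fun t => (W₂ t).1) t₀ :=
        continuousAt_fst.comp (hW₂ t₀ ht₂).continuousAt
      simpa only [ContinuousAt, hW₂0] using this
    exact hc.eventually (hd.eventually_ne hΩ₂)
  have hconf₁ : ∀ᶠ t in 𝓝 t₀, conformal Λ (W₁ t).1 ≠ 0 := by
    have hc : Tendsto (fun t => (W₁ t).1) (𝓝 t₀) (𝓝 x₀) := by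
      have : ContinuousAt (fun t => (W₁ t).1) t₀ :=
        continuousAt_fst.comp (hW₁ t₀ ht₁).continuousAt
      simpa only [ContinuousAt, hW₁0] using this
    exact hc.eventually ((continuous_conformal Λ).continuousAt.eventually_ne hΩ.ne')
  have hε₁' : ∀ᶠ t in 𝓝 t₀, t ∈ Ioo (t₀ - ε₁) (t₀ + ε₁) := Ioo_mem_nhds ht₁.1 ht₁.2
  have hε₂' : ∀ᶠ t in 𝓝 t₀, t ∈ Ioo (t₀ - ε₂) (t₀ + ε₂) := Ioo_mem_nhds ht₂.1 ht₂.2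
  obtain ⟨δ, hδ, hd⟩ := exists_Ioo_of_eventually ((hb₁.and hb₂).and ((hflow.and
    (hhess₂.and (hconf₂.and hconf₁))).and (hε₁'.and hε₂')))
  set J := Ioo (t₀ - δ) (t₀ + δ) with hJ
  have ht₀ : t₀ ∈ J := ⟨by linarith, by linarith⟩
  have hW₁' : ∀ t ∈ J, HasDerivAt W₁ (pullField Λ id (W₁ t)) t :=
    fun t ht => hW₁ t (hd t ht).2.2.1
  have hW₂' : ∀ t ∈ J, HasDerivAt W₂ (pullField Λ (waveMap F) (W₂ t)) t :=
    fun t ht => hW₂ t (hd t ht).2.2.2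
  have hsm₁ : ∀ t ∈ J, ContDiffAt ℝ ∞ F (planePart (W₁ t).1) := fun t ht =>
    hFP.contDiffAt_profile (hd t ht).1.1.1.1
  have hsm₂ : ∀ t ∈ J, ContDiffAt ℝ ∞ F (planePart (W₂ t).1) := fun t ht =>
    hFP.contDiffAt_profile (hd t ht).1.2.1.1
  -- `(t - t₀) α ≤ 0` selects the times in front of the wave, whichever way it is crossed.
  set W : ℝ → Coord × Coord := fun t => if (t - t₀) * α ≤ 0 then W₁ t else W₂ t with hWdef
  have hWt₀ : W t₀ = W₁ t₀ := by simp [hWdef]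
  have hside : ∀ t ∈ J, t ≠ t₀ → (t - t₀) * α ≠ 0 := fun t _ hne =>
    mul_ne_zero (sub_ne_zero.2 hne) hα0
  have hneg : ∀ t, (t - t₀) * α < 0 → W =ᶠ[𝓝 t] W₁ := fun t ht => by
    have hc : ContinuousAt (fun t => (t - t₀) * α) t := by fun_prop
    filter_upwards [hc.eventually_lt_const ht] with r hr
    exact if_pos hr.le
  have hpos : ∀ t, 0 < (t - t₀) * α → W =ᶠ[𝓝 t] W₂ := fun t ht => by
    have hc : ContinuousAt (fun t => (t - t₀) * α) t := by fun_prop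
    filter_upwards [hc.eventually_const_lt ht] with r hr
    exact if_neg hr.not_ge
  have hK : LipschitzOnWith (max K₁ K₂) W J :=
    LipschitzOnWith.glue ht₀ ((hK₁.weaken (le_max_left _ _)).mono fun t ht => (hd t ht).2.2.1)
      ((hK₂.weaken (le_max_right _ _)).mono fun t ht => (hd t ht).2.2.2) (by rw [hW₁0, hW₂0])
  have hmemD : ∀ t ∈ J, Chart.domain Λ H Hs (.wave s) ∈ 𝓝 (W t).1 := by
    intro t ht
    by_cases h : (t - t₀) * α ≤ 0
    · simp only [hWdef, if_pos h]
      exact domain_wave_mem_nhds (hsm₁ t ht) (hd t ht).1.1.1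
    · simp only [hWdef, if_neg h]
      exact domain_wave_mem_nhds (hsm₂ t ht) (hd t ht).1.2.1
  have hnegU : ∀ t ∈ J, (t - t₀) * α < 0 → (W₁ t).1 0 < 0 := fun t ht h => by
    have := (hd t ht).1.1.2 (by rintro rfl; simp at h)
    nlinarith
  have hposU : ∀ t ∈ J, 0 < (t - t₀) * α → 0 < (W₂ t).1 0 := fun t ht h => by
    have := (hd t ht).1.2.2 (by rintro rfl; simp at h)
    exact pos_of_mul_pos_left this h.le
  have hd₂ : ∀ t ∈ J, 0 < (t - t₀) * α → HasDerivAt W (pullField Λ (waveMap F) (W t)) t :=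
    fun t ht h => by
      rw [(hpos t h).eq_of_nhds]
      exact (hW₂' t ht).congr_of_eventuallyEq (hpos t h)
  have hd₁ : ∀ t ∈ J, (t - t₀) * α < 0 → HasDerivAt W (pullField Λ id (W t)) t :=
    fun t ht h => by
      rw [(hneg t h).eq_of_nhds]
      exact (hW₁' t ht).congr_of_eventuallyEq (hneg t h)
  have hf₁ : ∀ t ∈ J, (t - t₀) * α < 0 → geodesicField Λ F =ᶠ[𝓝 (W t)] pullField Λ id :=
    fun t ht h => by
      rw [(hneg t h).eq_of_nhds]
      exact geodesicField_eventuallyEq_flat (Or.inl (hnegU t ht h)) (hd t ht).2.1.2.2.2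
  have hf₂ : ∀ t ∈ J, 0 < (t - t₀) * α → geodesicField Λ F =ᶠ[𝓝 (W t)] pullField Λ (waveMap F) :=
    fun t ht h => by
      rw [(hpos t h).eq_of_nhds]
      exact geodesicField_eventuallyEq_wave (hposU t ht h) hFP (hd t ht).1.2.1.1
        (hd t ht).1.2.1.2.1.ne' (hd t ht).2.1.2.1
  refine ⟨.wave s, δ, hδ, W, ?_, hK.continuousOn, ?_, ?_⟩
  · refine isFilippovSolutionOn_of_hasDerivAt hK
      (fun t ht => continuousAt_fst.preimage_mem_nhds (hmemD t ht)) fun t ht hne => ?_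
    rw [← hF]
    rcases (hside t ht hne).lt_or_gt with h | h
    · have e := hf₁ t ht h
      refine ⟨by rw [e.eq_of_nhds]; exact hd₁ t ht h, ContinuousAt.congr ?_ e.symm⟩
      rw [(hneg t h).eq_of_nhds]
      exact (contDiffAt_pullField contDiffAt_id (isInvertible_fderiv_id _)
        (hd t ht).2.1.2.2.2).continuousAt
    · have e := hf₂ t ht h
      refine ⟨by rw [e.eq_of_nhds]; exact hd₂ t ht h, ContinuousAt.congr ?_ e.symm⟩
      rw [(hpos t h).eq_of_nhds]
      exact (contDiffAt_pullField (contDiffAt_waveMap (hsm₂ t ht))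
        (isInvertible_fderiv_waveMap (hsm₂ t ht) (hd t ht).2.1.2.1)
        (hd t ht).2.1.2.2.1).continuousAt
  · intro t ht
    by_cases hne : t = t₀
    · subst hne
      rw [hWt₀]
      -- The branches share the velocity `w₀`, so the position is differentiable at the crossing
      -- although the acceleration may jump.
      have g₁ : HasDerivAt (fun r => (W₁ r).1) (W₁ t).2 t :=
        (hasFDerivAt_fst (𝕜 := ℝ) (p := W₁ t)).comp_hasDerivAt t (hW₁' t ht)
      have g₂ : HasDerivAt (fun r => (W₂ r).1) (W₂ t).2 t :=
        (hasFDerivAt_fst (𝕜 := ℝ) (p := W₂ t)).comp_hasDerivAt t (hW₂' t ht)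
      rw [hW₂0] at g₂
      rw [hW₁0] at g₁ ⊢
      have u₁ : HasDerivWithinAt (fun r => (W r).1) w₀ {r | (r - t) * α ≤ 0} t :=
        g₁.hasDerivWithinAt.congr (fun r hr => by simp only [hWdef, if_pos (show (r - t) * α ≤ 0 from hr)]) (by simp [hWdef])
      have u₂ : HasDerivWithinAt (fun r => (W r).1) w₀ {r | ¬ (r - t) * α ≤ 0} t :=
        g₂.hasDerivWithinAt.congr (fun r hr => by simp only [hWdef, if_neg (show ¬ (r - t) * α ≤ 0 from hr)])
          (by simp [hWdef, hW₁0, hW₂0])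
      have := u₁.union u₂
      rwa [show {r | (r - t) * α ≤ 0} ∪ {r | ¬ (r - t) * α ≤ 0} = univ from
        eq_univ_of_forall fun r => em _, hasDerivWithinAt_univ] at this
    · rcases (hside t ht hne).lt_or_gt with h | h
      · exact (hasFDerivAt_fst (𝕜 := ℝ) (p := W t)).comp_hasDerivAt t (hd₁ t ht h)
      · exact (hasFDerivAt_fst (𝕜 := ℝ) (p := W t)).comp_hasDerivAt t (hd₂ t ht h)
  · intro t ht
    -- The front branch is the orbit of `b`. The other one, read through `waveMap`, starts from
    -- null-rotated data and is the orbit of `jump b`.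
    have E₁ := embed_comp_eq_flow s (T := id) ordConnected_Ioo
      (fun t ht => (hW₁' t ht).hasDerivWithinAt) (fun t _ => contDiffAt_id)
      (fun t _ => isInvertible_fderiv_id _) (fun t ht => (hd t ht).2.1.2.2.2) ht₀ ht
    have E₂ := embed_comp_eq_flow s (T := waveMap F) ordConnected_Ioo
      (fun t ht => (hW₂' t ht).hasDerivWithinAt)
      (fun t ht => by exact_mod_cast contDiffAt_infty.1 (contDiffAt_waveMap (hsm₂ t ht)) 2)
      (fun t ht => isInvertible_fderiv_waveMap (hsm₂ t ht) (hd t ht).2.1.2.1)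
      (fun t ht => (hd t ht).2.1.2.2.1) ht₀ ht
    simp only [hW₁0, fderiv_id, ContinuousLinearMap.id_apply, id_eq] at E₁
    rw [embed_chartPos hb.pos hs, dEmbed_chartVel hb.pos hs hb.tangent, curv_eq, hb.speed] at E₁
    simp only [hW₂0, fderiv_waveMap hFs, embed_waveMap hx00 hΩ.ne',
      dEmbed_waveMap hx00 hΩ.ne'] at E₂
    rw [embed_chartPos hb.pos hs, dEmbed_chartVel hb.pos hs hb.tangent, curv_eq,
      ambientForm_nullRotation, hb.speed, ← jumpParam_eq hH hHs hglue hb.pos h0 hs] at E₂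
    have hjump : jump Λ H Hs b = (nullRotation Λ (jumpParam Λ H Hs b.1) b.1,
      nullRotation Λ (jumpParam Λ H Hs b.1) b.2) := if_pos h0
    rw [← hjump] at E₂
    simp only [Chart.toAmbient, Chart.pole, ← hF]
    by_cases hne : t = t₀
    · subst hne
      rw [hWt₀, hW₁0, sub_self]
      simp only [brokenFlow, flow_zero, h0, le_refl, if_true]
      rw [toConformallyFlat_of_nonpos hx00.le, embed_chartPos hb.pos hs]
    · rcases (hside t ht hne).lt_or_gt with h | h
      · have hfl : (flow k (t - t₀) b).1.1 0 ≤ 0 := by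
          have := (hd t ht).2.1.1 hne
          nlinarith
        rw [(hneg t h).eq_of_nhds, toConformallyFlat_of_nonpos (hnegU t ht h).le, brokenFlow,
          if_pos hfl]
        exact (congrArg Prod.fst E₁).symm
      · have hfl : ¬ (flow k (t - t₀) b).1.1 0 ≤ 0 := by
          have := (hd t ht).2.1.1 hne
          exact not_le.2 (pos_of_mul_pos_left this h.le)
        rw [(hpos t h).eq_of_nhds, toConformallyFlat_of_pos (hposU t ht h), brokenFlow,
          if_neg hfl]
        exact (congrArg Prod.fst E₂).symm

theorem exists_isLocalGeodesic
    (hH : ContDiffOn ℝ ∞ H {X | 0 < surfaceFactor Λ X})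
    (hHs : ContDiffOn ℝ ∞ Hs {X | 0 < surfaceFactor Λ X})
    (hglue : 0 < Λ → ∀ X : Plane, X ≠ 0 →
      Hs X = Λ / 12 * planeSq X * H ((12 / (Λ * planeSq X)) • X))
    (hb : IsState Λ k b) (h : b.1.1 0 ≠ 0 ∨ b.2.1 0 ≠ 0)
    (t₀ : ℝ) :
    ∃ κ : Chart, ∃ ε > 0, ∃ W : ℝ → Coord × Coord, IsLocalGeodesic Λ H Hs κ t₀ ε W
      fun t => (brokenFlow Λ H Hs k (t - t₀) b).1 := by
  by_cases h0 : b.1.1 0 = 0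
  · exact exists_isLocalGeodesic_of_eq hH hHs hglue hb h0 (h.resolve_left fun h => h h0) t₀
  · exact exists_isLocalGeodesic_of_ne hb h0 t₀

end

end ImpulsiveWave

/-! ### Regularity of arbitrary Filippov solutions. -/

section Regularity

variable {E : Type*} [NormedAddCommGroup E]

theorem AbsolutelyContinuousOnInterval.fst {F : Type*} [NormedAddCommGroup F] {W : ℝ → E × F}
    {a b : ℝ} (h : AbsolutelyContinuousOnInterval W a b) :
    AbsolutelyContinuousOnInterval (fun t => (W t).1) a b := by
  refine squeeze_zero (fun _ => Finset.sum_nonneg fun _ _ => dist_nonneg) (fun _ => ?_) h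
  exact Finset.sum_le_sum fun _ _ => le_max_left _ _

theorem continuousOn_of_absolutelyContinuous {J : Set ℝ} {W : ℝ → E}
    (hW : ∀ a ∈ J, ∀ b ∈ J, AbsolutelyContinuousOnInterval W a b) : ContinuousOn W J := by
  intro t ht
  have right : ContinuousWithinAt W (J ∩ Ici t) t := by
    by_cases hb : ∃ b ∈ J, t < b
    · obtain ⟨b, hb, htb⟩ := hb
      have h1 := (hW t ht b hb).continuousOn t left_mem_uIcc
      rw [uIcc_of_le htb.le] at h1
      exact h1.mono_of_mem_nhdsWithin (mem_of_superset
        (inter_mem_nhdsWithin _ (Iio_mem_nhds htb)) fun s hs => ⟨hs.1.2, hs.2.le⟩)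
    · push Not at hb
      exact continuousWithinAt_singleton.mono fun s hs => le_antisymm (hb s hs.1) hs.2
  have left : ContinuousWithinAt W (J ∩ Iic t) t := by
    by_cases hb : ∃ b ∈ J, b < t
    · obtain ⟨b, hb, htb⟩ := hb
      have h1 := (hW b hb t ht).continuousOn t right_mem_uIcc
      rw [uIcc_of_le htb.le] at h1
      exact h1.mono_of_mem_nhdsWithin (mem_of_superset
        (inter_mem_nhdsWithin _ (Ioi_mem_nhds htb)) fun s hs => ⟨hs.2.le, hs.1.2⟩)
    · push Not at hb
      exact continuousWithinAt_singleton.mono fun s hs => le_antisymm hs.2 (hb s hs.1)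
  have := left.union right
  rwa [← inter_union_distrib_left, Iic_union_Ici, inter_univ] at this

variable [NormedSpace ℝ E] [CompleteSpace E]

/-- Where the right hand side is continuous a Filippov solution is a classical solution; one
exceptional parameter value does no harm. -/
theorem IsFilippovSolutionOn.hasDerivWithinAt [MeasureSpace E] {D : Set E} {f F : E → E}
    {J J' : Set ℝ} {W : ℝ → E} (hW : IsFilippovSolutionOn D f J W) (hJ' : J'.OrdConnected)
    (hsub : J' ⊆ J) (hF : ∀ t ∈ J', ContinuousAt F (W t)) (t₀ : ℝ)
    (hf : ∀ t ∈ J', t ≠ t₀ → f =ᶠ[𝓝 (W t)] F) :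
    ∀ t ∈ J', HasDerivWithinAt W (F (W t)) J' t := by
  have hAC : ∀ a ∈ J', ∀ b ∈ J', AbsolutelyContinuousOnInterval W a b := fun a ha b hb =>
    hW.absCont a (hsub ha) b (hsub hb)
  refine hasDerivWithinAt_of_absolutelyContinuous (g := fun t => F (W t)) hJ' hAC
    (fun t ht => (hF t ht).comp_continuousWithinAt
      (continuousOn_of_absolutelyContinuous hAC t ht)) ?_
  filter_upwards [hW.inclusion, Measure.ae_ne volume t₀] with t h1 h2 ht
  obtain ⟨d, hd, hder⟩ := h1 (hsub ht)
  have e := hf t ht h2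
  have := filippovMap_subset_of_continuousAt D ((hF t ht).congr e.symm) hd
  rw [mem_singleton_iff, e.eq_of_nhds] at this
  rwa [← this]

/-- The position components of the differential inclusion are single-valued and continuous, so a
discontinuity of the accelerations does not affect them. -/
theorem IsFilippovSolutionOn.hasDerivWithinAt_fst [MeasureSpace (E × E)] {D : Set (E × E)}
    {f : E × E → E × E} {J : Set ℝ} {W : ℝ → E × E} (hW : IsFilippovSolutionOn D f J W)
    (hJ : J.OrdConnected) (hf : ∀ w, (f w).1 = w.2) :
    ∀ t ∈ J, HasDerivWithinAt (fun t => (W t).1) (W t).2 J t := by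
  refine hasDerivWithinAt_of_absolutelyContinuous hJ
    (fun a ha b hb => (hW.absCont a ha b hb).fst)
    (continuous_snd.comp_continuousOn (continuousOn_of_absolutelyContinuous hW.absCont)) ?_
  filter_upwards [hW.inclusion] with t h1 ht
  obtain ⟨d, hd, hder⟩ := h1 ht
  rw [← filippovMap_fst_eq hf hd]
  exact (hasFDerivAt_fst (𝕜 := ℝ) (p := W t)).comp_hasDerivAt t hder

end Regularity

theorem ordConnected_mul_nonpos (t₀ α : ℝ) : {t : ℝ | (t - t₀) * α ≤ 0}.OrdConnected := by
  refine ⟨fun x hx y hy z hz => ?_⟩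
  simp only [mem_ofPred_eq] at hx hy ⊢
  rcases le_total 0 α with h | h
  · nlinarith [hz.1, hz.2]
  · nlinarith [hz.1, hz.2]

theorem ordConnected_mul_nonneg (t₀ α : ℝ) : {t : ℝ | 0 ≤ (t - t₀) * α}.OrdConnected := by
  have := ordConnected_mul_nonpos t₀ (-α)
  simpa using this

theorem exists_inter_Ioo_of_eventually {P : ℝ → Prop} {I : Set ℝ} {t₀ : ℝ}
    (h : ∀ᶠ t in 𝓝[I] t₀, P t) : ∃ δ > 0, ∀ t ∈ I ∩ Ioo (t₀ - δ) (t₀ + δ), P t := by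
  obtain ⟨δ, hδ, h⟩ := ImpulsiveWave.exists_Ioo_of_eventually (eventually_nhdsWithin_iff.1 h)
  exact ⟨δ, hδ, fun t ht => h t ht.2 ht.1⟩

theorem nhdsWithin_inter_Ioo {I : Set ℝ} {t₀ ε : ℝ} (hε : 0 < ε) :
    𝓝[I ∩ Ioo (t₀ - ε) (t₀ + ε)] t₀ = 𝓝[I] t₀ :=
  nhdsWithin_inter_of_mem' (mem_nhdsWithin_of_mem_nhds (Ioo_mem_nhds (by linarith) (by linarith)))

/-! ### The local form of an arbitrary Filippov geodesic. -/

namespace ImpulsiveWave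

theorem geodesicField_fst (Λ : ℝ) (H : Plane → ℝ) (w : Coord × Coord) :
    (geodesicField Λ H w).1 = w.2 := rfl

theorem toAmbient_wave_apply_zero {Λ : ℝ} {H Hs : Plane → ℝ} {s : Pole} (x : Coord) :
    ((Chart.wave s).toAmbient Λ H Hs x).1 0 =
      (omega Λ (Chart.profile H Hs (.wave s)) x)⁻¹ * x 0 := by
  simp only [Chart.toAmbient, Chart.pole]
  rcases le_or_gt (x 0) 0 with h | h
  · rw [toConformallyFlat_of_nonpos h, embed_eq, omega_eq_conformal (Or.inl h)]; rfl
  · rw [toConformallyFlat_of_pos h, embed_eq, conformal_waveMap Λ h.le]; rfl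

theorem embed_apply_zero {Λ : ℝ} {s : Pole} (y : Coord) :
    (embed Λ s y).1 0 = (conformal Λ y)⁻¹ * y 0 := rfl

theorem isState_embed {Λ : ℝ} {s : Pole} {y w : Coord} (hΩ : conformal Λ y ≠ 0)
    (h : Λ = 0 → (embed Λ s y).2 = 1) :
    IsState Λ (curv Λ (dEmbed Λ s y w)) (embed Λ s y, dEmbed Λ s y w) :=
  ⟨ambientForm_embed hΩ, ambientForm_embed_dEmbed hΩ, (curv_eq _ _).symm, h⟩

/-- `t₀` may be an end point of `J'` lying on the wave surface: the smooth field `pullField` is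
continuous there, even where the geodesic field does not agree with it. -/
theorem embed_comp_eq_flow_of_isFilippovSolutionOn {Λ : ℝ} (s : Pole) {F : Plane → ℝ}
    {T : Coord → Coord} {D : Set (Coord × Coord)} {W : ℝ → Coord × Coord} {J J' : Set ℝ}
    (hW : IsFilippovSolutionOn D (geodesicField Λ F) J W) (hJ' : J'.OrdConnected) (hsub : J' ⊆ J)
    {t₀ : ℝ} (hf : ∀ t ∈ J', t ≠ t₀ → geodesicField Λ F =ᶠ[𝓝 (W t)] pullField Λ T)
    (hT : ∀ t ∈ J', ContDiffAt ℝ ∞ T (W t).1)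
    (hinv : ∀ t ∈ J', (fderiv ℝ T (W t).1).IsInvertible)
    (hΩ : ∀ t ∈ J', conformal Λ (T (W t).1) ≠ 0) (ht₀ : t₀ ∈ J') {t : ℝ} (ht : t ∈ J') :
    (embed Λ s (T (W t).1), dEmbed Λ s (T (W t).1) (fderiv ℝ T (W t).1 (W t).2)) =
      flow (curv Λ (dEmbed Λ s (T (W t₀).1) (fderiv ℝ T (W t₀).1 (W t₀).2))) (t - t₀)
        (embed Λ s (T (W t₀).1), dEmbed Λ s (T (W t₀).1) (fderiv ℝ T (W t₀).1 (W t₀).2)) :=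
  embed_comp_eq_flow s hJ' (hW.hasDerivWithinAt hJ' hsub
    (fun t ht => (contDiffAt_pullField (hT t ht) (hinv t ht) (hΩ t ht)).continuousAt) t₀ hf)
    (fun t ht => by exact_mod_cast contDiffAt_infty.1 (hT t ht) 2) hinv hΩ ht₀ ht

/-- Near `t₀` the curve `c` on `I` is the orbit of a state that is transversal to the wave
surface. -/
def IsBrokenOrbitNear (Λ : ℝ) (H Hs : Plane → ℝ) (I : Set ℝ) (c : ℝ → Ambient) (t₀ : ℝ) : Prop :=
  ∃ k b, IsState Λ k b ∧ (b.1.1 0 ≠ 0 ∨ b.2.1 0 ≠ 0) ∧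
    ∀ᶠ t in 𝓝[I] t₀, c t = (brokenFlow Λ H Hs k (t - t₀) b).1

section

variable {Λ : ℝ} {H Hs : Plane → ℝ} {I : Set ℝ} {c : ℝ → Ambient} {t₀ ε : ℝ}
  {W : ℝ → Coord × Coord} {s : Pole}

/-- Away from the wave surface. -/
theorem isBrokenOrbitNear_of_ne {F : Plane → ℝ} {T : Coord → Coord} {D : Set (Coord × Coord)}
    (hI : I.OrdConnected) (ht₀ : t₀ ∈ I) (hε : 0 < ε)
    (hflat : Λ = 0 → (c t₀).2 = 1)
    (hW : IsFilippovSolutionOn D (geodesicField Λ F) (I ∩ Ioo (t₀ - ε) (t₀ + ε)) W)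
    (h : ∀ᶠ t in 𝓝[I] t₀, geodesicField Λ F =ᶠ[𝓝 (W t)] pullField Λ T ∧
      ContDiffAt ℝ ∞ T (W t).1 ∧ (fderiv ℝ T (W t).1).IsInvertible ∧
      conformal Λ (T (W t).1) ≠ 0 ∧ c t = embed Λ s (T (W t).1))
    (h0 : T (W t₀).1 0 ≠ 0) : IsBrokenOrbitNear Λ H Hs I c t₀ := by
  obtain ⟨-, -, -, h4, h5⟩ := h.self_of_nhdsWithin ht₀
  have hst := isState_embed (s := s) (w := fderiv ℝ T (W t₀).1 (W t₀).2) h4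
    fun h => by rw [← h5]; exact hflat h
  have hb0 : (embed Λ s (T (W t₀).1)).1 0 ≠ 0 := by
    rw [embed_apply_zero]
    exact mul_ne_zero (inv_ne_zero h4) h0
  refine ⟨_, _, hst, Or.inl hb0, ?_⟩
  obtain ⟨δ, hδ, hd⟩ := exists_inter_Ioo_of_eventually h
  set J' := I ∩ Ioo (t₀ - min δ ε) (t₀ + min δ ε)
  have hδε : 0 < min δ ε := lt_min hδ hε
  have hJδ : J' ⊆ I ∩ Ioo (t₀ - δ) (t₀ + δ) := inter_subset_inter_right _
    (Ioo_subset_Ioo (by linarith [min_le_left δ ε]) (by linarith [min_le_left δ ε]))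
  have hJε : J' ⊆ I ∩ Ioo (t₀ - ε) (t₀ + ε) := inter_subset_inter_right _
    (Ioo_subset_Ioo (by linarith [min_le_right δ ε]) (by linarith [min_le_right δ ε]))
  have hmem : J' ∈ 𝓝[I] t₀ :=
    inter_mem_nhdsWithin _ (Ioo_mem_nhds (by linarith) (by linarith))
  filter_upwards [hmem] with t ht
  rw [brokenFlow_of_ne hb0, (hd t (hJδ ht)).2.2.2.2]
  exact congrArg Prod.fst (embed_comp_eq_flow_of_isFilippovSolutionOn s hW
    (hI.inter ordConnected_Ioo) hJε (fun t ht _ => (hd t (hJδ ht)).1)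
    (fun t ht => (hd t (hJδ ht)).2.1) (fun t ht => (hd t (hJδ ht)).2.2.1)
    (fun t ht => (hd t (hJδ ht)).2.2.2.1) ⟨ht₀, by linarith, by linarith⟩ ht)

theorem hessDet_ne_zero_of_mem_domain
    (hH : ContDiffOn ℝ ∞ H {X | 0 < surfaceFactor Λ X})
    (hHs : ContDiffOn ℝ ∞ Hs {X | 0 < surfaceFactor Λ X})
    {x : Coord} (hx : x ∈ Chart.domain Λ H Hs (.wave s))
    (hx0 : 0 ≤ x 0) : hessDet (Chart.profile H Hs (.wave s)) x ≠ 0 := by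
  intro h
  have := hx.2.2
  rw [det_spatialMetric ((contDiffOn_profile hH hHs s).contDiffAt_profile hx.1) hx0, h] at this
  simp at this

/-- A curve crossing the wave surface transversally. -/
theorem isBrokenOrbitNear_of_eq
    (hH : ContDiffOn ℝ ∞ H {X | 0 < surfaceFactor Λ X})
    (hHs : ContDiffOn ℝ ∞ Hs {X | 0 < surfaceFactor Λ X})
    (hglue : 0 < Λ → ∀ X : Plane, X ≠ 0 →
      Hs X = Λ / 12 * planeSq X * H ((12 / (Λ * planeSq X)) • X))
    (hI : I.OrdConnected) (ht₀ : t₀ ∈ I) (hε : 0 < ε) (hflat : Λ = 0 → (c t₀).2 = 1)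
    (hW : IsFilippovSolutionOn {w | w.1 ∈ Chart.domain Λ H Hs (.wave s)}
      (geodesicField Λ (Chart.profile H Hs (.wave s))) (I ∩ Ioo (t₀ - ε) (t₀ + ε)) W)
    (hc : ∀ t ∈ I ∩ Ioo (t₀ - ε) (t₀ + ε), c t = (Chart.wave s).toAmbient Λ H Hs (W t).1)
    (h0 : (W t₀).1 0 = 0) (hα : (W t₀).2 0 ≠ 0) : IsBrokenOrbitNear Λ H Hs I c t₀ := by
  set F := Chart.profile H Hs (.wave s) with hF
  have hFP : ContDiffOn ℝ ∞ F {X | 0 < surfaceFactor Λ X} := contDiffOn_profile hH hHs s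
  set J := I ∩ Ioo (t₀ - ε) (t₀ + ε) with hJ
  have hJo : J.OrdConnected := hI.inter ordConnected_Ioo
  have htJ : t₀ ∈ J := ⟨ht₀, by linarith, by linarith⟩
  set x₀ := (W t₀).1 with hx₀
  set w₀ := (W t₀).2 with hw₀
  set α := w₀ 0 with hαdef
  have hΩ : 0 < conformal Λ x₀ := by
    rw [← omega_eq_conformal (H := F) (Or.inl h0.le)]
    exact (hW.mem t₀ htJ).2.1
  have hc₀ : c t₀ = embed Λ s x₀ := by
    rw [hc t₀ htJ, Chart.toAmbient, toConformallyFlat_of_nonpos h0.le]; rfl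
  have hst := isState_embed (s := s) (w := w₀) hΩ.ne'
    fun h => by rw [← hc₀]; exact hflat h
  set b : Ambient × Ambient := (embed Λ s x₀, dEmbed Λ s x₀ w₀) with hb
  have hb0 : b.1.1 0 = 0 := by simp [hb, embed_apply_zero, h0]
  set k := curv Λ (dEmbed Λ s x₀ w₀) with hk
  have hb1 : b.2.1 0 ≠ 0 := by
    have : b.2.1 0 = (conformal Λ x₀)⁻¹ * α := by
      simp [hb, dEmbed, h0, hαdef]
    rw [this]
    exact mul_ne_zero (inv_ne_zero hΩ.ne') hα
  have hfs : ContDiffAt ℝ ∞ F (planePart x₀) := hFP.contDiffAt_profile (hW.mem t₀ htJ).1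
  -- Reading the data at `t₀` through `waveMap` instead of the identity gives `jump b`.
  have hjump : jump Λ H Hs b = (embed Λ s (waveMap F x₀), dEmbed Λ s (waveMap F x₀)
      (fderiv ℝ (waveMap F) x₀ w₀)) := by
    rw [fderiv_waveMap hfs, embed_waveMap h0 hΩ.ne', dEmbed_waveMap h0 hΩ.ne', jump, if_pos hb0,
      jumpParam_eq hH hHs hglue hst.pos hb0 (neg_one_lt_sign_mul_embed hΩ), chartPos_embed hΩ.ne']
  have hk₂ : curv Λ (dEmbed Λ s (waveMap F x₀) (fderiv ℝ (waveMap F) x₀ w₀)) = k := by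
    have := (hst.jump (H := H) (Hs := Hs)).speed
    rw [hjump] at this
    rw [curv_eq]; exact this
  -- Differentiability of the position holds before any classical equation is known, and already
  -- decides on which side of the surface the curve runs.
  have hder : HasDerivWithinAt (fun t => (W t).1 0) α J t₀ :=
    hasDerivWithinAt_pi.1 (hW.hasDerivWithinAt_fst hJo (geodesicField_fst _ _) t₀ htJ) 0
  have hev := eventually_pos_mul_of_hasDerivWithinAt hder h0 hα
  rw [nhdsWithin_inter_Ioo hε] at hev
  obtain ⟨δ, hδ, hd⟩ := exists_inter_Ioo_of_eventually hev
  have hδε : 0 < min δ ε := lt_min hδ hε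
  set J' := I ∩ Ioo (t₀ - min δ ε) (t₀ + min δ ε)
  have hJδ : J' ⊆ I ∩ Ioo (t₀ - δ) (t₀ + δ) := inter_subset_inter_right _
    (Ioo_subset_Ioo (by linarith [min_le_left δ ε]) (by linarith [min_le_left δ ε]))
  have hJε : J' ⊆ J := inter_subset_inter_right _
    (Ioo_subset_Ioo (by linarith [min_le_right δ ε]) (by linarith [min_le_right δ ε]))
  have hmem : J' ∈ 𝓝[I] t₀ :=
    inter_mem_nhdsWithin _ (Ioo_mem_nhds (by linarith) (by linarith))
  have htJ' : t₀ ∈ J' := ⟨ht₀, by linarith, by linarith⟩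
  have hneg : ∀ t ∈ J', (t - t₀) * α < 0 → (W t).1 0 < 0 := fun t ht h => by
    have := hd t (hJδ ht) (by rintro rfl; simp at h)
    exact neg_of_mul_pos_left this h.le
  have hpos : ∀ t ∈ J', 0 < (t - t₀) * α → 0 < (W t).1 0 := fun t ht h => by
    have := hd t (hJδ ht) (by rintro rfl; simp at h)
    exact pos_of_mul_pos_left this h.le
  have hside : ∀ t, t ≠ t₀ → (t - t₀) * α ≠ 0 := fun t hne =>
    mul_ne_zero (sub_ne_zero.2 hne) hα
  have hnonpos : ∀ t ∈ J' ∩ {t | (t - t₀) * α ≤ 0}, (W t).1 0 ≤ 0 := fun t ht => by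
    rcases eq_or_ne t t₀ with rfl | hne
    · exact h0.le
    · exact (hneg t ht.1 (lt_of_le_of_ne ht.2 (hside t hne))).le
  have hnonneg : ∀ t ∈ J' ∩ {t | 0 ≤ (t - t₀) * α}, 0 ≤ (W t).1 0 := fun t ht => by
    rcases eq_or_ne t t₀ with rfl | hne
    · exact h0.ge
    · exact (hpos t ht.1 (lt_of_le_of_ne ht.2 (hside t hne).symm)).le
  have hΩ₁ : ∀ t ∈ J' ∩ {t | (t - t₀) * α ≤ 0}, 0 < conformal Λ (W t).1 := fun t ht => by
    rw [← omega_eq_conformal (H := F) (Or.inl (hnonpos t ht))]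
    exact (hW.mem t (hJε ht.1)).2.1
  have hΩ₂ : ∀ t ∈ J' ∩ {t | 0 ≤ (t - t₀) * α}, 0 < conformal Λ (waveMap F (W t).1) :=
    fun t ht => by
      rw [conformal_waveMap Λ (hnonneg t ht)]
      exact (hW.mem t (hJε ht.1)).2.1
  have hsm : ∀ t ∈ J', ContDiffAt ℝ ∞ F (planePart (W t).1) := fun t ht =>
    hFP.contDiffAt_profile (hW.mem t (hJε ht)).1
  refine ⟨k, b, hst, Or.inr hb1, ?_⟩
  filter_upwards [hmem] with t ht
  rw [hc t (hJε ht), Chart.toAmbient]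
  -- On each closed half of the parameter interval, with `t₀` included, the curve is a classical
  -- solution of one smooth system.
  rcases le_or_gt ((t - t₀) * α) 0 with h | h
  · have E := embed_comp_eq_flow_of_isFilippovSolutionOn s (T := id) hW
      ((hI.inter ordConnected_Ioo).inter (ordConnected_mul_nonpos t₀ α))
      (fun t ht => hJε ht.1) (t₀ := t₀)
      (fun t ht hne => geodesicField_eventuallyEq_flat
        (Or.inl (hneg t ht.1 (lt_of_le_of_ne ht.2 (hside t hne)))) (hΩ₁ t ht).ne')
      (fun _ _ => contDiffAt_id) (fun _ _ => isInvertible_fderiv_id _)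
      (fun t ht => (hΩ₁ t ht).ne') ⟨htJ', by simp⟩ ⟨ht, h⟩
    simp only [fderiv_id, ContinuousLinearMap.id_apply, id_eq] at E
    have hU := hnonpos t ⟨ht, h⟩
    have e1 := congrArg Prod.fst E
    have hfl : (flow k (t - t₀) b).1.1 0 ≤ 0 := by
      rw [← e1]
      simp only [embed_apply_zero]
      exact mul_nonpos_of_nonneg_of_nonpos (inv_nonneg.2 (hΩ₁ t ⟨ht, h⟩).le) hU
    rw [toConformallyFlat_of_nonpos hU, brokenFlow, if_pos hfl]
    exact e1
  · have E := embed_comp_eq_flow_of_isFilippovSolutionOn s (T := waveMap F) hW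
      ((hI.inter ordConnected_Ioo).inter (ordConnected_mul_nonneg t₀ α))
      (fun t ht => hJε ht.1) (t₀ := t₀)
      (fun t ht hne => geodesicField_eventuallyEq_wave
        (hpos t ht.1 (lt_of_le_of_ne ht.2 (hside t hne).symm)) hFP (hW.mem t (hJε ht.1)).1
        (hW.mem t (hJε ht.1)).2.1.ne'
        (hessDet_ne_zero_of_mem_domain hH hHs (hW.mem t (hJε ht.1)) (hnonneg t ht)))
      (fun t ht => contDiffAt_waveMap (hsm t ht.1))
      (fun t ht => isInvertible_fderiv_waveMap (hsm t ht.1)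
        (hessDet_ne_zero_of_mem_domain hH hHs (hW.mem t (hJε ht.1)) (hnonneg t ht)))
      (fun t ht => (hΩ₂ t ht).ne') ⟨htJ', by simp⟩ ⟨ht, h.le⟩
    rw [← hx₀, ← hw₀, hk₂, ← hjump] at E
    have hU := hpos t ht h
    have e1 := congrArg Prod.fst E
    have hfl : ¬ (flow k (t - t₀) b).1.1 0 ≤ 0 := by
      -- The branch test of `brokenFlow` uses `b`, but `jump` leaves `Ũ` and its velocity unchanged,
      -- so it may be read off from the orbit of `jump b`.
      have e2 : (flow k (t - t₀) b).1.1 0 = (flow k (t - t₀) (jump Λ H Hs b)).1.1 0 := by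
        simp only [flow_apply_zero, jump_fst_zero, jump_snd_zero]
      rw [e2, ← e1, not_le]
      simp only [embed_apply_zero]
      exact mul_pos (inv_pos.2 (hΩ₂ t ⟨ht, h.le⟩)) hU
    rw [toConformallyFlat_of_pos hU, brokenFlow, if_neg hfl]
    exact e1

/-- A Filippov geodesic is, near every parameter value, the orbit of a state transversal to the wave
surface, unless it touches the wave surface. -/
theorem isBrokenOrbitNear_or_tangent
    (hH : ContDiffOn ℝ ∞ H {X | 0 < surfaceFactor Λ X})
    (hHs : ContDiffOn ℝ ∞ Hs {X | 0 < surfaceFactor Λ X})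
    (hglue : 0 < Λ → ∀ X : Plane, X ≠ 0 →
      Hs X = Λ / 12 * planeSq X * H ((12 / (Λ * planeSq X)) • X))
    {γ : ℝ → Spacetime Λ} (hI : I.OrdConnected)
    (hγ : IsFilippovGeodesicOn Λ H Hs I γ) (ht₀ : t₀ ∈ I) :
    IsBrokenOrbitNear Λ H Hs I (fun t => (γ t).1) t₀ ∨
      ((γ t₀).1.1 0 = 0 ∧ HasDerivWithinAt (fun t => (γ t).1.1 0) 0 I t₀) := by
  obtain ⟨κ, ε, hε, W, hW, hc⟩ := hγ t₀ ht₀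
  have hflat : Λ = 0 → (γ t₀).1.2 = 1 := (γ t₀).2.2
  have hmem : I ∩ Ioo (t₀ - ε) (t₀ + ε) ∈ 𝓝[I] t₀ :=
    inter_mem_nhdsWithin _ (Ioo_mem_nhds (by linarith) (by linarith))
  have htJ : t₀ ∈ I ∩ Ioo (t₀ - ε) (t₀ + ε) := ⟨ht₀, by linarith, by linarith⟩
  have hJo : (I ∩ Ioo (t₀ - ε) (t₀ + ε)).OrdConnected := hI.inter ordConnected_Ioo
  have hvel := hW.hasDerivWithinAt_fst hJo (geodesicField_fst _ _)
  have hU : HasDerivWithinAt (fun t => (W t).1 0) ((W t₀).2 0) I t₀ :=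
    (hasDerivWithinAt_pi.1 (hvel t₀ htJ) 0).mono_of_mem_nhdsWithin hmem
  cases κ with
  | half s =>
    refine Or.inl (isBrokenOrbitNear_of_ne (T := id) (s := s) hI ht₀ hε hflat hW ?_
      (hW.mem t₀ htJ).1)
    filter_upwards [hmem] with t ht
    have hΩ : conformal Λ (W t).1 ≠ 0 := by
      rw [← omega_eq_conformal (Or.inr rfl)]; exact (hW.mem t ht).2.ne'
    exact ⟨geodesicField_eventuallyEq_flat (Or.inr rfl) hΩ, contDiffAt_id,
      isInvertible_fderiv_id _, hΩ, by rw [hc t ht, toAmbient_half]; rfl⟩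
  | wave s =>
    set F := Chart.profile H Hs (.wave s) with hF
    have hFP : ContDiffOn ℝ ∞ F {X | 0 < surfaceFactor Λ X} := contDiffOn_profile hH hHs s
    rcases lt_trichotomy ((W t₀).1 0) 0 with h | h | h
    · refine Or.inl (isBrokenOrbitNear_of_ne (T := id) (s := s) hI ht₀ hε hflat hW ?_ h.ne)
      filter_upwards [hmem, hU.continuousWithinAt.eventually_lt_const h] with t ht hlt
      have hΩ : conformal Λ (W t).1 ≠ 0 := by
        rw [← omega_eq_conformal (H := F) (Or.inl hlt.le)]; exact (hW.mem t ht).2.1.ne'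
      refine ⟨geodesicField_eventuallyEq_flat (Or.inl hlt) hΩ, contDiffAt_id,
        isInvertible_fderiv_id _, hΩ, ?_⟩
      rw [hc t ht, Chart.toAmbient, toConformallyFlat_of_nonpos hlt.le]; rfl
    · by_cases hα : (W t₀).2 0 = 0
      · right
        -- Here `Ũ = U / ω`, where `ω` is only continuous because of the kink. But `U = o(t - t₀)`,
        -- which survives a bounded factor.
        have hω : 0 < omega Λ F (W t₀).1 := (hW.mem t₀ htJ).2.1
        have hcont : ContinuousWithinAt (fun t => (omega Λ F (W t).1)⁻¹) I t₀ :=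
          (ContinuousAt.comp_continuousWithinAt (g := omega Λ F) (f := fun t => (W t).1)
            (continuousAt_omega (hFP.contDiffAt_profile (hW.mem t₀ htJ).1))
            ((hvel t₀ htJ).continuousWithinAt.mono_of_mem_nhdsWithin hmem)).inv₀ hω.ne'
        have hγU : ∀ t ∈ I ∩ Ioo (t₀ - ε) (t₀ + ε),
            (γ t).1.1 0 = (omega Λ F (W t).1)⁻¹ * (W t).1 0 := fun t ht => by
          rw [hc t ht, toAmbient_wave_apply_zero]
        have h1 : (γ t₀).1.1 0 = 0 := by rw [hγU t₀ htJ, h, mul_zero]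
        refine ⟨h1, ?_⟩
        rw [hα, hasDerivWithinAt_iff_isLittleO] at hU
        rw [hasDerivWithinAt_iff_isLittleO]
        have h2 := (hcont.isBigO_one ℝ).mul_isLittleO hU
        refine h2.congr' ?_ (by simp)
        filter_upwards [hmem] with t ht
        rw [h1, hγU t ht, h]
        simp
      · exact Or.inl (isBrokenOrbitNear_of_eq hH hHs hglue hI ht₀ hε hflat hW hc h hα)
    · refine Or.inl (isBrokenOrbitNear_of_ne (T := waveMap F) (s := s) hI ht₀ hε hflat hW ?_
        (by exact h.ne'))
      filter_upwards [hmem, hU.continuousWithinAt.eventually_const_lt h] with t ht hlt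
      have hd := hW.mem t ht
      have hsm := hFP.contDiffAt_profile hd.1
      have hhess := hessDet_ne_zero_of_mem_domain hH hHs hd hlt.le
      refine ⟨geodesicField_eventuallyEq_wave hlt hFP hd.1 hd.2.1.ne' hhess,
        contDiffAt_waveMap hsm, isInvertible_fderiv_waveMap hsm hhess, ?_, ?_⟩
      · rw [conformal_waveMap Λ hlt.le]; exact hd.2.1.ne'
      · rw [hc t ht, Chart.toAmbient, toConformallyFlat_of_pos hlt]; rfl

end

end ImpulsiveWave

theorem IsFilippovSolutionOn.mono {E : Type*} [NormedAddCommGroup E] [NormedSpace ℝ E]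
    [MeasureSpace E] {D : Set E} {f : E → E} {J J' : Set ℝ} {W : ℝ → E}
    (hW : IsFilippovSolutionOn D f J W) (h : J' ⊆ J) : IsFilippovSolutionOn D f J' W where
  mem t ht := hW.mem t (h ht)
  absCont a ha b hb := hW.absCont a (h ha) b (h hb)
  inclusion := hW.inclusion.mono fun _ ht htJ => ht (h htJ)

theorem contDiffOn_one_of_hasDerivAt {E : Type*} [NormedAddCommGroup E] [NormedSpace ℝ E]
    {f g : ℝ → E} {s : Set ℝ} (hs : IsOpen s) (hf : ∀ t ∈ s, HasDerivAt f (g t) t)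
    (hg : ContinuousOn g s) : ContDiffOn ℝ 1 f s := by
  rw [show (1 : WithTop ℕ∞) = 0 + 1 from (zero_add 1).symm, contDiffOn_succ_iff_deriv_of_isOpen hs]
  refine ⟨fun t ht => (hf t ht).differentiableAt.differentiableWithinAt, by simp, ?_⟩
  exact contDiffOn_zero.2 (hg.congr fun t ht => (hf t ht).deriv)

theorem Set.OrdConnected.uniqueDiffWithinAt {I : Set ℝ} (hI : I.OrdConnected) {s t : ℝ}
    (hs : s ∈ I) (ht : t ∈ I) (h : s ≠ t) : UniqueDiffWithinAt ℝ I s := by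
  rcases h.lt_or_gt with h | h
  · exact (uniqueDiffOn_Icc h s (left_mem_Icc.2 h.le)).mono (hI.out hs ht)
  · exact (uniqueDiffOn_Icc h s (right_mem_Icc.2 h.le)).mono (hI.out ht hs)

/-! ### Global broken orbits. -/

namespace ImpulsiveWave

section

variable {Λ k : ℝ} {H Hs : Plane → ℝ} {b : Ambient × Ambient}

theorem brokenFlow_fst_apply_zero (t : ℝ) :
    (brokenFlow Λ H Hs k t b).1.1 0 = (flow k t b).1.1 0 := by
  unfold brokenFlow
  split_ifs
  · rfl
  · simp only [flow_apply_zero, jump_fst_zero, jump_snd_zero]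

theorem IsState.brokenFlow (hb : IsState Λ k b) (t : ℝ) :
    IsState Λ k (brokenFlow Λ H Hs k t b) := by
  unfold ImpulsiveWave.brokenFlow
  split_ifs
  · exact hb.flow t
  · exact hb.jump.flow t

/-- `Ũ` is the same for both branches and is visible in the image, so it reveals which of the two
injective branches was used. -/
theorem brokenFlow_injective (t : ℝ) : Function.Injective (brokenFlow Λ H Hs k t) := by
  intro b b' h
  have h0 : (flow k t b).1.1 0 = (flow k t b').1.1 0 := by
    rw [← brokenFlow_fst_apply_zero (Λ := Λ) (H := H) (Hs := Hs), h, brokenFlow_fst_apply_zero]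
  have hf : ∀ {x y : Ambient × Ambient}, flow k t x = flow k t y → x = y := fun {x y} e => by
    rw [← flow_neg_flow k t x, e, flow_neg_flow]
  unfold brokenFlow at h
  rw [h0] at h
  split_ifs at h
  · exact hf h
  · exact jump_injective (hf h)

theorem hasDerivAt_brokenFlow_fst {t : ℝ} (h : (flow k t b).1.1 0 ≠ 0) :
    HasDerivAt (fun t => (brokenFlow Λ H Hs k t b).1) (brokenFlow Λ H Hs k t b).2 t := by
  have hc : ContinuousAt (fun t => (flow k t b).1.1 0) t :=
    (hasDerivAt_flow_apply_zero k t b).continuousAt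
  rcases h.lt_or_gt with h | h
  · have e : (brokenFlow Λ H Hs k · b) =ᶠ[𝓝 t] (flow k · b) := by
      filter_upwards [hc.eventually_lt_const h] with s hs
      rw [brokenFlow, if_pos hs.le]
    rw [e.eq_of_nhds]
    exact (hasDerivAt_flow_fst k t b).congr_of_eventuallyEq (e.fun_comp Prod.fst)
  · have e : (brokenFlow Λ H Hs k · b) =ᶠ[𝓝 t] (flow k · (jump Λ H Hs b)) := by
      filter_upwards [hc.eventually_const_lt h] with s hs
      rw [brokenFlow, if_neg hs.not_ge]
    rw [e.eq_of_nhds]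
    exact (hasDerivAt_flow_fst k t _).congr_of_eventuallyEq (e.fun_comp Prod.fst)

theorem eventually_flow_ne_zero (h : b.1.1 0 ≠ 0 ∨ b.2.1 0 ≠ 0) (t : ℝ) :
    ∀ᶠ s in 𝓝[≠] t, (flow k s b).1.1 0 ≠ 0 := by
  have hd := hasDerivAt_flow_apply_zero k t b
  rcases flow_ne_zero (k := k) (t := t) h with h | h
  · exact (hd.continuousAt.eventually_ne h).filter_mono nhdsWithin_le_nhds
  · exact hd.eventually_ne h

/-- Two states are equal if their orbits agree near some point off the wave surface. -/
theorem eq_of_brokenFlow_eventuallyEq {k' : ℝ} {b' : Ambient × Ambient} (hb : IsState Λ k b)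
    (hb' : IsState Λ k' b') {I : Set ℝ} {t t₁ : ℝ} (ht : t ∈ I) (hI : UniqueDiffWithinAt ℝ I t)
    (h0 : (flow k (t - t₁) b).1.1 0 ≠ 0)
    (h : ∀ᶠ s in 𝓝[I] t,
      (brokenFlow Λ H Hs k (s - t₁) b).1 = (brokenFlow Λ H Hs k' (s - t₁) b').1) :
    k = k' ∧ b = b' := by
  have e := h.self_of_nhdsWithin ht
  have h0' : (flow k' (t - t₁) b').1.1 0 ≠ 0 := by
    rwa [← brokenFlow_fst_apply_zero (Λ := Λ) (H := H) (Hs := Hs), ← e, brokenFlow_fst_apply_zero]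
  have d := ((hasDerivAt_brokenFlow_fst (Λ := Λ) (H := H) (Hs := Hs) h0).comp_sub_const
    t t₁).hasDerivWithinAt (s := I)
  have d' := ((hasDerivAt_brokenFlow_fst (Λ := Λ) (H := H) (Hs := Hs) h0').comp_sub_const
    t t₁).hasDerivWithinAt (s := I)
  have e2 := hI.eq_deriv _ d (d'.congr_of_eventuallyEq h e)
  have e3 : brokenFlow Λ H Hs k (t - t₁) b = brokenFlow Λ H Hs k' (t - t₁) b' := Prod.ext e e2
  -- `k` is not an independent datum: it is the `ambientForm` of the velocity, which the broken flow
  -- conserves.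
  have hk : k = k' := by
    rw [← (hb.brokenFlow (H := H) (Hs := Hs) (t - t₁)).speed, e3,
      (hb'.brokenFlow (H := H) (Hs := Hs) (t - t₁)).speed]
  subst hk
  exact ⟨rfl, brokenFlow_injective _ e3⟩

/-- A curve of states that is, near every parameter value, the orbit of its value there. -/
structure IsBrokenOrbit (Λ : ℝ) (H Hs : Plane → ℝ) (k : ℝ) (b : Ambient × Ambient)
    (w : ℝ → Ambient × Ambient) : Prop where
  zero : w 0 = b
  isState : ∀ t, IsState Λ k (w t)
  fst_apply_zero : ∀ t, (w t).1.1 0 = (flow k t b).1.1 0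
  snd_apply_zero : ∀ t, (w t).2.1 0 = (flow k t b).2.1 0
  eventually_eq : ∀ t₀, ∀ᶠ t in 𝓝 t₀, w t = brokenFlow Λ H Hs k (t - t₀) (w t₀)

/-- The state carried back to time zero by the free flow is locally constant between crossings and
changes by a conjugated jump at each crossing. Finding the orbit is thus an instance of
`exists_isBrokenAt`. -/
theorem exists_isBrokenOrbit (H Hs : Plane → ℝ) (hb : IsState Λ k b) (h0 : b.1.1 0 ≠ 0) :
    ∃ w, IsBrokenOrbit Λ H Hs k b w := by
  -- Fixing `Ũ` and its velocity at time zero gives all candidates the same crossing times; the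
  -- jumps respect this set.
  let S := {a : Ambient × Ambient // IsState Λ k a ∧ a.1.1 0 = b.1.1 0 ∧ a.2.1 0 = b.2.1 0}
  have hS1 : ∀ (a : S) t, (flow k t a.1).1.1 0 = (flow k t b).1.1 0 := fun a t => by
    rw [flow_apply_zero, flow_apply_zero, a.2.2.1, a.2.2.2]
  have hS2 : ∀ (a : S) t, (flow k t a.1).2.1 0 = (flow k t b).2.1 0 := fun a t => by
    rw [flow_snd_apply_zero, flow_snd_apply_zero, a.2.2.1, a.2.2.2]
  have back : ∀ (t : ℝ) (x : Ambient × Ambient), x.1.1 0 = (flow k t b).1.1 0 →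
      x.2.1 0 = (flow k t b).2.1 0 → (flow k (-t) x).1.1 0 = b.1.1 0 ∧
        (flow k (-t) x).2.1 0 = b.2.1 0 := fun t x h1 h2 => by
    have e := flow_neg_flow k t b
    constructor
    · rw [flow_apply_zero, h1, h2, ← flow_apply_zero, e]
    · rw [flow_snd_apply_zero, h1, h2, ← flow_snd_apply_zero, e]
  -- The jump at time `t`, conjugated to time zero by the flow. It is the identity unless `t` is a
  -- crossing time.
  let B : ℝ → S ≃ S := fun t =>
    { toFun := fun a => ⟨flow k (-t) (jump Λ H Hs (flow k t a.1)),
        ((a.2.1.flow t).jump).flow (-t), back t _ (by rw [jump_fst_zero, hS1])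
          (by rw [jump_snd_zero, hS2])⟩
      invFun := fun a => ⟨flow k (-t) (jumpInv Λ H Hs (flow k t a.1)),
        ((a.2.1.flow t).jumpInv).flow (-t), back t _ (by rw [jumpInv_fst_zero, hS1])
          (by rw [jumpInv_snd_zero, hS2])⟩
      left_inv := fun a => Subtype.ext (by
        simp only [flow_flow_neg, jumpInv_jump, flow_neg_flow])
      right_inv := fun a => Subtype.ext (by
        simp only [flow_flow_neg, jump_jumpInv, flow_neg_flow]) }
  have hu : Continuous fun t => (flow k t b).1.1 0 :=
    continuous_iff_continuousAt.2 fun t => (hasDerivAt_flow_apply_zero k t b).continuousAt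
  obtain ⟨Q, hQ0, hQ⟩ := exists_isBrokenAt (B := B) hu (eventually_flow_ne_zero (Or.inl h0))
    (fun t ht => by
      ext1 a
      refine Subtype.ext ?_
      show flow k (-t) (jump Λ H Hs (flow k t a.1)) = a.1
      rw [jump_of_ne (by rwa [hS1]), flow_neg_flow])
    (by rwa [flow_zero]) ⟨b, hb, rfl, rfl⟩
  refine ⟨fun t => flow k t (Q t).1, ?_, fun t => (Q t).2.1.flow t, fun t => hS1 _ t,
    fun t => hS2 _ t, fun t₀ => ?_⟩
  · simp only [hQ0, flow_zero]
  · filter_upwards [hQ t₀] with t ht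
    have e : ∀ x : Ambient × Ambient, flow k (t - t₀) (flow k t₀ x) = flow k t x := fun x => by
      rw [← flow_add, sub_add_cancel]
    have e' : ∀ x : Ambient × Ambient, flow k t (flow k (-t₀) x) = flow k (t - t₀) x := fun x => by
      rw [← flow_add, sub_eq_add_neg]
    simp only [ht, brokenFlow, e, hS1]
    split_ifs with h
    · rfl
    · exact e' _

end

theorem isState_of_isTangent {Λ : ℝ} {p : Spacetime Λ} {v : Ambient} (hv : IsTangent p v) :
    IsState Λ (curv Λ v) (p.1, v) :=
  ⟨by rw [ambientForm, ← sq]; exact p.2.1, hv, (curv_eq Λ v).symm, p.2.2⟩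

/-! ### Properties of the broken orbit and uniqueness. -/

section

variable {Λ k : ℝ} {H Hs : Plane → ℝ} {b : Ambient × Ambient} {w : ℝ → Ambient × Ambient}
  {γ : ℝ → Spacetime Λ}

theorem IsBrokenOrbit.ne_zero (hw : IsBrokenOrbit Λ H Hs k b w) (h0 : b.1.1 0 ≠ 0) (t : ℝ) :
    (w t).1.1 0 ≠ 0 ∨ (w t).2.1 0 ≠ 0 := by
  rw [hw.fst_apply_zero, hw.snd_apply_zero]
  exact flow_ne_zero (Or.inl h0)

theorem IsBrokenOrbit.exists_isLocalGeodesic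
    (hH : ContDiffOn ℝ ∞ H {X | 0 < surfaceFactor Λ X})
    (hHs : ContDiffOn ℝ ∞ Hs {X | 0 < surfaceFactor Λ X})
    (hglue : 0 < Λ → ∀ X : Plane, X ≠ 0 →
      Hs X = Λ / 12 * planeSq X * H ((12 / (Λ * planeSq X)) • X))
    (hw : IsBrokenOrbit Λ H Hs k b w) (h0 : b.1.1 0 ≠ 0)
    (t₀ : ℝ) : ∃ κ : Chart, ∃ ε > 0, ∃ W : ℝ → Coord × Coord,
      IsLocalGeodesic Λ H Hs κ t₀ ε W fun t => (w t).1 := by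
  obtain ⟨κ, ε, hε, W, hW⟩ := ImpulsiveWave.exists_isLocalGeodesic hH hHs hglue (hw.isState t₀)
    (hw.ne_zero h0 t₀) t₀
  obtain ⟨δ, hδ, hd⟩ := exists_Ioo_of_eventually (hw.eventually_eq t₀)
  have h1 : Ioo (t₀ - min δ ε) (t₀ + min δ ε) ⊆ Ioo (t₀ - δ) (t₀ + δ) :=
    Ioo_subset_Ioo (by linarith [min_le_left δ ε]) (by linarith [min_le_left δ ε])
  have h2 : Ioo (t₀ - min δ ε) (t₀ + min δ ε) ⊆ Ioo (t₀ - ε) (t₀ + ε) :=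
    Ioo_subset_Ioo (by linarith [min_le_right δ ε]) (by linarith [min_le_right δ ε])
  refine ⟨κ, min δ ε, lt_min hδ hε, W, hW.solution.mono h2, hW.continuousOn.mono h2,
    fun t ht => hW.hasDerivAt t (h2 ht), fun t ht => ?_⟩
  rw [hd t (h1 ht)]
  exact hW.eq t (h2 ht)

theorem IsBrokenOrbit.isFilippovGeodesicOn
    (hH : ContDiffOn ℝ ∞ H {X | 0 < surfaceFactor Λ X})
    (hHs : ContDiffOn ℝ ∞ Hs {X | 0 < surfaceFactor Λ X})
    (hglue : 0 < Λ → ∀ X : Plane, X ≠ 0 →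
      Hs X = Λ / 12 * planeSq X * H ((12 / (Λ * planeSq X)) • X))
    (hw : IsBrokenOrbit Λ H Hs k b w) (h0 : b.1.1 0 ≠ 0)
    (hγ : ∀ t, (γ t).1 = (w t).1) : IsFilippovGeodesicOn Λ H Hs univ γ := by
  intro t₀ _
  obtain ⟨κ, ε, hε, W, hW⟩ := hw.exists_isLocalGeodesic hH hHs hglue h0 t₀
  refine ⟨κ, ε, hε, W, ?_, ?_⟩
  · rw [univ_inter]; exact hW.solution
  · rw [univ_inter]
    intro t ht
    rw [hγ]
    exact hW.eq t ht

theorem IsBrokenOrbit.isC1Curve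
    (hH : ContDiffOn ℝ ∞ H {X | 0 < surfaceFactor Λ X})
    (hHs : ContDiffOn ℝ ∞ Hs {X | 0 < surfaceFactor Λ X})
    (hglue : 0 < Λ → ∀ X : Plane, X ≠ 0 →
      Hs X = Λ / 12 * planeSq X * H ((12 / (Λ * planeSq X)) • X))
    (hw : IsBrokenOrbit Λ H Hs k b w) (h0 : b.1.1 0 ≠ 0)
    (hγ : ∀ t, (γ t).1 = (w t).1) : IsC1Curve Λ H Hs γ := by
  intro t₀
  obtain ⟨κ, ε, hε, W, hW⟩ := hw.exists_isLocalGeodesic hH hHs hglue h0 t₀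
  refine ⟨κ, ε, hε, fun t => (W t).1, contDiffOn_one_of_hasDerivAt isOpen_Ioo hW.hasDerivAt
    (continuous_snd.comp_continuousOn hW.continuousOn), fun t ht => ⟨hW.solution.mem t ht, ?_⟩⟩
  rw [hγ]
  exact hW.eq t ht

/-- This makes the set of local agreement closed. At a limit point with a transversal local form,
agreement nearby determines the state; a tangential one would give `Ũ` a double zero along `w`. -/
theorem IsBrokenOrbit.eventually_eq_of_frequently
    (hH : ContDiffOn ℝ ∞ H {X | 0 < surfaceFactor Λ X})
    (hHs : ContDiffOn ℝ ∞ Hs {X | 0 < surfaceFactor Λ X})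
    (hglue : 0 < Λ → ∀ X : Plane, X ≠ 0 →
      Hs X = Λ / 12 * planeSq X * H ((12 / (Λ * planeSq X)) • X))
    (hw : IsBrokenOrbit Λ H Hs k b w)
    (h0 : b.1.1 0 ≠ 0) {I : Set ℝ} {c : ℝ → Spacetime Λ} (hI : I.OrdConnected)
    (hc : IsFilippovGeodesicOn Λ H Hs I c) {t₁ : ℝ} (ht₁ : t₁ ∈ I)
    (h : ∃ᶠ t in 𝓝[I] t₁, ∀ᶠ s in 𝓝[I] t, (c s).1 = (w s).1) :
    ∀ᶠ s in 𝓝[I] t₁, (c s).1 = (w s).1 := by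
  by_contra hcon
  have h' : ∃ᶠ t in 𝓝[I \ {t₁}] t₁, ∀ᶠ s in 𝓝[I] t, (c s).1 = (w s).1 := by
    rw [frequently_nhdsWithin_iff] at h ⊢
    refine h.mono fun t ht => ⟨ht.1, ht.2, ?_⟩
    rintro rfl
    exact hcon ht.1
  have hle : 𝓝[I \ {t₁}] t₁ ≤ 𝓝[I] t₁ := nhdsWithin_mono _ sdiff_subset
  have hmem : ∀ᶠ t in 𝓝[I \ {t₁}] t₁, t ∈ I \ {t₁} := self_mem_nhdsWithin
  have hu := hasDerivAt_flow_apply_zero k t₁ b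
  rcases isBrokenOrbitNear_or_tangent hH hHs hglue hI hc ht₁ with ⟨k', b', hb', hb0', hloc⟩ | htan
  · have hloc' : ∀ᶠ t in 𝓝[I] t₁, ∀ᶠ s in 𝓝[I] t,
        (c s).1 = (brokenFlow Λ H Hs k' (s - t₁) b').1 := eventually_eventually_nhdsWithin.2 hloc
    have hw' : ∀ᶠ t in 𝓝[I] t₁, ∀ᶠ s in 𝓝[I] t, w s = brokenFlow Λ H Hs k (s - t₁) (w t₁) :=
      eventually_eventually_nhdsWithin.2 ((hw.eventually_eq t₁).filter_mono nhdsWithin_le_nhds)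
    have hne : ∀ᶠ t in 𝓝[I \ {t₁}] t₁, (flow k t b).1.1 0 ≠ 0 :=
      (eventually_flow_ne_zero (Or.inl h0) t₁).filter_mono (nhdsWithin_mono _ fun t ht => ht.2)
    -- A nearby time of local agreement is taken off the wave surface, where position and velocity
    -- in the ambient space are meaningful and fix the state.
    obtain ⟨t, h1, h2, h3, h4, h5⟩ := (h'.and_eventually ((hloc'.filter_mono hle).and
      ((hw'.filter_mono hle).and (hne.and hmem)))).exists
    have e := h3.self_of_nhdsWithin h5.1
    obtain ⟨hk, hb⟩ := eq_of_brokenFlow_eventuallyEq (H := H) (Hs := Hs) (hw.isState t₁) hb' h5.1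
      (hI.uniqueDiffWithinAt h5.1 ht₁ h5.2)
      (by rwa [← brokenFlow_fst_apply_zero (Λ := Λ) (H := H) (Hs := Hs), ← e, hw.fst_apply_zero])
      (by filter_upwards [h1, h2, h3] with s e1 e2 e3; rw [← e3, ← e1, e2])
    subst hk hb
    exact hcon (by
      filter_upwards [hloc, (hw.eventually_eq t₁).filter_mono nhdsWithin_le_nhds] with s e1 e2
      rw [e1, e2])
  -- `Ũ` along `c` and along `w` agree at times accumulating at `t₁`, so their limits and the limits
  -- of their difference quotients agree. Both would vanish for `w`.
  · have hfr : ∃ᶠ t in 𝓝[I \ {t₁}] t₁, (c t).1.1 0 = (flow k t b).1.1 0 :=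
      (h'.and_eventually hmem).mono fun t ht => by
        rw [ht.1.self_of_nhdsWithin ht.2.1, hw.fst_apply_zero]
    have e0 : (c t₁).1.1 0 = (flow k t₁ b).1.1 0 :=
      tendsto_nhds_unique_of_frequently_eq (htan.2.continuousWithinAt.mono_left hle)
        (hu.continuousAt.mono_left nhdsWithin_le_nhds) hfr
    rw [htan.1] at e0
    have hd := hasDerivWithinAt_iff_tendsto_slope.1 htan.2
    have hd' := hasDerivWithinAt_iff_tendsto_slope.1 (hu.hasDerivWithinAt (s := I))
    have := tendsto_nhds_unique_of_frequently_eq hd hd' (hfr.mono fun t ht => by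
      rw [slope_def_field, slope_def_field, ht, htan.1, ← e0])
    exact (flow_ne_zero (k := k) (t := t₁) (Or.inl h0)).elim (fun h => h e0.symm)
      fun h => h this.symm

/-- Connectedness of `I`: the set of points near which the curves agree contains `0` and is open and
closed. -/
theorem IsBrokenOrbit.eq_of_isFilippovGeodesicOn
    (hH : ContDiffOn ℝ ∞ H {X | 0 < surfaceFactor Λ X})
    (hHs : ContDiffOn ℝ ∞ Hs {X | 0 < surfaceFactor Λ X})
    (hglue : 0 < Λ → ∀ X : Plane, X ≠ 0 →
      Hs X = Λ / 12 * planeSq X * H ((12 / (Λ * planeSq X)) • X))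
    (hw : IsBrokenOrbit Λ H Hs k b w)
    (h0 : b.1.1 0 ≠ 0) {I : Set ℝ} {c : ℝ → Spacetime Λ} (hI : I.OrdConnected) (h0I : 0 ∈ I)
    (hc : IsFilippovGeodesicOn Λ H Hs I c) (hc0 : (c 0).1 = b.1)
    (hc1 : HasDerivWithinAt (fun t => (c t).1) b.2 I 0) {t : ℝ} (ht : t ∈ I) :
    (c t).1 = (w t).1 := by
  -- A second point of `I` is what makes derivatives within `I` at `0` unique; for `t = 0` the
  -- initial position is enough.
  rcases eq_or_ne t 0 with rfl | hne
  · rw [hc0, hw.zero]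
  have hw0 : ∀ᶠ s in 𝓝[I] 0, w s = flow k s b := by
    filter_upwards [(hw.eventually_eq 0).filter_mono nhdsWithin_le_nhds] with s hs
    rw [hs, hw.zero, brokenFlow_of_ne h0, sub_zero]
  -- The start lies off the wave surface, so the tangential case is excluded and the local state is
  -- the pair of initial position and velocity.
  have initial : ∀ᶠ s in 𝓝[I] 0, (c s).1 = (w s).1 := by
    rcases isBrokenOrbitNear_or_tangent hH hHs hglue hI hc h0I with
      ⟨k', b', hb', hb0', hloc⟩ | htan
    · have e1 : (c 0).1 = (brokenFlow Λ H Hs k' (0 - 0) b').1 := hloc.self_of_nhdsWithin h0I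
      have hb0 : b'.1.1 0 ≠ 0 := by
        have := brokenFlow_fst_apply_zero (Λ := Λ) (H := H) (Hs := Hs) (k := k') (b := b') (0 - 0)
        rw [← e1, hc0, sub_zero, flow_zero] at this
        rwa [← this]
      have hloc' : ∀ᶠ s in 𝓝[I] 0, (c s).1 = (flow k' s b').1 := by
        filter_upwards [hloc] with s hs
        rw [hs, brokenFlow_of_ne hb0, sub_zero]
      have e2 := hloc'.self_of_nhdsWithin h0I
      have d := (hasDerivAt_flow_fst k' 0 b').hasDerivWithinAt (s := I)
      rw [flow_zero] at d e2
      have e3 := (hI.uniqueDiffWithinAt h0I ht hne.symm).eq_deriv _ hc1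
        (d.congr_of_eventuallyEq hloc' (by rw [e2, flow_zero]))
      have hbb : b' = b := Prod.ext (by rw [← e2, hc0]) e3.symm
      have hkk : k' = k := by
        rw [← hb'.speed, hbb]
        have := (hw.isState 0).speed
        rwa [hw.zero] at this
      subst hbb hkk
      filter_upwards [hloc', hw0] with s h1 h2
      rw [h1, h2]
    · exact absurd htan.1 (by rwa [hc0])
  have : PreconnectedSpace I := Subtype.preconnectedSpace hI.isPreconnected
  set A : Set I := {t | ∀ᶠ s in 𝓝[I] (t : ℝ), (c s).1 = (w s).1} with hA
  have hopen : IsOpen A := isOpen_iff_eventually.2 fun t ht =>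
    (eventually_nhds_subtype_iff I t fun t => ∀ᶠ s in 𝓝[I] t, (c s).1 = (w s).1).2
      (eventually_eventually_nhdsWithin.2 ht)
  have hclosed : IsClosed A := isClosed_iff_frequently.2 fun t ht => by
    refine hw.eventually_eq_of_frequently hH hHs hglue h0 hI hc t.2 fun hn => ht ?_
    exact (eventually_nhds_subtype_iff I t fun t => ¬ ∀ᶠ s in 𝓝[I] t, (c s).1 = (w s).1).2 hn
  have huniv : A = univ := IsClopen.eq_univ ⟨hclosed, hopen⟩ ⟨⟨0, h0I⟩, initial⟩
  have hmem : ∀ᶠ s in 𝓝[I] t, (c s).1 = (w s).1 :=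
    show (⟨t, ht⟩ : I) ∈ A from huniv ▸ mem_univ _
  exact hmem.self_of_nhdsWithin ht

end

end ImpulsiveWave

end

/-! ### Completeness and uniqueness of the geodesics. -/

open ImpulsiveWave in
theorem theorem3p5 (Λ : ℝ) (H Hs : Plane → ℝ)
    (hH : ContDiffOn ℝ ∞ H {X | 0 < surfaceFactor Λ X})
    (hHs : ContDiffOn ℝ ∞ Hs {X | 0 < surfaceFactor Λ X})
    (hglue : 0 < Λ → ∀ X : Plane, X ≠ 0 →
      Hs X = Λ / 12 * planeSq X * H ((12 / (Λ * planeSq X)) • X))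
    (p : Spacetime Λ) (hp : nullU p ≠ 0) (v : Ambient) (hv : IsTangent p v) :
    ∃ γ : ℝ → Spacetime Λ,
      IsFilippovGeodesicOn Λ H Hs Set.univ γ ∧
      IsC1Curve Λ H Hs γ ∧
      HasInitialData Set.univ γ p v ∧
      ∀ (I : Set ℝ) (c : ℝ → Spacetime Λ), I.OrdConnected → 0 ∈ I →
        IsFilippovGeodesicOn Λ H Hs I c → HasInitialData I c p v →
        ∀ t ∈ I, c t = γ t := by
  have h0 : ((p.1, v) : Ambient × Ambient).1.1 0 ≠ 0 := hp
  obtain ⟨w, hw⟩ := exists_isBrokenOrbit H Hs (isState_of_isTangent hv) h0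
  have hpos : ∀ t, (w t).1.2 ^ 2 + Λ / 3 * mink (w t).1.1 (w t).1.1 = 1 := fun t => by
    have := (hw.isState t).pos
    rwa [ambientForm, ← sq] at this
  refine ⟨fun t => ⟨(w t).1, hpos t, (hw.isState t).flat⟩,
    hw.isFilippovGeodesicOn hH hHs hglue h0 fun _ => rfl,
    hw.isC1Curve hH hHs hglue h0 fun _ => rfl, ⟨Subtype.ext ?_, ?_⟩, ?_⟩
  · exact congrArg Prod.fst hw.zero
  -- Since `p` is off the wave surface, the orbit is the free flow near time zero, whose velocity
  -- there is `v`.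
  · rw [hasDerivWithinAt_univ]
    have h := hasDerivAt_flow_fst (curv Λ v) 0 (p.1, v)
    rw [flow_zero] at h
    refine h.congr_of_eventuallyEq ?_
    filter_upwards [hw.eventually_eq 0] with t ht
    rw [ht, hw.zero, brokenFlow_of_ne h0, sub_zero]
  · intro I c hI h0I hc hci t ht
    exact Subtype.ext (hw.eq_of_isFilippovGeodesicOn hH hHs hglue h0 hI h0I hc
      (congrArg Subtype.val hci.1) hci.2 ht)
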